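/- Write $\Delta_{S^2}\ge 0$ and $\Delta=-\sum_i\partial_i^2\ge 0$ for the positive Laplacians on the unit sphere $S^2$ and on $\mathbb R^3$. Let $\theta\in[0,\pi]$ be the colatitude on $S^2$, so that the upper hemisphere is $\{\theta\le\pi/2\}$. Let $0<\epsilon<1/100$, and let $P$ be a real function of $\theta\in[0,\pi/2]$ which is nondecreasing, equal to $-1/3$ for $\theta<\pi/2-2\epsilon$ and equal to $0$ for $\pi/2-\epsilon<\theta\le\pi/2$. Let $P_{ev}$ and $P_{odd}$ be the functions on $S^2$ obtained from $P$ by even, respectively odd, continuation through the equator. Let $V_{ev}$ and $V_{odd}$ be the potentials on $\mathbb R^3$ which are equal to $r^{-2}P_{ev}$, respectively $r^{-2}P_{odd}$, for $r\ge 1$ and to $+1$ for $r<1$, and put $L_{ev}=\Delta+V_{ev}$ and $L_{odd}=\Delta+V_{odd}$ on $L^2(\mathbb R^3)$ with domain $H^2(\mathbb R^3)$. Then: (i) The operator $\Delta_{S^2}+P_{ev}$ on $L^2(S^2)$ has a lowest eigenvalue, and it is less than $-1/4$. (ii) The operator $\Delta_{S^2}+P_{odd}$ on $L^2(S^2)$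 has a lowest eigenvalue, and it is at least $-1/18$; in particular it is greater than $-1/4$. (iii) $L_{odd}$ has only finitely many eigenvalues, also when they are counted with multiplicity, whereas $L_{ev}$ has infinitely many (negative) eigenvalues. (iv) For a potential $V$ on $\mathbb R^3$ and $E\in\mathbb R$ put $\Omega_V(E)=\{(x,\xi)\in\mathbb R^3\times\mathbb R^3: |\xi|^2+V(x)<-E\}$, and let $\rho$ be the reflection $(x,\xi)\mapsto(sx,s\xi)$, where $s(x_1,x_2,x_3)=(x_1,x_2,-x_3)$. For every $E\ge 0$, $\Omega_{V_{ev}}(E)$ is the disjoint union of $\Omega_{V_{odd}}(E)$ and its mirror image $\rho(\Omega_{V_{odd}}(E))$. (v) Let $\mathcal Q$ be any family of (nonempty) connected subsets of phase space $\mathbb R^3\times\mathbb R^3$ that is invariant under $\rho$, and let $M_V(E)\in\{0,1,\dots,\infty\}$ be the supremum of the numbers of pairwise disjoint members of $\mathcal Q$ contained in $\Omega_V(E)$. For every $E\ge 0$, $M_{V_{ev}}(E)=2M_{V_{odd}}(E)$, and $\Omega_{V_{ev}}(E)$ contains infinitely many pairwise disjoint members of $\mathcal Q$ if and only if $\Omega_{V_{odd}}(E)$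 does. Consequently, if $N_V(E)$ is the number, with multiplicity, of eigenvalues of $\Delta+V$ below $-E$, there is no constant $C$ such that $$N_V(E)\le C\,(M_V(E)+1)\quad\text{and}\quad M_V(E)\le C\,(N_V(E)+1)\qquad\text{for all }E>0$$ hold for both $V=V_{ev}$ and $V=V_{odd}$. (vi) Part (v) applies to images of the open unit cube $(0,1)^6$ under canonical transformations (injective smooth maps of the cube into phase space which preserve the symplectic form), whatever further conditions are placed on these maps, as long as the conditions are invariant under composition with $\rho$: for each class $\mathcal T$ of canonical transformations with $\rho\circ\Phi\in\mathcal T$ for all $\Phi\in\mathcal T$, the family of the images of the cube under members of $\mathcal T$ is a family $\mathcal Q$ as in (v). The map $\rho\circ\Phi$ is canonical whenever $\Phi$ is, so that the class of all canonical transformations qualifies. -/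

import Mathlib

open MeasureTheory Set
open scoped SchwartzMap Laplacian ContDiff ENNReal

noncomputable section

namespace HomPot

/-- Euclidean space of dimension three. -/
abbrev R3 : Type := EuclideanSpace ℝ (Fin 3)

/-- The unit sphere of `ℝ³`; it carries the surface measure `(volume : Measure R3).toSphere`. -/
abbrev S2 : Type := Metric.sphere (0 : R3) 1

/-- The surface measure on the unit sphere. -/
abbrev surface : Measure S2 := (volume : Measure R3).toSphere

/-! ### Angular potentials -/

/-- The colatitude `θ ∈ [0, π]`, the angle to the third coordinate axis. -/
def colatitude (p : S2) : ℝ := Real.arccos ((p : R3) 2)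

/-- Even continuation through the equator of a function of `θ ∈ [0, π/2]`. -/
def evenExt (P : ℝ → ℝ) (p : S2) : ℝ :=
  if colatitude p ≤ Real.pi / 2 then P (colatitude p) else P (Real.pi - colatitude p)

/-- Odd continuation through the equator of a function of `θ ∈ [0, π/2]`. -/
def oddExt (P : ℝ → ℝ) (p : S2) : ℝ :=
  if colatitude p ≤ Real.pi / 2 then P (colatitude p) else -P (Real.pi - colatitude p)

/-! ### The operator `Δ + P` on `L²(S²)` -/

/-- Radial projection of a nonzero vector onto the unit sphere. -/
def radialProj (x : R3) (hx : x ≠ 0) : S2 :=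
  ⟨‖x‖⁻¹ • x, by simp [norm_smul, hx]⟩

open Classical in
/-- The extension of a function on the sphere that is homogeneous of degree `0`
(with the value `0` at the origin). -/
def radialExt (φ : S2 → ℂ) (x : R3) : ℂ :=
  if hx : x = 0 then 0 else φ (radialProj x hx)

/-- Smooth functions on the sphere. -/
def SmoothOnSphere (φ : S2 → ℂ) : Prop :=
  ContDiffOn ℝ ∞ (radialExt φ) {0}ᶜ

/-- The positive Laplace–Beltrami operator of the round sphere on smooth functions: minus the
Euclidean Laplacian of the extension that is constant along rays, restricted to the sphere. -/
def sphereLaplacian (φ : S2 → ℂ) (p : S2) : ℂ :=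
  -(Laplacian.laplacian (radialExt φ) (p : R3))

/-- `u ∈ L²(S²)` lies in the domain of the (self-adjoint, positive) operator `Δ` on `L²(S²)` and
`Δ u = w`: the identity holds in the sense of distributions. -/
def HasSphereLaplacian (u w : Lp ℂ 2 surface) : Prop :=
  ∀ φ : S2 → ℂ, SmoothOnSphere φ →
    ∫ p, u p * sphereLaplacian φ p ∂surface = ∫ p, w p * φ p ∂surface

/-- `u` is an eigenfunction of `Δ + P` on `L²(S²)` with eigenvalue `μ`. -/
def IsSphereEigenfunction (P : S2 → ℝ) (μ : ℝ) (u : Lp ℂ 2 surface) : Prop :=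
  u ≠ 0 ∧ ∃ w : Lp ℂ 2 surface, HasSphereLaplacian u w ∧
    ∀ᵐ p ∂surface, w p + (P p : ℂ) * u p = (μ : ℂ) * u p

/-- The eigenvalues of `Δ + P` on `L²(S²)`. -/
def sphereEigenvalues (P : S2 → ℝ) : Set ℝ :=
  {μ | ∃ u, IsSphereEigenfunction P μ u}

/-! ### Schrödinger operators on `L²(ℝ³)` -/

open Classical in
/-- The potential equal to `r⁻² P` for `r ≥ 1` and to `1` for `r < 1`. -/
def potential (P : S2 → ℝ) (x : R3) : ℝ :=
  if hx : x = 0 then 1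
  else if 1 ≤ ‖x‖ then (‖x‖ ^ 2)⁻¹ * P (radialProj x hx) else 1

/-- `u` is an eigenfunction, with eigenvalue `lam`, of the operator `Δ + V` with domain `H²(ℝ³)`,
where `Δ` is the positive Laplacian. -/
def IsEigenfunction (V : R3 → ℝ) (lam : ℝ) (u : Lp ℂ 2 (volume : Measure R3)) : Prop :=
  u ≠ 0 ∧ TemperedDistribution.MemSobolev 2 2 (u : 𝓢'(R3, ℂ)) ∧
    ∃ w : Lp ℂ 2 (volume : Measure R3),
      -(Laplacian.laplacian (u : 𝓢'(R3, ℂ))) = (w : 𝓢'(R3, ℂ)) ∧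
      ∀ᵐ x, w x + (V x : ℂ) * u x = (lam : ℂ) * u x

/-- The eigenvalues of `Δ + V` on `L²(ℝ³)`. -/
def eigenvalues (V : R3 → ℝ) : Set ℝ :=
  {lam | ∃ u, IsEigenfunction V lam u}

/-- The number of eigenvalues of `Δ + V` below `-E`, counted with multiplicity. -/
def countBelow (V : R3 → ℝ) (E : ℝ) : ℕ∞ :=
  Cardinal.toENat (Module.rank ℂ
    (Submodule.span ℂ {u : Lp ℂ 2 (volume : Measure R3) | ∃ lam < -E, IsEigenfunction V lam u}))

/-! ### Phase space -/

/-- Phase space `ℝ³ × ℝ³`, with points `(x, ξ)`. -/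
abbrev Phase : Type := R3 × R3

/-- The part of phase space where the symbol `|ξ|² + V(x)` of `Δ + V` is less than `-E`. -/
def region (V : R3 → ℝ) (E : ℝ) : Set Phase :=
  {z | ‖z.2‖ ^ 2 + V z.1 < -E}

/-- Reflection of `ℝ³` in the plane of the equator. -/
def reflect (x : R3) : R3 := !₂[x 0, x 1, -x 2]

/-- The canonical transformation induced by the reflection in the plane of the equator. -/
def phaseReflect (z : Phase) : Phase := (reflect z.1, reflect z.2)

/-- The open unit cube in phase space. -/
def unitCube : Set Phase :=
  {z | ∀ i, z.1 i ∈ Ioo (0 : ℝ) 1 ∧ z.2 i ∈ Ioo (0 : ℝ) 1}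

/-- The standard symplectic form. -/
def symplecticForm (v w : Phase) : ℝ := inner ℝ v.1 w.2 - inner ℝ v.2 w.1

/-- Canonical transformations defined on the unit cube: injective smooth maps into phase space
preserving the symplectic form. -/
def IsCanonical (Φ : Phase → Phase) : Prop :=
  ContDiffOn ℝ ∞ Φ unitCube ∧ InjOn Φ unitCube ∧
    ∀ z ∈ unitCube, ∀ v w, symplecticForm (fderiv ℝ Φ z v) (fderiv ℝ Φ z w) = symplecticForm v w

/-- A family of admissible test regions: connected subsets of phase space, the family being
invariant under the reflection in the plane of the equator. -/
def IsTestFamily (𝒬 : Set (Set Phase)) : Prop :=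
  (∀ Q ∈ 𝒬, IsConnected Q) ∧ ∀ Q ∈ 𝒬, phaseReflect '' Q ∈ 𝒬

/-- `𝒮` is a collection of pairwise disjoint members of `𝒬` contained in `R`. -/
def IsPacking (𝒬 : Set (Set Phase)) (R : Set Phase) (𝒮 : Set (Set Phase)) : Prop :=
  𝒮 ⊆ 𝒬 ∧ (∀ Q ∈ 𝒮, Q ⊆ R) ∧ 𝒮.PairwiseDisjoint id

/-- The maximal number of disjoint members of `𝒬` that fit into `R`. -/
def packingNumber (𝒬 : Set (Set Phase)) (R : Set Phase) : ℕ∞ :=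
  ⨆ 𝒮 ∈ {𝒮 | IsPacking 𝒬 R 𝒮}, 𝒮.encard

/-- The counting function of `Δ + V` and the number of disjoint members of `𝒬` that fit into the
region where the symbol is less than `-E` bound each other, up to the constant `C`. -/
def PackingEstimate (𝒬 : Set (Set Phase)) (V : R3 → ℝ) (C : ℕ) : Prop :=
  ∀ E : ℝ, 0 < E →
    countBelow V E ≤ C * (packingNumber 𝒬 (region V E) + 1) ∧
    packingNumber 𝒬 (region V E) ≤ C * (countBelow V E + 1)

end HomPot

end

namespace HomPot

section Abstract

open Filter Topology
open scoped InnerProductSpace NNReal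

variable {H : Type*} [NormedAddCommGroup H] [InnerProductSpace ℂ H]

theorem inner_self_ofReal (x : H) : ⟪x, x⟫_ℂ = ((‖x‖ ^ 2 : ℝ) : ℂ) := by
  rw [inner_self_eq_norm_sq_to_K]
  push_cast
  rfl

/-- A symmetric operator with `0 ≤ S ≤ m` satisfies `S² ≤ m S`. -/
theorem norm_sq_apply_le {S : H →L[ℂ] H} (hS : (S : H →ₗ[ℂ] H).IsSymmetric) {m : ℝ} (hm : 0 < m)
    (h0 : ∀ x, 0 ≤ (⟪S x, x⟫_ℂ).re) (h1 : ∀ x, (⟪S x, x⟫_ℂ).re ≤ m * ‖x‖ ^ 2) (x : H) :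
    ‖S x‖ ^ 2 ≤ m * (⟪S x, x⟫_ℂ).re := by
  have hxy : ∀ y, (⟪S (S x), y⟫_ℂ) = ⟪S x, S y⟫_ℂ := fun y => hS (S x) y
  have h2 := h0 (x - ((m⁻¹ : ℝ) : ℂ) • S x)
  have h3 := h1 (S x)
  have h4 : (⟪S (x - ((m⁻¹ : ℝ) : ℂ) • S x), x - ((m⁻¹ : ℝ) : ℂ) • S x⟫_ℂ).re =
      (⟪S x, x⟫_ℂ).re - 2 * m⁻¹ * ‖S x‖ ^ 2 + m⁻¹ ^ 2 * (⟪S (S x), S x⟫_ℂ).re := by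
    simp only [map_sub, map_smul, inner_sub_left, inner_sub_right, inner_smul_left,
      inner_smul_right, hxy x, inner_self_ofReal, Complex.conj_ofReal]
    simp only [Complex.sub_re, Complex.re_ofReal_mul, Complex.ofReal_re]
    ring
  rw [h4] at h2
  have h5 : m⁻¹ ^ 2 * (⟪S (S x), S x⟫_ℂ).re ≤ m⁻¹ * ‖S x‖ ^ 2 := by
    calc m⁻¹ ^ 2 * (⟪S (S x), S x⟫_ℂ).re ≤ m⁻¹ ^ 2 * (m * ‖S x‖ ^ 2) := by gcongr
      _ = _ := by field_simp
  have h6 : m⁻¹ * ‖S x‖ ^ 2 ≤ (⟪S x, x⟫_ℂ).re := by linarith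
  rwa [inv_mul_le_iff₀ hm] at h6

variable [CompleteSpace H]

/-- Approximate eigenvectors of `T + C`, above the upper bound `τ` of `T`, have a convergent
subsequence if `C` is compact. -/
theorem exists_subseq_tendsto {T C : H →L[ℂ] H} {τ κ : ℝ}
    (hT : ∀ x, (⟪T x, x⟫_ℂ).re ≤ τ * ‖x‖ ^ 2) (hC : IsCompactOperator C) (hκ : τ < κ)
    {x : ℕ → H} {R : ℝ} (hx : ∀ n, ‖x n‖ ≤ R)
    (hlim : Tendsto (fun n => (κ : ℂ) • x n - (T (x n) + C (x n))) atTop (𝓝 0)) :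
    ∃ y, ∃ φ : ℕ → ℕ, StrictMono φ ∧ Tendsto (x ∘ φ) atTop (𝓝 y) := by
  obtain ⟨K, hK, hCK⟩ := IsCompactOperator.image_closedBall_subset_compact (f := (C : H →ₗ[ℂ] H)) hC R
  obtain ⟨z, -, φ, hφ, hz⟩ := hK.tendsto_subseq (x := fun n => C (x n))
    (fun n => hCK ⟨x n, by simpa using hx n, rfl⟩)
  let S : H →L[ℂ] H := (κ : ℂ) • ContinuousLinearMap.id ℂ H - T
  have hS : ∀ v, ‖v‖ ^ 2 * ((Real.toNNReal (κ - τ) : ℝ≥0) : ℝ) ≤ ‖⟪S v, v⟫_ℂ‖ := by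
    intro v
    rw [Real.coe_toNNReal _ (by linarith)]
    refine le_trans ?_ (Complex.re_le_norm _)
    have : (⟪S v, v⟫_ℂ).re = κ * ‖v‖ ^ 2 - (⟪T v, v⟫_ℂ).re := by
      simp only [S, sub_apply, smul_apply,
        ContinuousLinearMap.id_apply, inner_sub_left, inner_smul_left, Complex.conj_ofReal,
        inner_self_ofReal, Complex.sub_re, Complex.re_ofReal_mul, Complex.ofReal_re]
    rw [this]
    linarith [hT v]
  have hanti := ContinuousLinearMap.antilipschitz_of_forall_le_inner_map S
    (by simpa using hκ : 0 < Real.toNNReal (κ - τ)) hS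
  have hemb := hanti.isClosedEmbedding S.uniformContinuous
  have hSx : Tendsto (fun n => S (x (φ n))) atTop (𝓝 z) := by
    have := (hlim.comp hφ.tendsto_atTop).add hz
    rw [zero_add] at this
    refine this.congr fun n => ?_
    simp only [Function.comp_apply, S, sub_apply, smul_apply, ContinuousLinearMap.id_apply]
    abel
  obtain ⟨y, hy⟩ : z ∈ range S :=
    hemb.isClosed_range.mem_of_tendsto hSx (Eventually.of_forall fun n => mem_range_self _)
  refine ⟨y, φ, hφ, ?_⟩
  rw [hemb.isEmbedding.tendsto_nhds_iff, hy]
  exact hSx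

/-- The upper bound of a symmetric operator `T + C` with `C` compact is attained if it exceeds the
upper bound of `T`. -/
theorem exists_max_eigenvector {A T C : H →L[ℂ] H} (hA : (A : H →ₗ[ℂ] H).IsSymmetric) {τ : ℝ}
    (hT : ∀ x, (⟪T x, x⟫_ℂ).re ≤ τ * ‖x‖ ^ 2) (hC : IsCompactOperator C) (hATC : A = T + C)
    {x₀ : H} (hx₀ : τ * ‖x₀‖ ^ 2 < (⟪A x₀, x₀⟫_ℂ).re) :
    ∃ a : ℝ, τ < a ∧ (∃ x, x ≠ 0 ∧ A x = (a : ℂ) • x) ∧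
      ∀ x, (⟪A x, x⟫_ℂ).re ≤ a * ‖x‖ ^ 2 := by
  have hx₀0 : x₀ ≠ 0 := by rintro rfl; simp at hx₀
  let Q : Set ℝ := (fun x => (⟪A x, x⟫_ℂ).re) '' Metric.sphere 0 1
  have hQb : BddAbove Q := by
    refine ⟨‖A‖, ?_⟩
    rintro _ ⟨x, hx, rfl⟩
    have hx1 : ‖x‖ = 1 := by simpa using hx
    calc (⟪A x, x⟫_ℂ).re ≤ ‖⟪A x, x⟫_ℂ‖ := Complex.re_le_norm _
      _ ≤ ‖A x‖ * ‖x‖ := norm_inner_le_norm _ _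
      _ ≤ ‖A‖ := by simpa [hx1] using A.le_opNorm x
  have hscale : ∀ x : H, x ≠ 0 → ∃ e ∈ Metric.sphere (0 : H) 1,
      (⟪A x, x⟫_ℂ).re = (⟪A e, e⟫_ℂ).re * ‖x‖ ^ 2 := by
    intro x hx
    have hn : ‖x‖ ≠ 0 := by simpa using hx
    refine ⟨((‖x‖⁻¹ : ℝ) : ℂ) • x, by simp [norm_smul, hn], ?_⟩
    rw [map_smul, inner_smul_left, inner_smul_right, Complex.conj_ofReal, Complex.re_ofReal_mul,
      Complex.re_ofReal_mul]
    field_simp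
  obtain ⟨e₀, he₀, hxe₀⟩ := hscale x₀ hx₀0
  have hne : Q.Nonempty := ⟨_, e₀, he₀, rfl⟩
  set a := sSup Q with ha
  have hup : ∀ x, (⟪A x, x⟫_ℂ).re ≤ a * ‖x‖ ^ 2 := by
    intro x
    by_cases hx : x = 0
    · simp [hx]
    obtain ⟨e, he, hxe⟩ := hscale x hx
    rw [hxe]
    gcongr
    exact le_csSup hQb ⟨e, he, rfl⟩
  have hτa : τ < a := by
    have h1 : τ < (⟪A e₀, e₀⟫_ℂ).re := by
      rw [hxe₀] at hx₀
      exact lt_of_mul_lt_mul_right hx₀ (by positivity)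
    exact h1.trans_le (le_csSup hQb ⟨e₀, he₀, rfl⟩)
  obtain ⟨u, -, hu, huQ⟩ := exists_seq_tendsto_sSup hne hQb
  choose x hx hxu using huQ
  have hx1 : ∀ n, ‖x n‖ = 1 := fun n => by simpa using hx n
  let S : H →L[ℂ] H := (a : ℂ) • ContinuousLinearMap.id ℂ H - A
  have hSsym : (S : H →ₗ[ℂ] H).IsSymmetric := by
    intro v w
    have := hA v w
    simp only [ContinuousLinearMap.coe_coe] at this
    simp only [S, ContinuousLinearMap.coe_coe, sub_apply, smul_apply,
      ContinuousLinearMap.id_apply, inner_sub_left, inner_sub_right, inner_smul_left,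
      inner_smul_right, Complex.conj_ofReal, this]
  have hSre : ∀ v, (⟪S v, v⟫_ℂ).re = a * ‖v‖ ^ 2 - (⟪A v, v⟫_ℂ).re := by
    intro v
    simp only [S, sub_apply, smul_apply,
      ContinuousLinearMap.id_apply, inner_sub_left, inner_smul_left, Complex.conj_ofReal,
      inner_self_ofReal, Complex.sub_re, Complex.re_ofReal_mul, Complex.ofReal_re]
  have hSle : ∀ v, ‖S v‖ ^ 2 ≤ (‖S‖ + 1) * (⟪S v, v⟫_ℂ).re := by
    refine norm_sq_apply_le hSsym (by positivity) (fun v => ?_) (fun v => ?_)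
    · rw [hSre]; linarith [hup v]
    · calc (⟪S v, v⟫_ℂ).re ≤ ‖⟪S v, v⟫_ℂ‖ := Complex.re_le_norm _
        _ ≤ ‖S v‖ * ‖v‖ := norm_inner_le_norm _ _
        _ ≤ (‖S‖ * ‖v‖) * ‖v‖ := by gcongr; exact S.le_opNorm v
        _ ≤ (‖S‖ + 1) * ‖v‖ ^ 2 := by nlinarith [norm_nonneg v]
  have hS0 : Tendsto (fun n => S (x n)) atTop (𝓝 0) := by
    have h1 : Tendsto (fun n => (‖S‖ + 1) * (a - u n)) atTop (𝓝 0) := by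
      have := (tendsto_const_nhds (x := a)).sub hu
      simpa [← ha] using this.const_mul (‖S‖ + 1)
    have h2 : Tendsto (fun n => ‖S (x n)‖ ^ 2) atTop (𝓝 0) := by
      refine squeeze_zero (fun n => by positivity) (fun n => ?_) h1
      refine (hSle (x n)).trans (le_of_eq ?_)
      rw [hSre, hx1, ← hxu n]
      simp
    have h3 := h2.sqrt
    rw [Real.sqrt_zero] at h3
    simp only [Real.sqrt_sq (norm_nonneg _)] at h3
    exact tendsto_zero_iff_norm_tendsto_zero.2 h3
  obtain ⟨y, φ, hφ, hy⟩ := exists_subseq_tendsto hT hC hτa (fun n => (hx1 n).le)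
    (by simpa [S, hATC] using hS0)
  refine ⟨a, hτa, ⟨y, ?_, ?_⟩, hup⟩
  · rintro rfl
    have := hy.norm
    simp [hx1] at this
  · have h1 : Tendsto (fun n => S (x (φ n))) atTop (𝓝 (S y)) := (S.continuous.tendsto y).comp hy
    have h2 := tendsto_nhds_unique h1 (hS0.comp hφ.tendsto_atTop)
    have h3 : (a : ℂ) • y - A y = 0 := by simpa [S] using h2
    exact (sub_eq_zero.1 h3).symm

/-- The eigenspaces of `T + C` above the upper bound of `T` are finite-dimensional. -/
theorem finiteDimensional_eigenspace_of_lt {A T C : H →L[ℂ] H} {τ κ : ℝ}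
    (hT : ∀ x, (⟪T x, x⟫_ℂ).re ≤ τ * ‖x‖ ^ 2) (hC : IsCompactOperator C) (hATC : A = T + C)
    (hκ : τ < κ) : FiniteDimensional ℂ (Module.End.eigenspace (A : H →ₗ[ℂ] H) (κ : ℂ)) := by
  set E := Module.End.eigenspace (A : H →ₗ[ℂ] H) (κ : ℂ)
  refine FiniteDimensional.of_isCompact_closedBall₀ ℂ (r := 1) one_pos ?_
  rw [isCompact_iff_isSeqCompact]
  intro x hx
  have hx1 : ∀ n, ‖(x n : H)‖ ≤ 1 := fun n => by simpa using hx n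
  have hxe : ∀ n, A (x n) = (κ : ℂ) • (x n : H) := fun n =>
    Module.End.mem_eigenspace_iff.1 (x n).2
  obtain ⟨y, φ, hφ, hy⟩ := exists_subseq_tendsto hT hC hκ (x := fun n => (x n : H)) hx1
    (by
      have : ∀ n, (κ : ℂ) • (x n : H) - (T (x n) + C (x n)) = 0 := by
        intro n
        rw [← hxe, hATC]; simp
      simp only [this, tendsto_const_nhds])
  have hyE : y ∈ E := by
    refine Module.End.mem_eigenspace_iff.2 ?_
    refine tendsto_nhds_unique ((A.continuous.tendsto y).comp hy) ?_
    refine (hy.const_smul (κ : ℂ)).congr fun n => ?_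
    simp [hxe]
  refine ⟨⟨y, hyE⟩, ?_, φ, hφ, ?_⟩
  · have : ‖y‖ ≤ 1 := le_of_tendsto hy.norm (Eventually.of_forall fun n => hx1 _)
    simpa using this
  · exact tendsto_subtype_rng.2 hy

/-- If a nonnegative symmetric operator `A = T + C`, with `C` compact and `T ≤ τ`, satisfies
`⟨A y, y⟩ < τ⁻¹ ‖A y‖²` for suitable `y` orthogonal to any given finite-dimensional subspace, then
it has infinitely many eigenvalues above `τ`. -/
theorem infinite_eigenvalues {A T C : H →L[ℂ] H} (hA : (A : H →ₗ[ℂ] H).IsSymmetric)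
    (hA0 : ∀ x, 0 ≤ (⟪A x, x⟫_ℂ).re) {τ : ℝ} (hτ : 0 < τ)
    (hT : ∀ x, (⟪T x, x⟫_ℂ).re ≤ τ * ‖x‖ ^ 2) (hC : IsCompactOperator C) (hATC : A = T + C)
    (hN : ∀ W : Submodule ℂ H, FiniteDimensional ℂ W → ∃ y ∈ Wᗮ,
      τ * (⟪A y, y⟫_ℂ).re < ‖A y‖ ^ 2) :
    {κ : ℝ | τ < κ ∧ ∃ x, x ≠ 0 ∧ A x = (κ : ℂ) • x}.Infinite := by
  intro hfin
  set F := {κ : ℝ | τ < κ ∧ ∃ x, x ≠ 0 ∧ A x = (κ : ℂ) • x} with hF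
  let W : Submodule ℂ H := ⨆ κ : F, Module.End.eigenspace (A : H →ₗ[ℂ] H) ((κ : ℝ) : ℂ)
  have : Finite F := hfin
  have hWκ : ∀ κ : F, FiniteDimensional ℂ
      (Module.End.eigenspace (A : H →ₗ[ℂ] H) ((κ : ℝ) : ℂ)) := fun κ =>
    finiteDimensional_eigenspace_of_lt hT hC hATC κ.2.1
  have hW : FiniteDimensional ℂ W := Submodule.finiteDimensional_iSup _
  have hAW : ∀ v ∈ Wᗮ, A v ∈ Wᗮ := by
    intro v hv
    rw [← Submodule.iInf_orthogonal, Submodule.mem_iInf] at hv ⊢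
    intro κ w hw
    have h1 := hA w v
    simp only [ContinuousLinearMap.coe_coe] at h1
    have h2 : A w = ((κ : ℝ) : ℂ) • w := Module.End.mem_eigenspace_iff.1 hw
    rw [← h1, h2, inner_smul_left, hv κ w hw, mul_zero]
  let P : H →L[ℂ] H := Wᗮ.starProjection
  have hPW : ∀ v, P v ∈ Wᗮ := fun v => Submodule.starProjection_apply_mem _ v
  have hPfix : ∀ v ∈ Wᗮ, P v = v := fun v hv => Submodule.starProjection_eq_self_iff.2 hv
  have hPsym : ∀ v w, ⟪P v, w⟫_ℂ = ⟪v, P w⟫_ℂ := fun v w =>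
    Submodule.inner_starProjection_left_eq_right _ v w
  have hPle : ∀ v, ‖P v‖ ≤ ‖v‖ := fun v => Submodule.norm_starProjection_apply_le _ v
  obtain ⟨y, hyW, hy⟩ := hN W hW
  have hle : ∀ x, (⟪(P ∘L A ∘L P) x, x⟫_ℂ).re ≤ τ * ‖x‖ ^ 2 := by
    by_contra! hcon
    obtain ⟨x₀, hx₀⟩ := hcon
    obtain ⟨a, ha, ⟨x, hx, hax⟩, -⟩ := exists_max_eigenvector (A := P ∘L A ∘L P)
      (T := P ∘L T ∘L P) (C := P ∘L C ∘L P) (τ := τ)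
      (by
        intro v w
        have := hA (P v) (P w)
        simp only [ContinuousLinearMap.coe_coe] at this
        simp only [ContinuousLinearMap.coe_coe, ContinuousLinearMap.comp_apply]
        rw [hPsym, this, ← hPsym])
      (by
        intro v
        simp only [ContinuousLinearMap.comp_apply]
        rw [hPsym]
        refine (hT _).trans ?_
        gcongr
        exact hPle v)
      ((hC.comp_clm P).clm_comp P) (by rw [hATC]; ext v; simp) hx₀
    have ha0 : (a : ℂ) ≠ 0 := by exact_mod_cast (hτ.trans ha).ne'
    have hxW : x ∈ Wᗮ := by
      have h1 : (a : ℂ) • x ∈ Wᗮ := by rw [← hax]; exact hPW _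
      have h2 := Wᗮ.smul_mem (a : ℂ)⁻¹ h1
      rwa [smul_smul, inv_mul_cancel₀ ha0, one_smul] at h2
    have hAx : A x = (a : ℂ) • x := by
      rw [← hax]
      simp only [ContinuousLinearMap.comp_apply]
      rw [hPfix x hxW, hPfix _ (hAW x hxW)]
    have hxW' : x ∈ W := by
      have haF : a ∈ F := ⟨ha, x, hx, hAx⟩
      exact Submodule.mem_iSup_of_mem (p := fun κ : F =>
        Module.End.eigenspace (A : H →ₗ[ℂ] H) ((κ : ℝ) : ℂ)) ⟨a, haF⟩
        (Module.End.mem_eigenspace_iff.2 hAx)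
    exact hx (by
      have := Submodule.inner_right_of_mem_orthogonal hxW' hxW
      exact inner_self_eq_zero.1 this)
  have h1 := norm_sq_apply_le (S := P ∘L A ∘L P)
    (by
      intro v w
      have := hA (P v) (P w)
      simp only [ContinuousLinearMap.coe_coe] at this
      simp only [ContinuousLinearMap.coe_coe, ContinuousLinearMap.comp_apply]
      rw [hPsym, this, ← hPsym]) hτ
    (fun v => by simp only [ContinuousLinearMap.comp_apply]; rw [hPsym]; exact hA0 _) hle y
  simp only [ContinuousLinearMap.comp_apply] at h1
  rw [hPfix y hyW, hPfix _ (hAW y hyW)] at h1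
  linarith

end Abstract

end HomPot

namespace HomPot

section Resolvent

open Filter Topology
open scoped InnerProductSpace

variable {H : Type*} [NormedAddCommGroup H] [InnerProductSpace ℂ H] [CompleteSpace H]

/-- If `T` is the inverse of a selfadjoint operator `A ≥ c` and `M` is a bounded symmetric operator
of norm less than `c`, then `A + M` has a nonnegative bounded inverse. -/
theorem exists_resolvent {T M : H →L[ℂ] H} (hT : (T : H →ₗ[ℂ] H).IsSymmetric)
    (hM : (M : H →ₗ[ℂ] H).IsSymmetric) {c m : ℝ} (hm : 0 ≤ m) (hmc : m < c)
    (hTc : ∀ z, c * ‖T z‖ ^ 2 ≤ (⟪T z, z⟫_ℂ).re) (hMm : ∀ u, ‖M u‖ ≤ m * ‖u‖) :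
    ∃ K : H →L[ℂ] H, (K : H →ₗ[ℂ] H).IsSymmetric ∧ (∀ x, 0 ≤ (⟪K x, x⟫_ℂ).re) ∧
      (∀ y u, u = K y ↔ u = T (y - M u)) ∧ (IsCompactOperator T → IsCompactOperator K) ∧
      (IsCompactOperator (M ∘L T) → IsCompactOperator (K - T)) := by
  have hc : 0 < c := hm.trans_lt hmc
  have hTn : ∀ z, ‖T z‖ ≤ c⁻¹ * ‖z‖ := by
    intro z
    have h1 : c * ‖T z‖ ^ 2 ≤ ‖T z‖ * ‖z‖ :=
      (hTc z).trans ((Complex.re_le_norm _).trans (norm_inner_le_norm _ _))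
    rcases (norm_nonneg (T z)).eq_or_lt with h | h
    · rw [← h]; positivity
    · rw [le_inv_mul_iff₀ hc]
      nlinarith
  have hlt : ‖-(M * T)‖ < 1 := by
    rw [norm_neg]
    refine (ContinuousLinearMap.opNorm_le_bound _ (M := m * c⁻¹) (by positivity)
      fun z => ?_).trans_lt ?_
    · calc ‖M (T z)‖ ≤ m * ‖T z‖ := hMm _
        _ ≤ m * (c⁻¹ * ‖z‖) := by gcongr; exact hTn z
        _ = _ := by ring
    · rwa [← div_eq_mul_inv, div_lt_one hc]
  let U : (H →L[ℂ] H)ˣ := Units.oneSub (-(M * T)) hlt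
  let N : H →L[ℂ] H := ↑U⁻¹
  have hU : ∀ z, (U : H →L[ℂ] H) z = z + M (T z) := by
    intro z
    simp [U]
  have hNU : ∀ z, N (z + M (T z)) = z := by
    intro z
    rw [← hU]
    have : (N * (U : H →L[ℂ] H)) z = z := by simp [N]
    exact this
  have hUN : ∀ y, N y + M (T (N y)) = y := by
    intro y
    rw [← hU]
    have : ((U : H →L[ℂ] H) * N) y = y := by simp [N]
    exact this
  have hK : ∀ y u, u = (T ∘L N) y ↔ u = T (y - M u) := by
    intro y u
    constructor
    · rintro rfl
      conv_lhs => rw [ContinuousLinearMap.comp_apply]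
      congr 1
      have := hUN y
      simp only [ContinuousLinearMap.comp_apply]
      exact eq_sub_of_add_eq this
    · intro h
      rw [ContinuousLinearMap.comp_apply]
      have h1 : N y = y - M u := by
        rw [← hNU (y - M u), ← h, sub_add_cancel]
      rw [h1, ← h]
  have hK' : ∀ y, (T ∘L N) y = T (y - M ((T ∘L N) y)) := fun y => (hK y _).1 rfl
  refine ⟨T ∘L N, ?_, ?_, hK, fun h => h.comp_clm N, ?_⟩
  · intro y y'
    simp only [ContinuousLinearMap.coe_coe]
    set u := (T ∘L N) y
    set u' := (T ∘L N) y'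
    have h1 : ⟪u, y' - M u'⟫_ℂ = ⟪y - M u, u'⟫_ℂ := by
      have := hT (y - M u) (y' - M u')
      simp only [ContinuousLinearMap.coe_coe] at this
      rwa [← hK' y, ← hK' y'] at this
    have h2 := hM u u'
    simp only [ContinuousLinearMap.coe_coe] at h2
    rw [inner_sub_right, inner_sub_left, h2] at h1
    exact sub_left_injective h1
  · intro y
    set u := (T ∘L N) y
    have h1 : ⟪u, y⟫_ℂ = ⟪u, y - M u⟫_ℂ + ⟪u, M u⟫_ℂ := by rw [← inner_add_right, sub_add_cancel]
    have h2 : c * ‖u‖ ^ 2 ≤ (⟪u, y - M u⟫_ℂ).re := by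
      have := hTc (y - M u)
      rwa [← hK' y] at this
    have h3 : -(m * ‖u‖ ^ 2) ≤ (⟪u, M u⟫_ℂ).re := by
      have h4 : |(⟪u, M u⟫_ℂ).re| ≤ m * ‖u‖ ^ 2 :=
        calc |(⟪u, M u⟫_ℂ).re| ≤ ‖⟪u, M u⟫_ℂ‖ := Complex.abs_re_le_norm _
          _ ≤ ‖u‖ * ‖M u‖ := norm_inner_le_norm _ _
          _ ≤ ‖u‖ * (m * ‖u‖) := by gcongr; exact hMm u
          _ = _ := by ring
      exact (abs_le.1 h4).1
    rw [h1, Complex.add_re]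
    nlinarith [sq_nonneg ‖u‖]
  · intro hMT
    have : T ∘L N - T = -(T ∘L ((M ∘L T) ∘L N)) := by
      ext y
      simp only [sub_apply, neg_apply, ContinuousLinearMap.comp_apply]
      rw [← map_sub, ← map_neg]
      congr 1
      rw [sub_eq_iff_eq_add, neg_add_eq_sub, eq_sub_iff_add_eq]
      exact hUN y
    rw [this]
    exact ((hMT.comp_clm N).clm_comp T).neg

/-- The largest eigenvalue of a nonzero nonnegative compact operator. -/
theorem exists_max_eigenvalue {K : H →L[ℂ] H} (hK : (K : H →ₗ[ℂ] H).IsSymmetric)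
    (hK0 : ∀ x, 0 ≤ (⟪K x, x⟫_ℂ).re) (hKc : IsCompactOperator K) {y₀ : H} (hy₀ : K y₀ ≠ 0) :
    ∃ κ : ℝ, 0 < κ ∧ (∃ x, x ≠ 0 ∧ K x = (κ : ℂ) • x) ∧
      ∀ y, ‖K y‖ ^ 2 ≤ κ * (⟪K y, y⟫_ℂ).re := by
  have h1 := norm_sq_apply_le hK (m := ‖K‖ + 1) (by positivity) hK0 (fun v => by
    calc (⟪K v, v⟫_ℂ).re ≤ ‖⟪K v, v⟫_ℂ‖ := Complex.re_le_norm _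
      _ ≤ ‖K v‖ * ‖v‖ := norm_inner_le_norm _ _
      _ ≤ (‖K‖ * ‖v‖) * ‖v‖ := by gcongr; exact K.le_opNorm v
      _ ≤ (‖K‖ + 1) * ‖v‖ ^ 2 := by nlinarith [norm_nonneg v]) y₀
  have h2 : 0 < (⟪K y₀, y₀⟫_ℂ).re := by
    have h3 : 0 < ‖K y₀‖ ^ 2 := by positivity
    exact pos_of_mul_pos_right (h3.trans_le h1) (by positivity)
  obtain ⟨κ, hκ, hx, hle⟩ := exists_max_eigenvector (A := K) (T := 0) (C := K) (τ := 0) hK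
    (by simp) hKc (by simp) (x₀ := y₀) (by simpa using h2)
  exact ⟨κ, hκ, hx, norm_sq_apply_le hK hκ hK0 hle⟩

end Resolvent

section MulOp

open scoped InnerProductSpace

variable {α : Type*} [MeasurableSpace α] {μ : Measure α} {V : α → ℝ} {C : ℝ}

theorem memLp_ofReal_mul (hV : Measurable V) (hC : ∀ x, |V x| ≤ C) (u : Lp ℂ 2 μ) :
    MemLp (fun x => (V x : ℂ) * u x) 2 μ := by
  refine MemLp.of_le_mul (Lp.memLp u) (c := C)
    ((Complex.measurable_ofReal.comp hV).aestronglyMeasurable.mul (Lp.aestronglyMeasurable u)) ?_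
  refine Filter.Eventually.of_forall fun x => ?_
  rw [norm_mul, Complex.norm_real]
  gcongr
  exact hC x

/-- Multiplication by a bounded real function on `L²`. -/
noncomputable def mulOp (μ : Measure α) (hV : Measurable V) (hC : ∀ x, |V x| ≤ C) : Lp ℂ 2 μ →L[ℂ] Lp ℂ 2 μ :=
  LinearMap.mkContinuous
    { toFun := fun u => (memLp_ofReal_mul hV hC u).toLp _
      map_add' := fun u v => by
        rw [← MemLp.toLp_add]
        refine MemLp.toLp_congr _ _ ?_
        filter_upwards [Lp.coeFn_add u v] with x hx
        rw [hx, Pi.add_apply, Pi.add_apply, mul_add]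
      map_smul' := fun c u => by
        rw [RingHom.id_apply, ← MemLp.toLp_const_smul]
        refine MemLp.toLp_congr _ _ ?_
        filter_upwards [Lp.coeFn_smul c u] with x hx
        rw [hx, Pi.smul_apply, Pi.smul_apply, smul_eq_mul, smul_eq_mul, mul_left_comm] }
    (max C 0) (fun u => by
      refine Lp.norm_le_mul_norm_of_ae_le_mul ?_
      filter_upwards [(memLp_ofReal_mul hV hC u).coeFn_toLp] with x hx
      rw [LinearMap.coe_mk, AddHom.coe_mk, hx, norm_mul, Complex.norm_real]
      gcongr
      exact (hC x).trans (le_max_left _ _))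

theorem mulOp_ae (hV : Measurable V) (hC : ∀ x, |V x| ≤ C) (u : Lp ℂ 2 μ) :
    mulOp μ hV hC u =ᵐ[μ] fun x => (V x : ℂ) * u x :=
  (memLp_ofReal_mul hV hC u).coeFn_toLp

theorem norm_mulOp_le (hV : Measurable V) (hC : ∀ x, |V x| ≤ C) (u : Lp ℂ 2 μ) :
    ‖mulOp μ hV hC u‖ ≤ C * ‖u‖ := by
  refine Lp.norm_le_mul_norm_of_ae_le_mul ?_
  filter_upwards [mulOp_ae hV hC u] with x hx
  rw [hx, norm_mul, Complex.norm_real]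
  gcongr
  exact hC x

theorem mulOp_symmetric (hV : Measurable V) (hC : ∀ x, |V x| ≤ C) :
    (mulOp μ hV hC : Lp ℂ 2 μ →ₗ[ℂ] Lp ℂ 2 μ).IsSymmetric := by
  intro u v
  simp only [ContinuousLinearMap.coe_coe, L2.inner_def]
  refine integral_congr_ae ?_
  filter_upwards [mulOp_ae hV hC u, mulOp_ae hV hC v] with x hx hx'
  rw [hx, hx']
  simp only [RCLike.inner_apply, map_mul, Complex.conj_ofReal]
  ring

theorem re_inner_mulOp (hV : Measurable V) (hC : ∀ x, |V x| ≤ C) (u : Lp ℂ 2 μ) :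
    (⟪u, mulOp μ hV hC u⟫_ℂ).re = ∫ x, V x * ‖u x‖ ^ 2 ∂μ := by
  rw [L2.inner_def, ← RCLike.re_eq_complex_re, ← integral_re (L2.integrable_inner u _)]
  refine integral_congr_ae ?_
  filter_upwards [mulOp_ae hV hC u] with x hx
  rw [hx, RCLike.inner_apply, mul_assoc, Complex.mul_conj, RCLike.re_eq_complex_re,
    Complex.normSq_eq_norm_sq, ← Complex.ofReal_mul, Complex.ofReal_re]

theorem integrable_mul_norm_sq (hV : Measurable V) (hC : ∀ x, |V x| ≤ C) (u : Lp ℂ 2 μ) :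
    Integrable (fun x => V x * ‖u x‖ ^ 2) μ := by
  have h := (Lp.memLp u).integrable_norm_pow (p := 2) (by norm_num)
  refine Integrable.bdd_mul (c := C) h hV.aestronglyMeasurable ?_
  exact Filter.Eventually.of_forall fun x => hC x

theorem norm_sq_eq_integral (u : Lp ℂ 2 μ) : ‖u‖ ^ 2 = ∫ x, ‖u x‖ ^ 2 ∂μ := by
  have h : ((‖u‖ ^ 2 : ℝ) : ℂ) = ((∫ x, ‖u x‖ ^ 2 ∂μ : ℝ) : ℂ) := by
    rw [← inner_self_ofReal, L2.inner_def, ← integral_complex_ofReal]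
    refine integral_congr_ae (Filter.Eventually.of_forall fun x => ?_)
    exact inner_self_ofReal _
  exact_mod_cast h

end MulOp

end HomPot

namespace HomPot

section Polar

open Filter Topology
open scoped InnerProductSpace

/-- The radial derivative of a function on `ℝ³`. -/
noncomputable def radialDeriv (F : R3 → ℂ) (p : R3) (r : ℝ) : ℂ := fderiv ℝ F (r • p) p

/-- The second radial derivative of a function on `ℝ³`. -/
noncomputable def radialDeriv₂ (F : R3 → ℂ) (p : R3) (r : ℝ) : ℂ :=
  fderiv ℝ (fderiv ℝ F) (r • p) p p

variable {F : R3 → ℂ}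

theorem contDiff_fderiv (hF : ContDiff ℝ ∞ F) : ContDiff ℝ ∞ (fderiv ℝ F) :=
  hF.fderiv_right (by simp)

theorem hasDerivAt_radial (hF : ContDiff ℝ ∞ F) (p : R3) (r : ℝ) :
    HasDerivAt (fun t : ℝ => F (t • p)) (radialDeriv F p r) r := by
  have h1 : HasDerivAt (fun t : ℝ => t • p) p r := by
    simpa using (hasDerivAt_id r).smul_const p
  exact ((hF.differentiable (by simp)).differentiableAt.hasFDerivAt).comp_hasDerivAt r h1

theorem hasDerivAt_radialDeriv (hF : ContDiff ℝ ∞ F) (p : R3) (r : ℝ) :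
    HasDerivAt (radialDeriv F p) (radialDeriv₂ F p r) r := by
  have h1 : HasDerivAt (fun t : ℝ => t • p) p r := by
    simpa using (hasDerivAt_id r).smul_const p
  have h2 := (((contDiff_fderiv hF).differentiable (by simp)).differentiableAt
    (x := r • p)).hasFDerivAt.comp_hasDerivAt r h1
  exact (h2.clm_apply (hasDerivAt_const r p)).congr_deriv (by simp [radialDeriv₂])

theorem deriv_clm_line {G' : R3 → R3 →L[ℝ] ℂ} {x v : R3} (h3 : DifferentiableAt ℝ G' x) : 
   deriv (fun t : ℝ => G' (x + t • v) v) 0 = fderiv ℝ G' x v v := by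
  have hline : HasDerivAt (fun t : ℝ => x + t • v) v 0 := by
    simpa using ((hasDerivAt_id (0:ℝ)).smul_const v).const_add x
  have h3' : HasFDerivAt G' (fderiv ℝ G' x) (x + (0 : ℝ) • v) := by
    rw [zero_smul, add_zero]
    exact h3.hasFDerivAt
  have h5 : HasDerivAt (fun t : ℝ => G' (x + t • v)) (fderiv ℝ G' x v) 0 := h3'.comp_hasDerivAt 0 hline
  have h4 := h5.clm_apply (hasDerivAt_const (0 : ℝ) v)
  rw [map_zero, add_zero] at h4
  exact h4.deriv
theorem deriv_deriv_line {G : R3 → ℂ} {x : R3} (hG : ContDiffAt ℝ 2 G x) (v : R3) :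
    deriv (deriv (fun t : ℝ => G (x + t • v))) 0 = iteratedFDeriv ℝ 2 G x ![v, v] := by
  have hline : ∀ t : ℝ, HasDerivAt (fun t : ℝ => x + t • v) v t := by
    intro t
    simpa using ((hasDerivAt_id t).smul_const v).const_add x
  have h1 : ∀ᶠ y in 𝓝 x, DifferentiableAt ℝ G y := by
    filter_upwards [(show ContDiffAt ℝ 1 G x from hG.of_le (by norm_num)).eventually (by norm_num)]
      with y hy using hy.differentiableAt (by norm_num)
  have hc : Tendsto (fun t : ℝ => x + t • v) (𝓝 0) (𝓝 x) := by
    have := (hline 0).continuousAt.tendsto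
    rwa [zero_smul, add_zero] at this
  have h2 : ∀ᶠ t in 𝓝 (0 : ℝ), deriv (fun t : ℝ => G (x + t • v)) t =
      fderiv ℝ G (x + t • v) v := by
    filter_upwards [hc.eventually h1] with t ht
    exact (ht.hasFDerivAt.comp_hasDerivAt t (hline t)).deriv
  rw [EventuallyEq.deriv_eq h2, iteratedFDeriv_two_apply]
  exact deriv_clm_line ((hG.fderiv_right (m := 1) (by norm_num)).differentiableAt (by norm_num))

theorem contDiffAt_radialExt (hF : ContDiff ℝ ∞ F) (r : ℝ) {x : R3} (hx : x ≠ 0) :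
    ContDiffAt ℝ ∞ (radialExt fun p => F (r • (p : R3))) x := by
  have h1 : ContDiffAt ℝ ∞ (fun y : R3 => F (r • ‖y‖⁻¹ • y)) x :=
    hF.contDiffAt.comp x (((contDiffAt_norm ℝ hx).inv (by simpa using hx)).smul
      contDiffAt_id |>.const_smul r)
  refine h1.congr_of_eventuallyEq ?_
  filter_upwards [isOpen_ne.mem_nhds hx] with y hy
  have hy : y ≠ 0 := hy
  simp [radialExt, hy, radialProj]

theorem smoothOnSphere_restrict (hF : ContDiff ℝ ∞ F) (r : ℝ) :
    SmoothOnSphere fun p => F (r • (p : R3)) :=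
  fun _ hx => (contDiffAt_radialExt hF r hx).contDiffWithinAt

theorem deriv_deriv_great_circle (hF : ContDiff ℝ ∞ F) {r : ℝ} {p v : R3} (hp : ‖p‖ = 1)
    (hv : ‖v‖ = 1) (hpv : ⟪p, v⟫_ℝ = 0) :
    deriv (deriv (fun t : ℝ => radialExt (fun q => F (r • (q : R3))) (p + t • v))) 0 =
      r ^ 2 * fderiv ℝ (fderiv ℝ F) (r • p) v v - r * fderiv ℝ F (r • p) p := by
  have hnorm : ∀ t : ℝ, ‖p + t • v‖ = Real.sqrt (1 + t ^ 2) := by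
    intro t
    rw [eq_comm, Real.sqrt_eq_iff_mul_self_eq (by positivity) (norm_nonneg _), ← sq,
      @norm_add_sq_real, real_inner_smul_right, hpv, norm_smul, hp, hv]
    simp
  have hpos : ∀ t : ℝ, 0 < Real.sqrt (1 + t ^ 2) := fun t => by positivity
  have hG : (fun t : ℝ => radialExt (fun q => F (r • (q : R3))) (p + t • v)) =
      fun t : ℝ => F (r • (Real.sqrt (1 + t ^ 2))⁻¹ • (p + t • v)) := by
    funext t
    have hne : p + t • v ≠ 0 := by
      rw [← norm_ne_zero_iff, hnorm]
      exact (hpos t).ne'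
    rw [radialExt, dif_neg hne]
    simp only [radialProj, hnorm]
  have hc : ∀ t : ℝ, HasDerivAt (fun t : ℝ => (Real.sqrt (1 + t ^ 2))⁻¹)
      (-t * ((Real.sqrt (1 + t ^ 2))⁻¹ * ((Real.sqrt (1 + t ^ 2)) ^ 2)⁻¹)) t := by
    intro t
    have h1 : HasDerivAt (fun t : ℝ => 1 + t ^ 2) (2 * t) t := by
      simpa using ((hasDerivAt_id t).pow 2).const_add 1
    have h2 := (h1.sqrt (by positivity)).inv (hpos t).ne'
    refine h2.congr_deriv ?_
    field_simp
  have hline : ∀ t : ℝ, HasDerivAt (fun t : ℝ => p + t • v) v t := by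
    intro t
    simpa using ((hasDerivAt_id t).smul_const v).const_add p
  have hγ : ∀ t : ℝ, HasDerivAt (fun t : ℝ => r • (Real.sqrt (1 + t ^ 2))⁻¹ • (p + t • v))
      (r • ((Real.sqrt (1 + t ^ 2))⁻¹ • v +
        (-t * ((Real.sqrt (1 + t ^ 2))⁻¹ * ((Real.sqrt (1 + t ^ 2)) ^ 2)⁻¹)) • (p + t • v))) t :=
    fun t => ((hc t).smul (hline t)).const_smul r
  have hd : DifferentiableAt ℝ (fun t : ℝ => (Real.sqrt (1 + t ^ 2))⁻¹ *
      ((Real.sqrt (1 + t ^ 2)) ^ 2)⁻¹) 0 := by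
    have h1 : DifferentiableAt ℝ (fun t : ℝ => Real.sqrt (1 + t ^ 2)) 0 :=
      DifferentiableAt.sqrt (by fun_prop) (by simp)
    exact (h1.inv (hpos 0).ne').mul ((h1.pow 2).inv (pow_ne_zero 2 (hpos 0).ne'))
  have hγ2 : HasDerivAt (fun t : ℝ => r • ((Real.sqrt (1 + t ^ 2))⁻¹ • v +
        (-t * ((Real.sqrt (1 + t ^ 2))⁻¹ * ((Real.sqrt (1 + t ^ 2)) ^ 2)⁻¹)) • (p + t • v)))
      (-r • p) 0 := by
    have h1 := (hc 0).smul_const v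
    have h2 := (((hasDerivAt_id (0 : ℝ)).neg).mul hd.hasDerivAt).smul (hline 0)
    have h3 := (h1.add h2).const_smul r
    refine h3.congr_deriv ?_
    simp
  rw [hG]
  have hd1 : deriv (fun t : ℝ => F (r • (Real.sqrt (1 + t ^ 2))⁻¹ • (p + t • v))) = fun t =>
      fderiv ℝ F (r • (Real.sqrt (1 + t ^ 2))⁻¹ • (p + t • v))
      (r • ((Real.sqrt (1 + t ^ 2))⁻¹ • v +
        (-t * ((Real.sqrt (1 + t ^ 2))⁻¹ * ((Real.sqrt (1 + t ^ 2)) ^ 2)⁻¹)) • (p + t • v))) := by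
    funext t
    exact (((hF.differentiable (by simp)).differentiableAt.hasFDerivAt).comp_hasDerivAt t
      (hγ t)).deriv
  rw [hd1]
  have h5 := ((((contDiff_fderiv hF).differentiable (by simp)).differentiableAt
    ).hasFDerivAt.comp_hasDerivAt 0 (hγ 0)).clm_apply hγ2
  have h6 := h5.deriv
  simp only [Function.comp_apply] at h6
  refine h6.trans ?_
  simp
  ring

/-- The Laplacian in polar coordinates. -/
theorem laplacian_polar (hF : ContDiff ℝ ∞ F) (p : S2) {r : ℝ} (hr : 0 < r) :
    Laplacian.laplacian F (r • (p : R3)) =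
      radialDeriv₂ F p r + (2 / r : ℝ) * radialDeriv F p r -
        (r ^ 2 : ℝ)⁻¹ * sphereLaplacian (fun q => F (r • (q : R3))) p := by
  have hp : ‖(p : R3)‖ = 1 := by simp
  have hp0 : (p : R3) ≠ 0 := by rw [← norm_ne_zero_iff, hp]; exact one_ne_zero
  obtain ⟨b, hb⟩ := Orthonormal.exists_orthonormalBasis_extension_of_card_eq (𝕜 := ℝ) (E := R3)
    (ι := Fin 3) (by simp) (v := fun _ => (p : R3)) (s := {0})
    (by
      rw [orthonormal_iff_ite]
      rintro ⟨i, hi⟩ ⟨j, hj⟩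
      have hi : i = 0 := hi
      have hj : j = 0 := hj
      subst hi hj
      simp)
  have hb0 : b 0 = (p : R3) := hb 0 rfl
  have hsm := contDiffAt_radialExt hF r hp0
  have hon := b.orthonormal
  have hcirc : ∀ i : Fin 3, i ≠ 0 →
      iteratedFDeriv ℝ 2 (radialExt fun q => F (r • (q : R3))) (p : R3) ![b i, b i] =
      r ^ 2 * fderiv ℝ (fderiv ℝ F) (r • (p : R3)) (b i) (b i)
        - r * fderiv ℝ F (r • (p : R3)) p := by
    intro i hi
    rw [← deriv_deriv_line (hsm.of_le ENat.LEInfty.out),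
      deriv_deriv_great_circle hF hp (hon.1 i)]
    rw [← hb0]
    exact hon.2 hi.symm
  have hrad : iteratedFDeriv ℝ 2 (radialExt fun q => F (r • (q : R3))) (p : R3) ![b 0, b 0] = 0 := by
    rw [← deriv_deriv_line (hsm.of_le ENat.LEInfty.out), hb0]
    have : (fun t : ℝ => radialExt (fun q => F (r • (q : R3))) ((p : R3) + t • (p : R3)))
        =ᶠ[𝓝 0] fun _ => F (r • (p : R3)) := by
      filter_upwards [lt_mem_nhds (show (-1 : ℝ) < 0 by norm_num)] with t ht
      have h1 : (p : R3) + t • (p : R3) = (1 + t) • (p : R3) := by module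
      have ht0 : 0 < 1 + t := by linarith
      rw [radialExt, dif_neg (by rw [h1]; exact smul_ne_zero ht0.ne' hp0)]
      simp only [radialProj, h1, norm_smul, hp, Real.norm_eq_abs, abs_of_pos ht0, mul_one]
      rw [smul_smul (1 + t)⁻¹, inv_mul_cancel₀ ht0.ne', one_smul]
    have h2 := this.deriv
    rw [EventuallyEq.deriv_eq h2]
    simp
  have hr0 : (r : ℂ) ≠ 0 := by exact_mod_cast hr.ne'
  rw [sphereLaplacian, InnerProductSpace.laplacian_eq_iteratedFDeriv_orthonormalBasis _ b,
    InnerProductSpace.laplacian_eq_iteratedFDeriv_orthonormalBasis _ b]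
  simp only [Fin.sum_univ_three, hrad, hcirc 1 (by decide), hcirc 2 (by decide)]
  simp only [iteratedFDeriv_two_apply, radialDeriv, radialDeriv₂, Matrix.cons_val_zero,
    Matrix.cons_val_one, hb0]
  push_cast
  field_simp
  ring

end Polar

end HomPot

namespace HomPot

section PolarIntegral

variable {E : Type*} [NormedAddCommGroup E]

/-- The measure `dω dr` on `S² × (0, ∞)`. -/
noncomputable abbrev polarMeasure : Measure (S2 × ℝ) :=
  surface.prod (volume.restrict (Ioi (0 : ℝ)))

instance sigmaFinite_comap_coe :
    SigmaFinite (Measure.comap (Subtype.val : Ioi (0 : ℝ) → ℝ) volume) := by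
  have h : Measure.volumeIoiPow 0 = Measure.comap (Subtype.val : Ioi (0 : ℝ) → ℝ) volume := by
    simp [Measure.volumeIoiPow]
  rw [← h]
  infer_instance

theorem measurePreserving_prodMap_coe :
    MeasurePreserving (Prod.map id (Subtype.val : Ioi (0 : ℝ) → ℝ))
      (surface.prod (Measure.comap Subtype.val volume)) polarMeasure :=
  (MeasurePreserving.id _).prod ⟨measurable_subtype_coe, map_comap_subtype_coe measurableSet_Ioi _⟩

theorem measurableEmbedding_prodMap_coe :
    MeasurableEmbedding (Prod.map (id : S2 → S2) (Subtype.val : Ioi (0 : ℝ) → ℝ)) :=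
  MeasurableEmbedding.id.prodMap (MeasurableEmbedding.subtype_coe measurableSet_Ioi)

theorem prod_volumeIoiPow : surface.prod (Measure.volumeIoiPow 2) =
    (surface.prod (Measure.comap Subtype.val volume)).withDensity
      (fun z : S2 × Ioi (0 : ℝ) => ((Real.toNNReal (z.2.1 ^ 2) : NNReal) : ℝ≥0∞)) := by
  rw [Measure.volumeIoiPow, prod_withDensity_right (by fun_prop)]
  rfl

theorem measurePreserving_polar : MeasurePreserving (homeomorphUnitSphereProd R3)
    (Measure.comap Subtype.val (volume : Measure R3)) (surface.prod (Measure.volumeIoiPow 2)) := by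
  have := (volume : Measure R3).measurePreserving_homeomorphUnitSphereProd
  simpa using this

theorem smul_homeomorphUnitSphereProd (x : ({0}ᶜ : Set R3)) :
    ((homeomorphUnitSphereProd R3 x).2 : ℝ) • ((homeomorphUnitSphereProd R3 x).1 : R3) = x := by
  have : ‖(x : R3)‖ ≠ 0 := norm_ne_zero_iff.2 x.2
  simp [smul_smul, this]

theorem toNNReal_sq_smul [NormedSpace ℝ E] (r : ℝ) (v : E) : Real.toNNReal (r ^ 2) • v = r ^ 2 • v := by
  rw [NNReal.smul_def, Real.coe_toNNReal _ (sq_nonneg r)]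

theorem integrable_polar [NormedSpace ℝ E] {f : R3 → E} :
    Integrable f ↔ Integrable (fun z : S2 × ℝ => z.2 ^ 2 • f (z.2 • (z.1 : R3))) polarMeasure := by
  rw [← measurePreserving_prodMap_coe.integrable_comp_emb measurableEmbedding_prodMap_coe,
    ← restrict_compl_singleton (μ := (volume : Measure R3)) 0, ← IntegrableOn,
    integrableOn_iff_comap_subtypeVal (measurableSet_singleton _).compl]
  have h1 := measurePreserving_polar.integrable_comp_emb (Homeomorph.measurableEmbedding _)
    (g := fun z : S2 × Ioi (0 : ℝ) => f (z.2.1 • (z.1 : R3)))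
  have h2 : (fun z : S2 × Ioi (0 : ℝ) => f (z.2.1 • (z.1 : R3))) ∘ homeomorphUnitSphereProd R3 =
      f ∘ Subtype.val := by
    funext x
    exact congrArg f (smul_homeomorphUnitSphereProd x)
  rw [h2] at h1
  rw [h1, prod_volumeIoiPow, integrable_withDensity_iff_integrable_smul (by fun_prop)]
  simp only [toNNReal_sq_smul]
  rfl

theorem integral_polar [NormedSpace ℝ E] [CompleteSpace E] (f : R3 → E) :
    ∫ x, f x = ∫ z, z.2 ^ 2 • f (z.2 • (z.1 : R3)) ∂polarMeasure := by
  rw [← measurePreserving_prodMap_coe.integral_comp measurableEmbedding_prodMap_coe,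
    ← restrict_compl_singleton (μ := (volume : Measure R3)) 0,
    ← integral_subtype_comap (measurableSet_singleton _).compl]
  have h1 := measurePreserving_polar.integral_comp (Homeomorph.measurableEmbedding _)
    (fun z : S2 × Ioi (0 : ℝ) => f (z.2.1 • (z.1 : R3)))
  simp only [smul_homeomorphUnitSphereProd] at h1
  rw [h1, prod_volumeIoiPow, integral_withDensity_eq_integral_smul (by fun_prop)]
  simp only [toNNReal_sq_smul]
  rfl

/-- Integrals of products of radial and angular functions. -/
theorem integral_radial_mul_angular (g : ℝ → ℂ) (h : S2 → ℂ) {f : R3 → ℂ}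
    (hf : ∀ (p : S2) (r : ℝ), 0 < r → r ^ 2 * f (r • (p : R3)) = h p * g r) :
    ∫ x, f x = (∫ p, h p ∂surface) * ∫ r in Ioi 0, g r := by
  rw [integral_polar, ← integral_prod_mul]
  refine integral_congr_ae ?_
  have : ∀ᵐ z : S2 × ℝ ∂polarMeasure, z.2 ∈ Ioi (0 : ℝ) :=
    Measure.quasiMeasurePreserving_snd.ae (ae_restrict_mem measurableSet_Ioi)
  filter_upwards [this] with z hz
  rw [← hf z.1 z.2 hz, Complex.real_smul]
  push_cast
  rfl

end PolarIntegral

end HomPot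

namespace HomPot

section SphereSymmetry

open Filter Topology

theorem norm_coe_S2 (p : S2) : ‖(p : R3)‖ = 1 := by simp

theorem coe_S2_ne_zero (p : S2) : (p : R3) ≠ 0 := by
  rw [← norm_ne_zero_iff, norm_coe_S2]
  exact one_ne_zero

theorem radialProj_smul {r : ℝ} (hr : 0 < r) (p : S2) (h : r • (p : R3) ≠ 0) :
    radialProj (r • (p : R3)) h = p := by
  ext1
  simp [radialProj, norm_smul, abs_of_pos hr, smul_smul, hr.ne']

theorem smul_coe_S2_ne_zero {r : ℝ} (hr : 0 < r) (p : S2) : r • (p : R3) ≠ 0 :=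
  smul_ne_zero hr.ne' (coe_S2_ne_zero p)

theorem radialExt_smul (φ : S2 → ℂ) {r : ℝ} (hr : 0 < r) (p : S2) :
    radialExt φ (r • (p : R3)) = φ p := by
  rw [radialExt, dif_neg (smul_coe_S2_ne_zero hr p), radialProj_smul hr]

theorem radialExt_coe (φ : S2 → ℂ) (p : S2) : radialExt φ p = φ p := by
  simpa using radialExt_smul φ one_pos p

theorem SmoothOnSphere.contDiffAt {φ : S2 → ℂ} (hφ : SmoothOnSphere φ) {x : R3} (hx : x ≠ 0) :
    ContDiffAt ℝ ∞ (radialExt φ) x :=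
  (hφ x hx).contDiffAt (isOpen_compl_singleton.mem_nhds hx)

theorem SmoothOnSphere.continuous {φ : S2 → ℂ} (hφ : SmoothOnSphere φ) : Continuous φ := by
  have h : Continuous fun p : S2 => radialExt φ (p : R3) :=
    continuous_iff_continuousAt.2 fun p =>
      (hφ.contDiffAt (coe_S2_ne_zero p)).continuousAt.comp continuous_subtype_val.continuousAt
  simpa only [radialExt_coe] using h

theorem continuousAt_laplacian {G : R3 → ℂ} {x : R3} (hG : ContDiffAt ℝ ∞ G x) :
    ContinuousAt (Laplacian.laplacian G) x := by
  rw [InnerProductSpace.laplacian_eq_iteratedFDeriv_stdOrthonormalBasis]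
  refine tendsto_finsetSum _ fun i _ => ?_
  simp only [iteratedFDeriv_two_apply]
  have h1 : ContDiffAt ℝ 1 (fderiv ℝ G) x := 
    (show ContDiffAt ℝ 2 G x from hG.of_le ENat.LEInfty.out).fderiv_right (by norm_num)
  have h2 : ContDiffAt ℝ 0 (fderiv ℝ (fderiv ℝ G)) x := h1.fderiv_right (by norm_num)
  exact (h2.continuousAt.clm_apply continuousAt_const).clm_apply continuousAt_const

theorem SmoothOnSphere.continuous_sphereLaplacian {φ : S2 → ℂ} (hφ : SmoothOnSphere φ) :
    Continuous (sphereLaplacian φ) :=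
  continuous_iff_continuousAt.2 fun p =>
    ((continuousAt_laplacian (hφ.contDiffAt (coe_S2_ne_zero p))).comp
      continuous_subtype_val.continuousAt).neg

theorem SmoothOnSphere.conj {φ : S2 → ℂ} (hφ : SmoothOnSphere φ) :
    SmoothOnSphere fun p => (starRingEnd ℂ) (φ p) := by
  have h : (radialExt fun p => (starRingEnd ℂ) (φ p)) = Complex.conjCLE ∘ radialExt φ := by
    funext x
    by_cases hx : x = 0 <;> simp [radialExt, hx]
  rw [SmoothOnSphere, h]
  exact Complex.conjCLE.contDiff.comp_contDiffOn hφ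

theorem sphereLaplacian_conj (φ : S2 → ℂ) (p : S2) :
    sphereLaplacian (fun p => (starRingEnd ℂ) (φ p)) p = (starRingEnd ℂ) (sphereLaplacian φ p) := by
  have h : (radialExt fun p => (starRingEnd ℂ) (φ p)) = Complex.conjCLE ∘ radialExt φ := by
    funext x
    by_cases hx : x = 0 <;> simp [radialExt, hx]
  rw [sphereLaplacian, h, InnerProductSpace.laplacian_CLE_comp_left, sphereLaplacian]
  simp

theorem sphereLaplacian_const_mul {φ : S2 → ℂ} (hφ : SmoothOnSphere φ) (c : ℂ) (p : S2) :
    sphereLaplacian (fun p => c * φ p) p = c * sphereLaplacian φ p := by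
  have h : (radialExt fun p => c * φ p) = c • radialExt φ := by
    funext x
    by_cases hx : x = 0 <;> simp [radialExt, hx]
  rw [sphereLaplacian, h, InnerProductSpace.laplacian_smul _
    ((hφ.contDiffAt (coe_S2_ne_zero p)).of_le ENat.LEInfty.out), sphereLaplacian, smul_eq_mul]
  ring

/-- The product of a radial and an angular function. -/
noncomputable def radialProd (χ : ℝ → ℂ) (φ : S2 → ℂ) (x : R3) : ℂ := χ ‖x‖ * radialExt φ x

variable {χ : ℝ → ℂ} {φ ψ : S2 → ℂ}

theorem radialProd_smul (χ : ℝ → ℂ) (φ : S2 → ℂ) {r : ℝ} (hr : 0 < r) (p : S2) :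
    radialProd χ φ (r • (p : R3)) = χ r * φ p := by
  rw [radialProd, radialExt_smul φ hr, norm_smul, norm_coe_S2, mul_one, Real.norm_eq_abs,
    abs_of_pos hr]

theorem contDiff_radialProd (hχ : ContDiff ℝ ∞ χ) (hχ0 : (0 : ℝ) ∉ tsupport χ)
    (hφ : SmoothOnSphere φ) : ContDiff ℝ ∞ (radialProd χ φ) := by
  rw [contDiff_iff_contDiffAt]
  intro x
  by_cases hx : x = 0
  · have h1 : ∀ᶠ y : R3 in 𝓝 0, χ ‖y‖ = 0 := by
      have h2 := notMem_tsupport_iff_eventuallyEq.1 hχ0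
      have h3 : Tendsto (fun y : R3 => ‖y‖) (𝓝 0) (𝓝 0) := by
        simpa using (continuous_norm (E := R3)).tendsto 0
      exact h3.eventually h2
    subst hx
    refine (contDiffAt_const (c := (0 : ℂ))).congr_of_eventuallyEq ?_
    filter_upwards [h1] with y hy
    rw [radialProd, hy, zero_mul]
  · exact (hχ.contDiffAt.comp x (contDiffAt_norm ℝ hx)).mul (hφ.contDiffAt hx)

theorem hasCompactSupport_radialProd (hχ : HasCompactSupport χ) (φ : S2 → ℂ) :
    HasCompactSupport (radialProd χ φ) := by
  obtain ⟨R, hR⟩ := hχ.isCompact.isBounded.subset_closedBall (0 : ℝ)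
  refine HasCompactSupport.intro (isCompact_closedBall (0 : R3) R) fun x hx => ?_
  have : ‖x‖ ∉ tsupport χ := fun h => hx (by simpa using hR h)
  rw [radialProd, image_eq_zero_of_notMem_tsupport this, zero_mul]

theorem laplacian_radialProd (hχ : ContDiff ℝ ∞ χ) (hχ0 : (0 : ℝ) ∉ tsupport χ)
    (hφ : SmoothOnSphere φ) (p : S2) {r : ℝ} (hr : 0 < r) :
    Laplacian.laplacian (radialProd χ φ) (r • (p : R3)) =
      (deriv (deriv χ) r + (2 / r : ℝ) * deriv χ r) * φ p -
        (r ^ 2 : ℝ)⁻¹ * χ r * sphereLaplacian φ p := by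
  have hF := contDiff_radialProd hχ hχ0 hφ
  have h1 : ∀ t : ℝ, 0 < t → radialDeriv (radialProd χ φ) p t = deriv χ t * φ p := by
    intro t ht
    have h2 : (fun t : ℝ => radialProd χ φ (t • (p : R3))) =ᶠ[𝓝 t] fun t => χ t * φ p := by
      filter_upwards [lt_mem_nhds ht] with s hs using radialProd_smul χ φ hs p
    have h3 := ((hχ.differentiable (by simp)).differentiableAt.hasDerivAt (x := t)).mul_const (φ p)
    exact (hasDerivAt_radial hF p t).unique (h3.congr_of_eventuallyEq h2)
  have h2 : radialDeriv₂ (radialProd χ φ) p r = deriv (deriv χ) r * φ p := by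
    have h3 : radialDeriv (radialProd χ φ) p =ᶠ[𝓝 r] fun t => deriv χ t * φ p := by
      filter_upwards [lt_mem_nhds hr] with s hs using h1 s hs
    have h4 : ContDiff ℝ ∞ (deriv χ) := hχ.deriv'
    have h5 := ((h4.differentiable (by simp)).differentiableAt.hasDerivAt (x := r)).mul_const (φ p)
    exact (hasDerivAt_radialDeriv hF p r).unique (h5.congr_of_eventuallyEq h3)
  rw [laplacian_polar hF p hr, h1 r hr, h2]
  have h6 : (fun q : S2 => radialProd χ φ (r • (q : R3))) = fun q => χ r * φ q := by
    funext q
    exact radialProd_smul χ φ hr q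
  rw [h6, sphereLaplacian_const_mul hφ]
  push_cast
  ring

/-- Green's formula on the sphere. -/
theorem integral_mul_sphereLaplacian (hφ : SmoothOnSphere φ) (hψ : SmoothOnSphere ψ) :
    ∫ p, φ p * sphereLaplacian ψ p ∂surface = ∫ p, sphereLaplacian φ p * ψ p ∂surface := by
  let b : ContDiffBump (1 : ℝ) := ⟨1 / 4, 1 / 2, by norm_num, by norm_num⟩
  let χ : ℝ → ℂ := fun t => (b t : ℂ)
  have hχ : ContDiff ℝ ∞ χ := Complex.ofRealCLM.contDiff.comp b.contDiff
  have hts : tsupport χ ⊆ Metric.closedBall (1 : ℝ) (1 / 2) := by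
    have h1 : tsupport χ ⊆ tsupport b := closure_mono fun t ht => by
      simpa [χ] using ht
    rwa [b.tsupport_eq] at h1
  have hχc : HasCompactSupport χ := (isCompact_closedBall _ _).of_isClosed_subset
    (isClosed_tsupport _) hts
  have hχ0 : (0 : ℝ) ∉ tsupport χ := fun h => by
    have := hts h
    rw [Metric.mem_closedBall, Real.dist_eq] at this
    norm_num at this
  have hΦ := contDiff_radialProd hχ hχ0 hφ
  have hΨ := contDiff_radialProd hχ hχ0 hψ
  have hΦc := hasCompactSupport_radialProd hχc φ
  have hΨc := hasCompactSupport_radialProd hχc ψ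
  let f : 𝓢(R3, ℂ) := hΦc.toSchwartzMap hΦ
  let g : 𝓢(R3, ℂ) := hΨc.toSchwartzMap hΨ
  have hparts := SchwartzMap.integral_mul_laplacian_right_eq_left (μ := (volume : Measure R3)) f g
  have hi1 : Integrable fun x => f x * Laplacian.laplacian g x :=
    (SchwartzMap.pairing (ContinuousLinearMap.mul ℝ ℂ) f (Laplacian.laplacian g)).integrable
  have hi2 : Integrable fun x => Laplacian.laplacian f x * g x :=
    (SchwartzMap.pairing (ContinuousLinearMap.mul ℝ ℂ) (Laplacian.laplacian f) g).integrable
  rw [← sub_eq_zero, ← integral_sub hi1 hi2] at hparts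
  rw [integral_radial_mul_angular (fun r => -(χ r * χ r))
    (fun p => φ p * sphereLaplacian ψ p - sphereLaplacian φ p * ψ p) (fun p r hr => by
      have h1 : f (r • (p : R3)) = χ r * φ p := radialProd_smul χ φ hr p
      have h2 : g (r • (p : R3)) = χ r * ψ p := radialProd_smul χ ψ hr p
      rw [SchwartzMap.laplacian_apply, SchwartzMap.laplacian_apply, h1, h2]
      have h3 : Laplacian.laplacian (f : R3 → ℂ) (r • (p : R3)) = _ :=
        laplacian_radialProd hχ hχ0 hφ p hr
      have h4 : Laplacian.laplacian (g : R3 → ℂ) (r • (p : R3)) = _ :=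
        laplacian_radialProd hχ hχ0 hψ p hr
      rw [h3, h4]
      have hr0 : (r : ℂ) ≠ 0 := by exact_mod_cast hr.ne'
      push_cast
      field_simp
      ring)] at hparts
  have hpos : ∫ r in Ioi (0 : ℝ), -(χ r * χ r) ≠ 0 := by
    have h1 : ∫ r in Ioi (0 : ℝ), -(χ r * χ r) = ((-∫ r in Ioi (0 : ℝ), b r * b r : ℝ) : ℂ) := by
      rw [integral_neg, Complex.ofReal_neg, ← integral_complex_ofReal]
      simp [χ]
    rw [h1]
    have h2 : 0 < ∫ r in Ioi (0 : ℝ), b r * b r := by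
      have hc : Continuous fun r => b r * b r := b.continuous.mul b.continuous
      rw [setIntegral_pos_iff_support_of_nonneg_ae
        (Eventually.of_forall fun r => mul_self_nonneg _)
        (hc.integrable_of_hasCompactSupport b.hasCompactSupport.mul_right).integrableOn]
      have h3 : Ioo (1 / 2 : ℝ) (3 / 2) ⊆ (Function.support fun r => b r * b r) ∩ Ioi 0 := by
        intro r hr
        have : r ∈ Function.support b := by
          rw [b.support_eq, Metric.mem_ball, Real.dist_eq]
          change |r - 1| < 1 / 2
          rw [abs_lt]
          constructor <;> linarith [hr.1, hr.2]
        exact ⟨by simpa using this, by rw [mem_Ioi]; linarith [hr.1]⟩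
      refine lt_of_lt_of_le ?_ (measure_mono h3)
      rw [Real.volume_Ioo]
      norm_num
    exact_mod_cast (neg_neg_of_pos h2).ne
  have hfin := (mul_eq_zero.1 hparts).resolve_right hpos
  rw [integral_sub, sub_eq_zero] at hfin
  · exact hfin
  · exact ((hφ.continuous.mul hψ.continuous_sphereLaplacian).integrable_of_hasCompactSupport
      (HasCompactSupport.of_compactSpace _))
  · exact ((hφ.continuous_sphereLaplacian.mul hψ.continuous).integrable_of_hasCompactSupport
      (HasCompactSupport.of_compactSpace _))

end SphereSymmetry

end HomPot

namespace HomPot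

section Harmonics

open Filter Topology
open scoped InnerProductSpace

/-- The class in `L²(S²)` of a continuous function. -/
noncomputable def sphereClass (φ : S2 → ℂ) (h : Continuous φ) : Lp ℂ 2 surface :=
  ContinuousMap.toLp (E := ℂ) 2 surface ℂ ⟨φ, h⟩

theorem sphereClass_ae {φ : S2 → ℂ} (h : Continuous φ) : sphereClass φ h =ᵐ[surface] φ :=
  ContinuousMap.coeFn_toLp surface ⟨φ, h⟩

theorem inner_sphereClass {φ : S2 → ℂ} (h : Continuous φ) (u : Lp ℂ 2 surface) :
    ⟪sphereClass φ h, u⟫_ℂ = ∫ p, u p * (starRingEnd ℂ) (φ p) ∂surface := by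
  rw [L2.inner_def]
  refine integral_congr_ae ?_
  filter_upwards [sphereClass_ae h] with p hp
  rw [hp, RCLike.inner_apply]

theorem hasSphereLaplacian_iff {u w : Lp ℂ 2 surface} : HasSphereLaplacian u w ↔
    ∀ (φ : S2 → ℂ) (hφ : SmoothOnSphere φ),
      ⟪sphereClass (sphereLaplacian φ) hφ.continuous_sphereLaplacian, u⟫_ℂ =
        ⟪sphereClass φ hφ.continuous, w⟫_ℂ := by
  simp only [inner_sphereClass]
  constructor
  · intro h φ hφ
    have := h _ hφ.conj
    simpa only [sphereLaplacian_conj] using this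
  · intro h φ hφ
    have := h _ hφ.conj
    simpa only [sphereLaplacian_conj, Complex.conj_conj] using this

theorem HasSphereLaplacian.add {u w u' w' : Lp ℂ 2 surface} (h : HasSphereLaplacian u w)
    (h' : HasSphereLaplacian u' w') : HasSphereLaplacian (u + u') (w + w') := by
  rw [hasSphereLaplacian_iff] at *
  intro φ hφ
  rw [inner_add_right, inner_add_right, h φ hφ, h' φ hφ]

theorem HasSphereLaplacian.smul {u w : Lp ℂ 2 surface} (h : HasSphereLaplacian u w) (c : ℂ) :
    HasSphereLaplacian (c • u) (c • w) := by
  rw [hasSphereLaplacian_iff] at *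
  intro φ hφ
  rw [inner_smul_right, inner_smul_right, h φ hφ]

theorem hasSphereLaplacian_sphereClass {φ : S2 → ℂ} (hφ : SmoothOnSphere φ) :
    HasSphereLaplacian (sphereClass φ hφ.continuous)
      (sphereClass (sphereLaplacian φ) hφ.continuous_sphereLaplacian) := by
  intro ψ hψ
  have h1 : ∫ p, sphereClass φ hφ.continuous p * sphereLaplacian ψ p ∂surface =
      ∫ p, φ p * sphereLaplacian ψ p ∂surface := by
    refine integral_congr_ae ?_
    filter_upwards [sphereClass_ae hφ.continuous] with p hp
    rw [hp]
  have h2 : ∫ p, sphereClass (sphereLaplacian φ) hφ.continuous_sphereLaplacian p * ψ p ∂surface =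
      ∫ p, sphereLaplacian φ p * ψ p ∂surface := by
    refine integral_congr_ae ?_
    filter_upwards [sphereClass_ae hφ.continuous_sphereLaplacian] with p hp
    rw [hp]
  rw [h1, h2, integral_mul_sphereLaplacian hφ hψ]

/-- Monomials, as functions on `ℝ³`. -/
noncomputable def monomialFun (α : Fin 3 → ℕ) (x : R3) : ℂ := ∏ i, ((x i : ℝ) : ℂ) ^ α i

theorem contDiff_monomialFun (α : Fin 3 → ℕ) : ContDiff ℝ ∞ (monomialFun α) := by
  refine contDiff_prod fun i _ => ContDiff.pow ?_ _
  exact Complex.ofRealCLM.contDiff.comp (EuclideanSpace.proj (𝕜 := ℝ) i).contDiff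

theorem monomialFun_smul (α : Fin 3 → ℕ) (r : ℝ) (x : R3) :
    monomialFun α (r • x) = (r : ℂ) ^ (∑ i, α i) * monomialFun α x := by
  simp only [monomialFun, PiLp.smul_apply, smul_eq_mul, Complex.ofReal_mul, mul_pow,
    Finset.prod_mul_distrib, Finset.prod_pow_eq_pow_sum]

theorem smoothOnSphere_monomialFun (α : Fin 3 → ℕ) :
    SmoothOnSphere fun p => monomialFun α (p : R3) := by
  simpa using smoothOnSphere_restrict (contDiff_monomialFun α) 1

theorem laplacian_monomialFun (α : Fin 3 → ℕ) (x : R3) :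
    Laplacian.laplacian (monomialFun α) x =
      ∑ i, ((α i * (α i - 1) : ℕ) : ℂ) * monomialFun (Function.update α i (α i - 2)) x := by
  rw [InnerProductSpace.laplacian_eq_iteratedFDeriv_orthonormalBasis _
    (EuclideanSpace.basisFun (Fin 3) ℝ)]
  refine Finset.sum_congr rfl fun i _ => ?_
  rw [← deriv_deriv_line ((contDiff_monomialFun α).contDiffAt.of_le ENat.LEInfty.out)]
  have h1 : (fun t : ℝ => monomialFun α (x + t • EuclideanSpace.basisFun (Fin 3) ℝ i)) =
      fun t : ℝ => (∏ j ∈ Finset.univ.erase i, ((x j : ℝ) : ℂ) ^ α j) *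
        ((x i : ℂ) + (t : ℂ)) ^ α i := by
    funext t
    rw [monomialFun, ← Finset.mul_prod_erase _ _ (Finset.mem_univ i), mul_comm]
    congr 1
    · refine Finset.prod_congr rfl fun j hj => ?_
      have : j ≠ i := Finset.ne_of_mem_erase hj
      simp [this]
    · simp
  have h2 : ∀ (n : ℕ) (t : ℝ), HasDerivAt (fun t : ℝ => ((x i : ℂ) + (t : ℂ)) ^ n)
      (n * ((x i : ℂ) + (t : ℂ)) ^ (n - 1)) t := by
    intro n t
    have h : HasDerivAt (fun t : ℝ => (x i : ℂ) + (t : ℂ)) 1 t :=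
      (Complex.ofRealCLM.hasDerivAt (x := t)).const_add (x i : ℂ)
    exact (h.fun_pow n).congr_deriv (mul_one _)
  have h3 : deriv (fun t : ℝ => (∏ j ∈ Finset.univ.erase i, ((x j : ℝ) : ℂ) ^ α j) *
        ((x i : ℂ) + (t : ℂ)) ^ α i) = fun t : ℝ =>
        (∏ j ∈ Finset.univ.erase i, ((x j : ℝ) : ℂ) ^ α j) *
        ((α i : ℂ) * ((x i : ℂ) + (t : ℂ)) ^ (α i - 1)) := by
    funext t
    exact ((h2 _ t).const_mul _).deriv
  rw [h1, h3, (((h2 _ 0).const_mul _).const_mul _).deriv, monomialFun,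
    ← Finset.mul_prod_erase _ _ (Finset.mem_univ i)]
  have h4 : ∏ j ∈ Finset.univ.erase i, ((x j : ℝ) : ℂ) ^ (Function.update α i (α i - 2)) j =
      ∏ j ∈ Finset.univ.erase i, ((x j : ℝ) : ℂ) ^ α j := by
    refine Finset.prod_congr rfl fun j hj => ?_
    rw [Function.update_of_ne (Finset.ne_of_mem_erase hj)]
  rw [h4, Function.update_self, show α i - 1 - 1 = α i - 2 by omega]
  push_cast
  ring

theorem sphereLaplacian_monomialFun (α : Fin 3 → ℕ) (p : S2) :
    sphereLaplacian (fun q => monomialFun α (q : R3)) p =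
      ((∑ i, α i : ℕ) * ((∑ i, α i : ℕ) + 1)) * monomialFun α (p : R3) -
        Laplacian.laplacian (monomialFun α) (p : R3) := by
  set n := ∑ i, α i
  have hF := contDiff_monomialFun α
  have hpow : ∀ (k : ℕ) (t : ℝ), HasDerivAt (fun t : ℝ => (t : ℂ) ^ k) (k * (t : ℂ) ^ (k - 1)) t := by
    intro k t
    have h : HasDerivAt (fun t : ℝ => (t : ℂ)) 1 t := Complex.ofRealCLM.hasDerivAt
    exact (h.fun_pow k).congr_deriv (mul_one _)
  have h1 : ∀ t : ℝ, radialDeriv (monomialFun α) p t =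
      n * (t : ℂ) ^ (n - 1) * monomialFun α (p : R3) := by
    intro t
    refine (hasDerivAt_radial hF p t).unique ?_
    simp only [monomialFun_smul]
    exact (hpow n t).mul_const _
  have h2 : radialDeriv₂ (monomialFun α) p 1 = n * (n - 1) * monomialFun α (p : R3) := by
    refine (hasDerivAt_radialDeriv hF p 1).unique ?_
    have h3 : radialDeriv (monomialFun α) p = fun t : ℝ =>
        n * (t : ℂ) ^ (n - 1) * monomialFun α (p : R3) := funext h1
    rw [h3]
    refine (((hpow (n - 1) 1).const_mul (n : ℂ)).mul_const _).congr_deriv ?_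
    rcases Nat.eq_zero_or_pos n with h0 | h0
    · simp [h0]
    · simp [Nat.cast_sub (show 1 ≤ n from h0)]
  have h3 := laplacian_polar hF p one_pos
  rw [h1, h2] at h3
  simp only [one_smul, Complex.ofReal_one, one_pow, inv_one, one_mul, div_one] at h3
  rw [h3]
  push_cast
  ring

/-- The class of a monomial in `L²(S²)`. -/
noncomputable def monomialClass (α : Fin 3 → ℕ) : Lp ℂ 2 surface :=
  sphereClass (fun p => monomialFun α (p : R3)) (smoothOnSphere_monomialFun α).continuous

/-- The polynomials of degree less than `n`, in `L²(S²)`. -/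
noncomputable def polySpace (n : ℕ) : Submodule ℂ (Lp ℂ 2 surface) :=
  Submodule.span ℂ (monomialClass '' {α | ∑ i, α i < n})

theorem polySpace_mono {m n : ℕ} (h : m ≤ n) : polySpace m ≤ polySpace n :=
  Submodule.span_mono (image_mono fun _ hα => lt_of_lt_of_le hα h)

theorem monomialClass_mem {α : Fin 3 → ℕ} {n : ℕ} (h : ∑ i, α i < n) :
    monomialClass α ∈ polySpace n := Submodule.subset_span ⟨α, h, rfl⟩

instance finiteDimensional_polySpace (n : ℕ) : FiniteDimensional ℂ (polySpace n) := by
  refine FiniteDimensional.span_of_finite ℂ (Set.Finite.image _ ?_)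
  refine (Set.finite_Iic (fun _ : Fin 3 => n)).subset fun α hα i => ?_
  exact (Finset.single_le_sum (fun _ _ => Nat.zero_le _) (Finset.mem_univ i)).trans
    (le_of_lt hα)

theorem exists_hasSphereLaplacian_monomialClass (α : Fin 3 → ℕ) :
    ∃ h ∈ polySpace (∑ i, α i), HasSphereLaplacian (monomialClass α)
      ((((∑ i, α i : ℕ) : ℂ) * ((∑ i, α i : ℕ) + 1)) • monomialClass α - h) := by
  let h : Lp ℂ 2 surface := ∑ i, ((α i * (α i - 1) : ℕ) : ℂ) •
    monomialClass (Function.update α i (α i - 2))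
  refine ⟨h, ?_, ?_⟩
  · refine Submodule.sum_mem _ fun i _ => ?_
    by_cases hi : α i ≤ 1
    · have : α i * (α i - 1) = 0 := by
        rw [Nat.mul_eq_zero]; omega
      rw [this, Nat.cast_zero, zero_smul]
      exact zero_mem _
    · refine Submodule.smul_mem _ _ (monomialClass_mem ?_)
      refine Finset.sum_lt_sum (fun j _ => ?_) ⟨i, Finset.mem_univ i, ?_⟩
      · by_cases hj : j = i
        · subst hj; simp
        · simp [hj]
      · simp only [Function.update_self]; omega
  · have h1 := hasSphereLaplacian_sphereClass (smoothOnSphere_monomialFun α)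
    suffices heq : (((∑ i, α i : ℕ) : ℂ) * ((∑ i, α i : ℕ) + 1)) • monomialClass α - h =
        sphereClass (sphereLaplacian fun p => monomialFun α (p : R3))
          (smoothOnSphere_monomialFun α).continuous_sphereLaplacian by
      rw [heq]; exact h1
    refine Lp.ext ?_
    have h2 : ∀ᵐ p ∂surface, ∀ i, monomialClass (Function.update α i (α i - 2)) p =
        monomialFun (Function.update α i (α i - 2)) (p : R3) :=
      ae_all_iff.2 fun i => sphereClass_ae _
    have h3 : (h : S2 → ℂ) =ᵐ[surface] fun p => ∑ i, ((α i * (α i - 1) : ℕ) : ℂ) •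
        monomialClass (Function.update α i (α i - 2)) p := by
      refine (Lp.coeFn_finsetSum _ _).trans ?_
      have : ∀ᵐ p ∂surface, ∀ i, (((α i * (α i - 1) : ℕ) : ℂ) •
        monomialClass (Function.update α i (α i - 2)) : Lp ℂ 2 surface) p =
          ((α i * (α i - 1) : ℕ) : ℂ) • monomialClass (Function.update α i (α i - 2)) p :=
        ae_all_iff.2 fun i => Lp.coeFn_smul _ _
      filter_upwards [this] with p hp
      rw [Finset.sum_apply]
      exact Finset.sum_congr rfl fun i _ => hp i
    have h5 : monomialClass α =ᵐ[surface] fun p => monomialFun α (p : R3) := sphereClass_ae _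
    filter_upwards [sphereClass_ae (smoothOnSphere_monomialFun α).continuous_sphereLaplacian,
      h5, h2, h3, Lp.coeFn_sub
        ((((∑ i, α i : ℕ) : ℂ) * ((∑ i, α i : ℕ) + 1)) • monomialClass α) h,
      Lp.coeFn_smul (((∑ i, α i : ℕ) : ℂ) * ((∑ i, α i : ℕ) + 1)) (monomialClass α)]
      with p hp1 hp2 hp3 hp4 hp5 hp6
    rw [hp5, Pi.sub_apply, hp6, Pi.smul_apply, hp4, hp1, sphereLaplacian_monomialFun,
      laplacian_monomialFun, hp2]
    simp only [hp3, smul_eq_mul]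

/-- On polynomials of degree `n`, the Laplacian of the sphere is `n (n + 1)` up to polynomials of
lower degree. -/
theorem exists_hasSphereLaplacian_polySpace {n : ℕ} {f : Lp ℂ 2 surface}
    (hf : f ∈ polySpace (n + 1)) :
    ∃ h ∈ polySpace n, HasSphereLaplacian f (((n : ℂ) * (n + 1)) • f + h) := by
  refine Submodule.span_induction (p := fun f _ => ∃ h ∈ polySpace n,
    HasSphereLaplacian f (((n : ℂ) * (n + 1)) • f + h)) ?_ ?_ ?_ ?_ hf
  · rintro _ ⟨α, hα, rfl⟩
    obtain ⟨h, hh, hL⟩ := exists_hasSphereLaplacian_monomialClass α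
    set k := ∑ i, α i with hk
    have hkn : k ≤ n := Nat.lt_succ_iff.1 hα
    refine ⟨(((k : ℂ) * (k + 1)) - ((n : ℂ) * (n + 1))) • monomialClass α - h, ?_, ?_⟩
    · refine Submodule.sub_mem _ ?_ (polySpace_mono hkn hh)
      rcases hkn.eq_or_lt with h1 | h1
      · rw [h1, sub_self, zero_smul]; exact zero_mem _
      · exact Submodule.smul_mem _ _ (monomialClass_mem h1)
    · convert hL using 1
      module
  · refine ⟨0, zero_mem _, ?_⟩
    rw [hasSphereLaplacian_iff]
    intro φ hφ
    simp
  · rintro f g - - ⟨h, hh, hL⟩ ⟨h', hh', hL'⟩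
    refine ⟨h + h', Submodule.add_mem _ hh hh', ?_⟩
    convert hL.add hL' using 1
    module
  · rintro c f - ⟨h, hh, hL⟩
    refine ⟨c • h, Submodule.smul_mem _ _ hh, ?_⟩
    convert hL.smul c using 1
    module

/-- The polynomials are dense in `L²(S²)`. -/
theorem dense_iSup_polySpace : (⨆ n, polySpace n).topologicalClosure = ⊤ := by
  let coord : Fin 3 → C(S2, ℂ) := fun i =>
    ⟨fun p => (((p : R3) i : ℝ) : ℂ), by fun_prop⟩
  let monC : (Fin 3 → ℕ) → C(S2, ℂ) := fun α =>
    ⟨fun p => monomialFun α (p : R3), (smoothOnSphere_monomialFun α).continuous⟩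
  let A : Subalgebra ℂ C(S2, ℂ) := Algebra.adjoin ℂ (range coord)
  have hstar : ∀ i, star (coord i) = coord i := by
    intro i
    ext p
    simp [coord]
  let B : StarSubalgebra ℂ C(S2, ℂ) :=
    { A with
      star_mem' := fun {f} hf => by
        refine Algebra.adjoin_induction (p := fun f _ => star f ∈ A) ?_ ?_ ?_ ?_ hf
        · rintro _ ⟨i, rfl⟩
          rw [hstar]
          exact Algebra.subset_adjoin ⟨i, rfl⟩
        · intro c
          rw [← algebraMap_star_comm]
          exact A.algebraMap_mem _
        · intro f g _ _ h1 h2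
          rw [star_add]
          exact A.add_mem h1 h2
        · intro f g _ _ h1 h2
          rw [star_mul]
          exact A.mul_mem h2 h1 }
  have hsep : B.SeparatesPoints := by
    intro p q hpq
    by_contra! hcon
    refine hpq (Subtype.ext (PiLp.ext fun i => ?_))
    have : (((p : R3) i : ℝ) : ℂ) = (((q : R3) i : ℝ) : ℂ) :=
      hcon _ ⟨coord i, Algebra.subset_adjoin ⟨i, rfl⟩, rfl⟩
    exact_mod_cast this
  have hB := ContinuousMap.starSubalgebra_topologicalClosure_eq_top_of_separatesPoints B hsep
  have hmem : ∀ f ∈ A, ContinuousMap.toLp (E := ℂ) 2 surface ℂ f ∈ ⨆ n, polySpace n := by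
    intro f hf
    have h1 : f ∈ Submodule.span ℂ (range monC) := by
      have h2 : f ∈ Subalgebra.toSubmodule A := hf
      rw [Algebra.adjoin_eq_span] at h2
      refine Submodule.span_mono ?_ h2
      intro g hg
      refine Submonoid.closure_induction (motive := fun g _ => g ∈ range monC) ?_ ?_ ?_ hg
      · rintro _ ⟨i, rfl⟩
        refine ⟨Pi.single i 1, ?_⟩
        ext p
        simp only [monC, coord, ContinuousMap.coe_mk, monomialFun]
        rw [Finset.prod_eq_single i]
        · simp
        · intro j _ hj
          simp [hj]
        · simp
      · exact ⟨0, by ext p; simp [monC, monomialFun]⟩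
      · rintro _ _ _ _ ⟨α, rfl⟩ ⟨β, rfl⟩
        refine ⟨α + β, ?_⟩
        ext p
        simp [monC, monomialFun, pow_add, Finset.prod_mul_distrib]
    refine Submodule.span_induction (p := fun f _ =>
      ContinuousMap.toLp (E := ℂ) 2 surface ℂ f ∈ ⨆ n, polySpace n) ?_ ?_ ?_ ?_ h1
    · rintro _ ⟨α, rfl⟩
      exact Submodule.mem_iSup_of_mem ((∑ i, α i) + 1) (monomialClass_mem (Nat.lt_succ_self _))
    · rw [map_zero]; exact zero_mem _
    · intro f g _ _ h1 h2
      rw [map_add]; exact Submodule.add_mem _ h1 h2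
    · intro c f _ h1
      rw [map_smul]; exact Submodule.smul_mem _ _ h1
  have hdense : DenseRange (ContinuousMap.toLp (E := ℂ) 2 (surface : Measure S2) ℂ) :=
    ContinuousMap.toLp_denseRange ℂ surface ℂ (by norm_num)
  have hAd : Dense (A : Set C(S2, ℂ)) := by
    intro f
    have h1 : f ∈ B.topologicalClosure := hB ▸ StarSubalgebra.mem_top
    exact h1
  rw [← Submodule.dense_iff_topologicalClosure_eq_top]
  refine (hdense.dense_image (ContinuousLinearMap.continuous _) hAd).mono ?_
  rintro _ ⟨f, hf, rfl⟩
  exact hmem f hf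

end Harmonics

end HomPot

namespace HomPot

section Diagonal

open Filter Topology
open scoped InnerProductSpace

variable {H : Type*} [NormedAddCommGroup H] [InnerProductSpace ℂ H] [CompleteSpace H] {ι : Type*}

omit [CompleteSpace H] in
theorem isCompactOperator_rankOne (x y : H) :
    IsCompactOperator (InnerProductSpace.rankOne ℂ x y) := by
  have h : (InnerProductSpace.rankOne ℂ x y : H →L[ℂ] H) =
      (ContinuousLinearMap.toSpanSingleton ℂ x) ∘L (innerSL ℂ y) := by
    ext z
    simp
  rw [h]
  have h2 : IsCompactOperator (innerSL ℂ y : H →L[ℂ] ℂ) :=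
    isCompactOperator_of_locallyCompactSpace_dom (innerSL ℂ y : H →L[ℂ] ℂ)
  exact h2.clm_comp (ContinuousLinearMap.toSpanSingleton ℂ x)

omit [CompleteSpace H] in
theorem isCompactOperator_sum (s : Finset ι) (f : ι → H →L[ℂ] H)
    (hf : ∀ i ∈ s, IsCompactOperator (f i)) : IsCompactOperator (∑ i ∈ s, f i : H →L[ℂ] H) := by
  have h : ∑ i ∈ s, f i ∈ compactOperator (RingHom.id ℂ) H H := Submodule.sum_mem _ hf
  exact h

/-- Diagonal operators with entries tending to `0` are compact. -/
theorem exists_diagonal_operator (b : HilbertBasis ι ℂ H) {a : ι → ℝ}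
    (ha : Tendsto a cofinite (𝓝 0)) :
    ∃ T : H →L[ℂ] H, IsCompactOperator T ∧ ∀ x i, ⟪b i, T x⟫_ℂ = a i * ⟪b i, x⟫_ℂ := by
  classical
  let f : ι → H →L[ℂ] H := fun i => (a i : ℂ) • InnerProductSpace.rankOne ℂ (b i) (b i)
  have hf : Summable f := by
    rw [summable_iff_vanishing_norm]
    intro ε hε
    have h1 : {i | ¬ |a i| < ε / 2}.Finite := by
      have := ha.eventually (Metric.ball_mem_nhds 0 (half_pos hε))
      simpa [Real.dist_eq] using this
    refine ⟨h1.toFinset, fun t ht => ?_⟩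
    refine lt_of_le_of_lt ?_ (half_lt_self hε)
    refine ContinuousLinearMap.opNorm_le_bound _ (half_pos hε).le fun x => ?_
    have h2 : (∑ i ∈ t, f i) x = ∑ i ∈ t, ((a i : ℂ) * ⟪b i, x⟫_ℂ) • b i := by
      simp only [f, sum_apply, smul_apply, InnerProductSpace.rankOne_apply, smul_smul]
    have h3 : ‖∑ i ∈ t, ((a i : ℂ) * ⟪b i, x⟫_ℂ) • b i‖ ^ 2 =
        ∑ i ∈ t, ‖(a i : ℂ) * ⟪b i, x⟫_ℂ‖ ^ 2 := by
      have h4 := b.orthonormal.inner_sum (fun i => (a i : ℂ) * ⟪b i, x⟫_ℂ)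
        (fun i => (a i : ℂ) * ⟪b i, x⟫_ℂ) t
      rw [inner_self_ofReal] at h4
      have h5 : ∀ z : ℂ, (starRingEnd ℂ) z * z = ((‖z‖ ^ 2 : ℝ) : ℂ) := by
        intro z
        rw [Complex.conj_mul']
        push_cast
        rfl
      simp only [h5] at h4
      exact_mod_cast h4
    have h6 : ‖∑ i ∈ t, ((a i : ℂ) * ⟪b i, x⟫_ℂ) • b i‖ ^ 2 ≤ (ε / 2 * ‖x‖) ^ 2 := by
      rw [h3, mul_pow]
      calc ∑ i ∈ t, ‖(a i : ℂ) * ⟪b i, x⟫_ℂ‖ ^ 2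
          ≤ ∑ i ∈ t, (ε / 2) ^ 2 * ‖⟪b i, x⟫_ℂ‖ ^ 2 := by
            refine Finset.sum_le_sum fun i hi => ?_
            rw [norm_mul, mul_pow, Complex.norm_real]
            have : |a i| < ε / 2 := by
              by_contra hcon
              exact Finset.disjoint_left.1 ht hi (by simpa using hcon)
            gcongr
            exact this.le
        _ = (ε / 2) ^ 2 * ∑ i ∈ t, ‖⟪b i, x⟫_ℂ‖ ^ 2 := by rw [Finset.mul_sum]
        _ ≤ (ε / 2) ^ 2 * ‖x‖ ^ 2 := by
            gcongr
            exact b.orthonormal.sum_inner_products_le x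
    rw [h2]
    exact le_of_sq_le_sq h6 (by positivity)
  refine ⟨∑' i, f i, ?_, fun x i => ?_⟩
  · refine isCompactOperator_of_tendsto (l := atTop) hf.hasSum
      (Eventually.of_forall fun s => isCompactOperator_sum s f fun i _ =>
        (isCompactOperator_rankOne _ _).smul (a i : ℂ))
  · have h1 : HasSum (fun j => ⟪b i, f j x⟫_ℂ) ⟪b i, (∑' i, f i) x⟫_ℂ := by
      have h2 := hf.hasSum.mapL ((innerSL ℂ (b i)) ∘L (ContinuousLinearMap.apply ℂ H x))
      simpa using h2
    refine h1.unique ?_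
    have h3 : ∀ j, j ≠ i → ⟪b i, f j x⟫_ℂ = 0 := by
      intro j hj
      have h4 : ⟪b i, b j⟫_ℂ = 0 := b.orthonormal.2 hj.symm
      simp [f, h4]
    have h5 : ⟪b i, f i x⟫_ℂ = a i * ⟪b i, x⟫_ℂ := by
      have h6 : ⟪b i, b i⟫_ℂ = 1 := by rw [inner_self_ofReal, b.orthonormal.1 i]; simp
      simp only [f, smul_apply, InnerProductSpace.rankOne_apply, inner_smul_right, h6, mul_one]
    rw [← h5]
    exact hasSum_single i h3

omit [CompleteSpace H] in
theorem hasSum_re_inner (b : HilbertBasis ι ℂ H) {x y : H} {a : ι → ℝ}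
    (h : ∀ i, ⟪b i, y⟫_ℂ = a i * ⟪b i, x⟫_ℂ) :
    HasSum (fun i => a i * ‖⟪b i, x⟫_ℂ‖ ^ 2) (⟪x, y⟫_ℂ).re := by
  have h1 := Complex.hasSum_re (b.hasSum_inner_mul_inner x y)
  convert h1 using 1
  funext i
  rw [h i, ← inner_conj_symm x (b i), mul_left_comm, Complex.conj_mul']
  rw [← Complex.ofReal_pow, ← Complex.ofReal_mul, Complex.ofReal_re]

end Diagonal

end HomPot

namespace HomPot

section SphereSpectrum

open Filter Topology
open scoped InnerProductSpace

theorem eq_zero_of_inner_monomialClass {w : Lp ℂ 2 surface}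
    (h : ∀ α, ⟪monomialClass α, w⟫_ℂ = 0) : w = 0 := by
  have h1 : w ∈ (⨆ n, polySpace n)ᗮ := by
    rw [Submodule.mem_orthogonal]
    have h2 : (⨆ n, polySpace n) ≤ (ℂ ∙ w)ᗮ := by
      refine iSup_le fun n => Submodule.span_le.2 ?_
      rintro _ ⟨α, -, rfl⟩
      rw [SetLike.mem_coe, Submodule.mem_orthogonal_singleton_iff_inner_left]
      exact h α
    intro u hu
    exact Submodule.mem_orthogonal_singleton_iff_inner_left.1 (h2 hu)
  rw [Submodule.topologicalClosure_eq_top_iff.1 dense_iSup_polySpace] at h1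
  simpa using h1

theorem HasSphereLaplacian.unique {u w w' : Lp ℂ 2 surface} (h : HasSphereLaplacian u w)
    (h' : HasSphereLaplacian u w') : w = w' := by
  rw [hasSphereLaplacian_iff] at h h'
  rw [← sub_eq_zero]
  refine eq_zero_of_inner_monomialClass fun α => ?_
  have hα := smoothOnSphere_monomialFun α
  rw [inner_sub_right]
  exact sub_eq_zero.2 ((h _ hα).symm.trans (h' _ hα))

theorem hasSphereLaplacian_zero : HasSphereLaplacian 0 0 := by
  rw [hasSphereLaplacian_iff]
  intro φ hφ
  simp

theorem HasSphereLaplacian.inner_eq_of_mem {n : ℕ} {f g u w : Lp ℂ 2 surface}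
    (hf : f ∈ polySpace n) (hfg : HasSphereLaplacian f g) (h : HasSphereLaplacian u w) :
    ⟪g, u⟫_ℂ = ⟪f, w⟫_ℂ := by
  have key : ∃ g, HasSphereLaplacian f g ∧ ∀ u w, HasSphereLaplacian u w →
      ⟪g, u⟫_ℂ = ⟪f, w⟫_ℂ := by
    refine Submodule.span_induction (p := fun f _ => ∃ g, HasSphereLaplacian f g ∧
      ∀ u w, HasSphereLaplacian u w → ⟪g, u⟫_ℂ = ⟪f, w⟫_ℂ) ?_ ?_ ?_ ?_ hf
    · rintro _ ⟨α, -, rfl⟩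
      have hα := smoothOnSphere_monomialFun α
      exact ⟨_, hasSphereLaplacian_sphereClass hα, fun u w h =>
        hasSphereLaplacian_iff.1 h _ hα⟩
    · exact ⟨0, hasSphereLaplacian_zero, fun u w _ => by simp⟩
    · rintro x y - - ⟨gx, hx, hx'⟩ ⟨gy, hy, hy'⟩
      refine ⟨gx + gy, hx.add hy, fun u w h => ?_⟩
      rw [inner_add_left, inner_add_left, hx' u w h, hy' u w h]
    · rintro c x - ⟨gx, hx, hx'⟩
      refine ⟨c • gx, hx.smul c, fun u w h => ?_⟩
      rw [inner_smul_left, inner_smul_left, hx' u w h]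
  obtain ⟨g', hg', H⟩ := key
  rw [hfg.unique hg']
  exact H u w h

theorem polySpace_zero : polySpace 0 = ⊥ := by
  rw [polySpace]
  simp

/-- The spherical harmonics of degree `n`. -/
noncomputable def harmonicSpace (n : ℕ) : Submodule ℂ (Lp ℂ 2 surface) :=
  polySpace (n + 1) ⊓ (polySpace n)ᗮ

instance (n : ℕ) : FiniteDimensional ℂ (harmonicSpace n) :=
  Submodule.finiteDimensional_of_le inf_le_left

theorem exists_hasSphereLaplacian_mem {n : ℕ} {z : Lp ℂ 2 surface} (hz : z ∈ polySpace n) :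
    ∃ g ∈ polySpace n, HasSphereLaplacian z g := by
  cases n with
  | zero =>
    rw [polySpace_zero, Submodule.mem_bot] at hz
    exact ⟨0, Submodule.zero_mem _, hz ▸ hasSphereLaplacian_zero⟩
  | succ m =>
    obtain ⟨h, hh, hL⟩ := exists_hasSphereLaplacian_polySpace hz
    exact ⟨_, Submodule.add_mem _ (Submodule.smul_mem _ _ hz)
      (polySpace_mono (Nat.le_succ m) hh), hL⟩

theorem hasSphereLaplacian_harmonicSpace {n : ℕ} {f : Lp ℂ 2 surface}
    (hf : f ∈ harmonicSpace n) : HasSphereLaplacian f (((n : ℂ) * (n + 1)) • f) := by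
  obtain ⟨hf1, hf2⟩ := hf
  obtain ⟨h, hh, hL⟩ := exists_hasSphereLaplacian_polySpace hf1
  have h0 : h = 0 := by
    obtain ⟨g, hg, hgL⟩ := exists_hasSphereLaplacian_mem hh
    have h1 := HasSphereLaplacian.inner_eq_of_mem hh hgL hL
    rw [SetLike.mem_coe, Submodule.mem_orthogonal] at hf2
    rw [hf2 g hg, inner_add_right, inner_smul_right, hf2 h hh, mul_zero, zero_add] at h1
    exact inner_self_eq_zero.1 h1.symm
  rwa [h0, add_zero] at hL

theorem orthogonalFamily_harmonicSpace :
    OrthogonalFamily ℂ (fun n => harmonicSpace n) fun n => (harmonicSpace n).subtypeₗᵢ := by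
  refine OrthogonalFamily.of_pairwise fun m n hmn => ?_
  have key : ∀ {m n : ℕ}, m < n → harmonicSpace m ⟂ harmonicSpace n := fun {m n} h =>
    (Submodule.isOrtho_orthogonal_right (polySpace n)).mono
      (inf_le_left.trans (polySpace_mono h)) inf_le_right
  rcases lt_or_gt_of_ne hmn with h | h
  · exact key h
  · exact (key h).symm

/-- The index set of a Hilbert basis of spherical harmonics. -/
abbrev HarmonicIndex : Type := Σ n : ℕ, Fin (Module.finrank ℂ (harmonicSpace n))

noncomputable def harmonicFamily (i : HarmonicIndex) : Lp ℂ 2 surface :=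
  (stdOrthonormalBasis ℂ (harmonicSpace i.1) i.2 : harmonicSpace i.1)

theorem harmonicFamily_mem (i : HarmonicIndex) : harmonicFamily i ∈ harmonicSpace i.1 :=
  (stdOrthonormalBasis ℂ (harmonicSpace i.1) i.2).2

theorem orthonormal_harmonicFamily : Orthonormal ℂ harmonicFamily := by
  have h := orthogonalFamily_harmonicSpace.orthonormal_sigma_orthonormal
    (v_family := fun n j => stdOrthonormalBasis ℂ (harmonicSpace n) j)
    fun n => (stdOrthonormalBasis ℂ (harmonicSpace n)).orthonormal
  have h2 : harmonicFamily = fun a : HarmonicIndex => (harmonicSpace a.1).subtypeₗᵢ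
      (stdOrthonormalBasis ℂ (harmonicSpace a.1) a.2) := rfl
  rw [h2]
  exact h

theorem harmonicSpace_le_span (n : ℕ) :
    harmonicSpace n ≤ Submodule.span ℂ (range harmonicFamily) := by
  intro x hx
  have h1 := (stdOrthonormalBasis ℂ (harmonicSpace n)).sum_repr ⟨x, hx⟩
  have h2 := congrArg (fun z : harmonicSpace n => (z : Lp ℂ 2 surface)) h1
  simp only [AddSubmonoidClass.coe_finsetSum, SetLike.val_smul] at h2
  rw [← h2]
  exact Submodule.sum_mem _ fun j _ => Submodule.smul_mem _ _
    (Submodule.subset_span ⟨⟨n, j⟩, rfl⟩)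

theorem polySpace_le_span (n : ℕ) : polySpace n ≤ Submodule.span ℂ (range harmonicFamily) := by
  induction n with
  | zero => rw [polySpace_zero]; exact bot_le
  | succ n ih =>
    rw [← Submodule.sup_orthogonal_inf_of_hasOrthogonalProjection (polySpace_mono (Nat.le_succ n))]
    refine sup_le ih (le_trans (le_of_eq ?_) (harmonicSpace_le_span n))
    rw [inf_comm, harmonicSpace]

noncomputable def harmonicBasis : HilbertBasis HarmonicIndex ℂ (Lp ℂ 2 surface) :=
  HilbertBasis.mk orthonormal_harmonicFamily (by
    rw [← dense_iSup_polySpace]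
    exact Submodule.topologicalClosure_mono (iSup_le polySpace_le_span))

theorem harmonicBasis_apply (i : HarmonicIndex) : harmonicBasis i = harmonicFamily i := by
  rw [harmonicBasis, HilbertBasis.coe_mk]

theorem hasSphereLaplacian_iff_inner {u w : Lp ℂ 2 surface} : HasSphereLaplacian u w ↔
    ∀ i : HarmonicIndex, ⟪harmonicBasis i, w⟫_ℂ =
      ((i.1 * (i.1 + 1) : ℝ) : ℂ) * ⟪harmonicBasis i, u⟫_ℂ := by
  have key : ∀ {u w : Lp ℂ 2 surface}, HasSphereLaplacian u w →
      ∀ i : HarmonicIndex, ⟪harmonicBasis i, w⟫_ℂ =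
      ((i.1 * (i.1 + 1) : ℝ) : ℂ) * ⟪harmonicBasis i, u⟫_ℂ := by
    intro u w h i
    rw [harmonicBasis_apply]
    have h1 := harmonicFamily_mem i
    rw [← HasSphereLaplacian.inner_eq_of_mem h1.1 (hasSphereLaplacian_harmonicSpace h1) h,
      inner_smul_left]
    simp
  refine ⟨key, fun h => ?_⟩
  rw [hasSphereLaplacian_iff]
  intro φ hφ
  have h1 := key (hasSphereLaplacian_sphereClass hφ)
  set f := sphereClass φ hφ.continuous
  set g := sphereClass (sphereLaplacian φ) hφ.continuous_sphereLaplacian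
  refine (harmonicBasis.hasSum_inner_mul_inner g u).unique ?_
  convert harmonicBasis.hasSum_inner_mul_inner f w using 1
  funext i
  rw [h i, ← inner_conj_symm g, h1 i, map_mul, Complex.conj_ofReal, inner_conj_symm]
  ring

/-- The resolvent `(1 + Δ)⁻¹` on the sphere. -/
theorem exists_sphere_resolvent : ∃ T : Lp ℂ 2 surface →L[ℂ] Lp ℂ 2 surface,
    IsCompactOperator T ∧ (T : Lp ℂ 2 surface →ₗ[ℂ] Lp ℂ 2 surface).IsSymmetric ∧
    (∀ z, ‖T z‖ ^ 2 ≤ (⟪T z, z⟫_ℂ).re) ∧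
    ∀ u w, HasSphereLaplacian u w ↔ u = T (u + w) := by
  let a : HarmonicIndex → ℝ := fun i => (1 + (i.1 : ℝ) * (i.1 + 1))⁻¹
  have ha : Tendsto a cofinite (𝓝 0) := by
    have h1 : Tendsto (fun n : ℕ => (1 + (n : ℝ) * (n + 1))⁻¹) cofinite (𝓝 0) := by
      rw [Nat.cofinite_eq_atTop]
      refine tendsto_inv_atTop_zero.comp ?_
      refine tendsto_atTop_mono (fun n => ?_) tendsto_natCast_atTop_atTop
      nlinarith [Nat.cast_nonneg (α := ℝ) n, sq_nonneg (n : ℝ)]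
    refine h1.comp (Tendsto.cofinite_of_finite_preimage_singleton fun n => ?_)
    refine (Set.finite_range fun j : Fin (Module.finrank ℂ (harmonicSpace n)) =>
      (⟨n, j⟩ : HarmonicIndex)).subset ?_
    rintro ⟨m, j⟩ hm
    obtain rfl : m = n := hm
    exact ⟨j, rfl⟩
  have ha0 : ∀ i, 0 < a i := fun i => by positivity
  have ha1 : ∀ i, a i ≤ 1 := fun i => inv_le_one_of_one_le₀ (by
    have : 0 ≤ (i.1 : ℝ) * (i.1 + 1) := by positivity
    linarith)
  obtain ⟨T, hT, hTa⟩ := exists_diagonal_operator harmonicBasis ha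
  refine ⟨T, hT, ?_, ?_, ?_⟩
  · intro x y
    change ⟪T x, y⟫_ℂ = ⟪x, T y⟫_ℂ
    refine (harmonicBasis.hasSum_inner_mul_inner (T x) y).unique ?_
    convert harmonicBasis.hasSum_inner_mul_inner x (T y) using 1
    funext i
    rw [hTa, ← inner_conj_symm (T x), hTa, map_mul, Complex.conj_ofReal, inner_conj_symm]
    ring
  · intro z
    have h1 := hasSum_re_inner harmonicBasis (hTa z)
    have h2 := hasSum_re_inner (x := T z) (y := T z) (a := fun _ => 1) harmonicBasis
      fun i => by simp
    rw [inner_self_ofReal, Complex.ofReal_re] at h2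
    rw [← inner_conj_symm, Complex.conj_re]
    refine hasSum_le (fun i => ?_) h2 h1
    rw [hTa, norm_mul, mul_pow, Complex.norm_real, Real.norm_of_nonneg (ha0 i).le, one_mul, sq,
      mul_assoc]
    refine mul_le_mul_of_nonneg_left ?_ (ha0 i).le
    exact mul_le_of_le_one_left (sq_nonneg _) (ha1 i)
  · intro u w
    rw [hasSphereLaplacian_iff_inner]
    have h1 : u = T (u + w) ↔ ∀ i, ⟪harmonicBasis i, u⟫_ℂ = ⟪harmonicBasis i, T (u + w)⟫_ℂ := by
      refine ⟨fun h i => by rw [← h], fun h => ?_⟩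
      refine harmonicBasis.repr.injective (lp.ext (funext fun i => ?_))
      rw [HilbertBasis.repr_apply_apply, HilbertBasis.repr_apply_apply, h i]
    rw [h1]
    refine forall_congr' fun i => ?_
    rw [hTa, inner_add_right]
    have h2 : (1 + ((i.1 * (i.1 + 1) : ℝ) : ℂ)) ≠ 0 := by
      have : (1 + (i.1 : ℝ) * (i.1 + 1)) ≠ 0 := by positivity
      exact_mod_cast this
    have h3 : ((a i : ℝ) : ℂ) = (1 + ((i.1 * (i.1 + 1) : ℝ) : ℂ))⁻¹ := by
      simp only [a]; push_cast; rfl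
    rw [h3, eq_inv_mul_iff_mul_eq₀ h2, add_mul, one_mul, add_right_inj, eq_comm]

/-- The spectral gap of the sphere. -/
theorem HasSphereLaplacian.exists_gap {u w : Lp ℂ 2 surface} (h : HasSphereLaplacian u w) :
    ∃ c : ℂ, 2 * ‖u - c • monomialClass 0‖ ^ 2 ≤ (⟪u, w⟫_ℂ).re := by
  obtain ⟨u0, hu0, v, hv, rfl⟩ := (polySpace 1).exists_add_mem_mem_orthogonal u
  have h0 : HasSphereLaplacian u0 0 := by
    obtain ⟨g, hg, hL⟩ := exists_hasSphereLaplacian_polySpace hu0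
    rw [polySpace_zero, Submodule.mem_bot] at hg
    simpa [hg] using hL
  have hvL : HasSphereLaplacian v w := by
    have := h.add (h0.smul (-1))
    simpa using this
  have hin : ⟪u0, w⟫_ℂ = 0 := by
    rw [← HasSphereLaplacian.inner_eq_of_mem hu0 h0 h, inner_zero_left]
  obtain ⟨c, rfl⟩ : ∃ c : ℂ, c • monomialClass 0 = u0 := by
    have h1 : polySpace 1 = ℂ ∙ monomialClass 0 := by
      rw [polySpace]
      congr 1
      have : {α : Fin 3 → ℕ | ∑ i, α i < 1} = {0} := by
        ext α
        simp [Finset.sum_eq_zero_iff, funext_iff]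
      rw [this, image_singleton]
    rw [h1] at hu0
    exact Submodule.mem_span_singleton.1 hu0
  refine ⟨c, ?_⟩
  rw [add_sub_cancel_left, inner_add_left, hin, zero_add]
  have h1 := hasSum_re_inner harmonicBasis (hasSphereLaplacian_iff_inner.1 hvL)
  have h2 := hasSum_re_inner (x := v) (y := (2 : ℂ) • v) (a := fun _ => 2) harmonicBasis
    fun i => by simp
  rw [inner_smul_right, inner_self_ofReal] at h2
  have h3 : ((2 : ℂ) * ((‖v‖ ^ 2 : ℝ) : ℂ)).re = 2 * ‖v‖ ^ 2 := by
    rw [← Complex.ofReal_ofNat, ← Complex.ofReal_mul, Complex.ofReal_re]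
  rw [h3] at h2
  refine hasSum_le (fun i => ?_) h2 h1
  obtain ⟨n, j⟩ := i
  rcases Nat.eq_zero_or_pos n with rfl | hn
  · have h4 : ⟪harmonicBasis ⟨0, j⟩, v⟫_ℂ = 0 := by
      rw [harmonicBasis_apply]
      exact hv _ (harmonicFamily_mem ⟨0, j⟩).1
    rw [h4]
    simp
  · have : (1 : ℝ) ≤ n := by exact_mod_cast hn
    refine mul_le_mul_of_nonneg_right ?_ (sq_nonneg _)
    simp only
    nlinarith

end SphereSpectrum

end HomPot

namespace HomPot

section Profile

open Filter Topology
open scoped InnerProductSpace Pointwise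

/-- Nondecreasing functions on `[0, π/2]` that increase from `-1/3` to `0`, the increase taking
place near `π/2`. -/
structure IsProfile (P : ℝ → ℝ) : Prop where
  mono : MonotoneOn P (Icc 0 (Real.pi / 2))
  end_eq : P (Real.pi / 2) = 0
  cap : ∀ θ, 0 ≤ θ → θ < Real.pi / 2 - 1 / 50 → P θ = -1 / 3

variable {P : ℝ → ℝ}

theorem IsProfile.nonpos (hP : IsProfile P) {θ : ℝ} (h0 : 0 ≤ θ) (h1 : θ ≤ Real.pi / 2) :
    P θ ≤ 0 := by
  rw [← hP.end_eq]
  exact hP.mono ⟨h0, h1⟩ ⟨by positivity, le_rfl⟩ h1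

theorem IsProfile.ge (hP : IsProfile P) {θ : ℝ} (h0 : 0 ≤ θ) (h1 : θ ≤ Real.pi / 2) :
    -1 / 3 ≤ P θ := by
  rw [← hP.cap 0 le_rfl (by linarith [Real.pi_gt_three])]
  exact hP.mono ⟨le_rfl, by positivity⟩ ⟨h0, h1⟩ h0

theorem IsProfile.abs_le (hP : IsProfile P) {θ : ℝ} (h0 : 0 ≤ θ) (h1 : θ ≤ Real.pi / 2) :
    |P θ| ≤ 1 / 3 := by
  rw [_root_.abs_le]
  constructor <;> linarith [hP.nonpos h0 h1, hP.ge h0 h1]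

theorem colatitude_nonneg (p : S2) : 0 ≤ colatitude p := Real.arccos_nonneg _

theorem colatitude_le_pi (p : S2) : colatitude p ≤ Real.pi := Real.arccos_le_pi _

theorem continuous_colatitude : Continuous colatitude := by
  unfold colatitude
  fun_prop

theorem IsProfile.abs_evenExt_le (hP : IsProfile P) (p : S2) : |evenExt P p| ≤ 1 / 3 := by
  have h0 := colatitude_nonneg p
  have h1 := colatitude_le_pi p
  unfold evenExt
  split_ifs with h
  · exact hP.abs_le h0 h
  · exact hP.abs_le (by linarith) (by linarith)

theorem IsProfile.abs_oddExt_le (hP : IsProfile P) (p : S2) : |oddExt P p| ≤ 1 / 3 := by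
  have h0 := colatitude_nonneg p
  have h1 := colatitude_le_pi p
  unfold oddExt
  split_ifs with h
  · exact hP.abs_le h0 h
  · rw [abs_neg]
    exact hP.abs_le (by linarith) (by linarith)

theorem IsProfile.evenExt_nonpos (hP : IsProfile P) (p : S2) : evenExt P p ≤ 0 := by
  have h0 := colatitude_nonneg p
  have h1 := colatitude_le_pi p
  unfold evenExt
  split_ifs with h
  · exact hP.nonpos h0 h
  · exact hP.nonpos (by linarith) (by linarith)

theorem IsProfile.exists_measurable (hP : IsProfile P) :
    ∃ Q : ℝ → ℝ, Measurable Q ∧ ∀ θ, 0 ≤ θ → θ ≤ Real.pi / 2 → Q θ = P θ := by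
  have h : (0 : ℝ) ≤ Real.pi / 2 := by positivity
  refine ⟨IccExtend h (P ∘ (↑)), Monotone.measurable ?_, fun θ h0 h1 => ?_⟩
  · exact Monotone.IccExtend h fun x y hxy => hP.mono x.2 y.2 hxy
  · exact IccExtend_of_mem h _ ⟨h0, h1⟩

theorem IsProfile.measurable_evenExt (hP : IsProfile P) : Measurable (evenExt P) := by
  obtain ⟨Q, hQ, hQP⟩ := hP.exists_measurable
  have h : evenExt P = fun p => if colatitude p ≤ Real.pi / 2 then Q (colatitude p)
      else Q (Real.pi - colatitude p) := by
    funext p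
    have h0 := colatitude_nonneg p
    have h1 := colatitude_le_pi p
    unfold evenExt
    split_ifs with h
    · exact (hQP _ h0 h).symm
    · exact (hQP _ (by linarith) (by linarith)).symm
  rw [h]
  have hc := continuous_colatitude.measurable
  exact Measurable.ite (measurableSet_le hc measurable_const) (hQ.comp hc)
    (hQ.comp (measurable_const.sub hc))

theorem IsProfile.measurable_oddExt (hP : IsProfile P) : Measurable (oddExt P) := by
  have h : oddExt P = fun p => if colatitude p ≤ Real.pi / 2 then evenExt P p
      else -evenExt P p := by
    funext p
    unfold oddExt evenExt
    split_ifs <;> rfl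
  rw [h]
  have hc := continuous_colatitude.measurable
  exact Measurable.ite (measurableSet_le hc measurable_const) hP.measurable_evenExt
    hP.measurable_evenExt.neg

/-- The reflection in the plane of the equator as a linear isometry. -/
noncomputable def reflectIso : R3 ≃ₗᵢ[ℝ] R3 where
  toFun := reflect
  invFun := reflect
  left_inv x := by ext i; fin_cases i <;> simp [reflect]
  right_inv x := by ext i; fin_cases i <;> simp [reflect]
  map_add' x y := by ext i; fin_cases i <;> simp [reflect]; ring
  map_smul' c x := by ext i; fin_cases i <;> simp [reflect]
  norm_map' x := by
    change ‖reflect x‖ = ‖x‖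
    simp [EuclideanSpace.norm_eq, Fin.sum_univ_three, reflect]

theorem reflect_reflect (x : R3) : reflect (reflect x) = x := reflectIso.left_inv x

theorem norm_reflect (x : R3) : ‖reflect x‖ = ‖x‖ := reflectIso.norm_map x

/-- The reflection of the sphere in the plane of the equator. -/
noncomputable def sphereReflect (p : S2) : S2 :=
  ⟨reflect p, by simp [norm_reflect]⟩

theorem sphereReflect_sphereReflect (p : S2) : sphereReflect (sphereReflect p) = p :=
  Subtype.ext (reflect_reflect _)

theorem continuous_sphereReflect : Continuous sphereReflect :=
  Continuous.subtype_mk (reflectIso.continuous.comp continuous_subtype_val) _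

theorem colatitude_sphereReflect (p : S2) :
    colatitude (sphereReflect p) = Real.pi - colatitude p := by
  rw [colatitude, colatitude, ← Real.arccos_neg]
  rfl

theorem IsProfile.oddExt_sphereReflect (hP : IsProfile P) (p : S2) :
    oddExt P (sphereReflect p) = -oddExt P p := by
  unfold oddExt
  rw [colatitude_sphereReflect]
  rcases lt_trichotomy (colatitude p) (Real.pi / 2) with h | h | h
  · rw [if_neg (by linarith), if_pos h.le, sub_sub_cancel]
  · rw [h, if_pos (by linarith), if_pos le_rfl, show Real.pi - Real.pi / 2 = Real.pi / 2 by ring,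
      hP.end_eq, neg_zero]
  · rw [if_pos (by linarith), if_neg (by linarith), neg_neg]

theorem measurePreserving_sphereReflect :
    MeasurePreserving sphereReflect surface surface := by
  refine ⟨continuous_sphereReflect.measurable, Measure.ext fun s hs => ?_⟩
  have hs' := continuous_sphereReflect.measurable hs
  rw [Measure.map_apply continuous_sphereReflect.measurable hs, Measure.toSphere_apply' _ hs',
    Measure.toSphere_apply' _ hs]
  congr 1
  rw [← reflectIso.measurePreserving.measure_preimage_emb
    reflectIso.toHomeomorph.measurableEmbedding]
  congr 1
  ext x
  simp only [Set.mem_smul, mem_preimage]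
  constructor
  · rintro ⟨r, hr, _, ⟨p, hp, rfl⟩, hx⟩
    refine ⟨r, hr, _, ⟨_, hp, rfl⟩, ?_⟩
    apply reflectIso.injective
    change reflectIso (r • reflectIso (p : R3)) = reflectIso x
    rw [← hx, map_smul]
    congr 1
    exact reflect_reflect _
  · rintro ⟨r, hr, _, ⟨p, hp, rfl⟩, rfl⟩
    refine ⟨r, hr, _, ⟨sphereReflect p, ?_, rfl⟩, (reflectIso.map_smul r (p : R3)).symm⟩
    rw [mem_preimage, sphereReflect_sphereReflect]
    exact hp

theorem integral_comp_sphereReflect (f : S2 → ℝ) :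
    ∫ p, f (sphereReflect p) ∂surface = ∫ p, f p ∂surface :=
  measurePreserving_sphereReflect.integral_comp
    ((Homeomorph.mk ⟨sphereReflect, sphereReflect, sphereReflect_sphereReflect,
      sphereReflect_sphereReflect⟩ continuous_sphereReflect
      continuous_sphereReflect).measurableEmbedding) f

/-- The angular form bound for potentials that are odd under the reflection. -/
theorem HasSphereLaplacian.ge_of_odd {u w : Lp ℂ 2 surface} (h : HasSphereLaplacian u w)
    {Q : S2 → ℝ} (hQ : Measurable Q) (hb : ∀ p, |Q p| ≤ 1 / 3)
    (hodd : ∀ p, Q (sphereReflect p) = -Q p) :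
    -(1 / 18) * ‖u‖ ^ 2 ≤ (⟪u, w⟫_ℂ).re + ∫ p, Q p * ‖u p‖ ^ 2 ∂surface := by
  obtain ⟨c, hc⟩ := h.exists_gap
  set v := u - c • monomialClass 0 with hv
  have hvae : ∀ᵐ p ∂surface, v p = u p - c := by
    filter_upwards [Lp.coeFn_sub u (c • monomialClass 0), Lp.coeFn_smul c (monomialClass 0),
      sphereClass_ae (smoothOnSphere_monomialFun 0).continuous] with p h1 h2 h3
    rw [hv, h1, Pi.sub_apply, h2, Pi.smul_apply, monomialClass, h3]
    simp [monomialFun]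
  have iu : Integrable (fun p => ‖u p‖ ^ 2) surface :=
    (Lp.memLp u).integrable_norm_pow (p := 2) (by norm_num)
  have iv : Integrable (fun p => ‖v p‖ ^ 2) surface :=
    (Lp.memLp v).integrable_norm_pow (p := 2) (by norm_num)
  have iQ := integrable_mul_norm_sq hQ hb u
  have hmp := measurePreserving_sphereReflect
  have iu' : Integrable (fun p => ‖u (sphereReflect p)‖ ^ 2) surface :=
    hmp.integrable_comp_of_integrable iu
  have iv' : Integrable (fun p => ‖v (sphereReflect p)‖ ^ 2) surface :=
    hmp.integrable_comp_of_integrable iv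
  have iQ' : Integrable (fun p => Q (sphereReflect p) * ‖u (sphereReflect p)‖ ^ 2) surface :=
    hmp.integrable_comp_of_integrable iQ
  have hpt : ∀ᵐ p ∂surface,
      -(1 / 2) * (Q p * ‖u p‖ ^ 2 + Q (sphereReflect p) * ‖u (sphereReflect p)‖ ^ 2) ≤
      (‖v p‖ ^ 2 + ‖v (sphereReflect p)‖ ^ 2) +
        (1 / 36) * (‖u p‖ ^ 2 + ‖u (sphereReflect p)‖ ^ 2) := by
    filter_upwards [hvae, hmp.quasiMeasurePreserving.ae hvae] with p h1 h2
    rw [hodd]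
    set A := ‖u p‖
    set B := ‖u (sphereReflect p)‖
    have hA : 0 ≤ A := norm_nonneg _
    have hB : 0 ≤ B := norm_nonneg _
    have hab : |A - B| ≤ ‖v p‖ + ‖v (sphereReflect p)‖ := by
      have h3 : u p - u (sphereReflect p) = v p - v (sphereReflect p) := by rw [h1, h2]; ring
      calc |A - B| ≤ ‖u p - u (sphereReflect p)‖ := abs_norm_sub_norm_le _ _
        _ ≤ _ := by rw [h3]; exact norm_sub_le _ _
    set a := ‖v p‖
    set b := ‖v (sphereReflect p)‖
    have ha : 0 ≤ a := norm_nonneg _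
    have hb' : 0 ≤ b := norm_nonneg _
    have h4 : -(Q p * ((A - B) * (A + B))) ≤ (1 / 3) * ((a + b) * (A + B)) := by
      calc -(Q p * ((A - B) * (A + B))) ≤ |Q p * ((A - B) * (A + B))| := neg_le_abs _
        _ = |Q p| * (|A - B| * (A + B)) := by
            rw [abs_mul, abs_mul, abs_of_nonneg (add_nonneg hA hB)]
        _ ≤ (1 / 3) * ((a + b) * (A + B)) := by
            gcongr
            exact hb p
    nlinarith [sq_nonneg (a - b), sq_nonneg (A - B), sq_nonneg (6 * (a + b) - (A + B))]
  have hI := integral_mono_ae ((iQ.add iQ').const_mul (-(1 / 2)))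
    ((iv.add iv').add ((iu.add iu').const_mul (1 / 36))) hpt
  have e1 : ∫ p, ‖v (sphereReflect p)‖ ^ 2 ∂surface = ∫ p, ‖v p‖ ^ 2 ∂surface :=
    integral_comp_sphereReflect fun p => ‖v p‖ ^ 2
  have e2 : ∫ p, ‖u (sphereReflect p)‖ ^ 2 ∂surface = ∫ p, ‖u p‖ ^ 2 ∂surface :=
    integral_comp_sphereReflect fun p => ‖u p‖ ^ 2
  have e3 : ∫ p, Q (sphereReflect p) * ‖u (sphereReflect p)‖ ^ 2 ∂surface =
      ∫ p, Q p * ‖u p‖ ^ 2 ∂surface := integral_comp_sphereReflect fun p => Q p * ‖u p‖ ^ 2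
  have hL : ∫ p, -(1 / 2) * (Q p * ‖u p‖ ^ 2 + Q (sphereReflect p) * ‖u (sphereReflect p)‖ ^ 2)
      ∂surface = - ∫ p, Q p * ‖u p‖ ^ 2 ∂surface := by
    rw [integral_const_mul, integral_add iQ iQ', e3]
    ring
  have hR : ∫ p, ((‖v p‖ ^ 2 + ‖v (sphereReflect p)‖ ^ 2) +
        (1 / 36) * (‖u p‖ ^ 2 + ‖u (sphereReflect p)‖ ^ 2)) ∂surface =
      2 * ‖v‖ ^ 2 + (1 / 18) * ‖u‖ ^ 2 := by
    rw [integral_add (f := fun p => ‖v p‖ ^ 2 + ‖v (sphereReflect p)‖ ^ 2)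
      (g := fun p => (1 / 36) * (‖u p‖ ^ 2 + ‖u (sphereReflect p)‖ ^ 2)) (iv.add iv')
      ((iu.add iu').const_mul _), integral_const_mul,
      integral_add iv iv', integral_add iu iu', e1, e2, norm_sq_eq_integral, norm_sq_eq_integral]
    ring
  have hI' := (hL.symm.le.trans hI).trans hR.le
  linarith

end Profile

section SphereEigenvalues

open Filter Topology
open scoped InnerProductSpace Pointwise

variable {Q : S2 → ℝ}

theorem hasSphereLaplacian_one : HasSphereLaplacian (monomialClass 0) 0 := by
  obtain ⟨g, hg, hL⟩ := exists_hasSphereLaplacian_polySpace (n := 0)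
    (monomialClass_mem (α := 0) (by simp))
  rw [polySpace_zero, Submodule.mem_bot] at hg
  simpa [hg] using hL

theorem IsSphereEigenfunction.rayleigh (hQ : Measurable Q) (hb : ∀ p, |Q p| ≤ 1 / 3) {μ : ℝ}
    {u w : Lp ℂ 2 surface} (hw : ∀ᵐ p ∂surface, w p + (Q p : ℂ) * u p = (μ : ℂ) * u p) :
    (⟪u, w⟫_ℂ).re + ∫ p, Q p * ‖u p‖ ^ 2 ∂surface = μ * ‖u‖ ^ 2 := by
  have h1 : w + mulOp surface hQ hb u = (μ : ℂ) • u := by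
    refine Lp.ext ?_
    filter_upwards [hw, Lp.coeFn_add w (mulOp surface hQ hb u), mulOp_ae hQ hb u,
      Lp.coeFn_smul (μ : ℂ) u] with p h1 h2 h3 h4
    rw [h2, Pi.add_apply, h3, h1, h4, Pi.smul_apply, smul_eq_mul]
  rw [← re_inner_mulOp hQ hb, ← Complex.add_re, ← inner_add_right, h1, inner_smul_right,
    inner_self_ofReal, ← Complex.ofReal_mul, Complex.ofReal_re]

theorem exists_isLeast_sphereEigenvalues (hQ : Measurable Q) (hb : ∀ p, |Q p| ≤ 1 / 3) :
    ∃ μ, IsLeast (sphereEigenvalues Q) μ ∧ ∀ u w, HasSphereLaplacian u w →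
      μ * ‖u‖ ^ 2 ≤ (⟪u, w⟫_ℂ).re + ∫ p, Q p * ‖u p‖ ^ 2 ∂surface := by
  obtain ⟨T, hTc, hTs, hT1, hT⟩ := exists_sphere_resolvent
  set M := mulOp surface hQ hb
  obtain ⟨K, hKs, hK0, hK, hKc, -⟩ := exists_resolvent hTs (mulOp_symmetric hQ hb)
    (c := 1) (m := 1 / 3) (by norm_num) (by norm_num) (fun z => by rw [one_mul]; exact hT1 z)
    (norm_mulOp_le hQ hb)
  have hK' : ∀ u w, HasSphereLaplacian u w ↔ u = K (u + w + M u) := by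
    intro u w
    rw [hT, hK, add_sub_cancel_right]
  have h2 : monomialClass 0 ≠ 0 := by
    intro h
    have h3 := sphereClass_ae (smoothOnSphere_monomialFun 0).continuous
    change (monomialClass 0 : S2 → ℂ) =ᵐ[surface] _ at h3
    rw [h] at h3
    have h4 : ∀ᵐ p ∂surface, False := by
      filter_upwards [h3, Lp.coeFn_zero ℂ 2 surface] with p h5 h6
      rw [h6] at h5
      simp [monomialFun] at h5
    rw [ae_iff] at h4
    simp at h4
    linarith [Real.pi_pos]
  obtain ⟨κ, hκ, ⟨x, hx, hxκ⟩, hmax⟩ := exists_max_eigenvalue hKs hK0 (hKc hTc)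
    (y₀ := monomialClass 0 + 0 + M (monomialClass 0)) (by rwa [← (hK' _ _).1 hasSphereLaplacian_one])
  have hlow : ∀ u w, HasSphereLaplacian u w →
      (κ⁻¹ - 1) * ‖u‖ ^ 2 ≤ (⟪u, w⟫_ℂ).re + ∫ p, Q p * ‖u p‖ ^ 2 ∂surface := by
    intro u w huw
    have h5 := hmax (u + w + M u)
    rw [← (hK' _ _).1 huw, inner_add_right, inner_add_right, inner_self_ofReal, Complex.add_re,
      Complex.add_re, Complex.ofReal_re, re_inner_mulOp hQ hb] at h5
    have h6 : κ⁻¹ * ‖u‖ ^ 2 ≤ ‖u‖ ^ 2 + (⟪u, w⟫_ℂ).re + ∫ p, Q p * ‖u p‖ ^ 2 ∂surface := by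
      rw [inv_mul_le_iff₀ hκ]
      exact h5
    linarith
  refine ⟨κ⁻¹ - 1, ⟨⟨x, hx, (κ⁻¹ : ℂ) • x - M x - x, ?_, ?_⟩, ?_⟩, hlow⟩
  · rw [hK']
    have h7 : x + ((κ⁻¹ : ℂ) • x - M x - x) + M x = (κ⁻¹ : ℂ) • x := by abel
    have h8 : (κ : ℂ) ≠ 0 := by exact_mod_cast hκ.ne'
    rw [h7, map_smul, hxκ, smul_smul, inv_mul_cancel₀ h8, one_smul]
  · filter_upwards [Lp.coeFn_sub ((κ⁻¹ : ℂ) • x - M x) x, Lp.coeFn_sub ((κ⁻¹ : ℂ) • x) (M x),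
      Lp.coeFn_smul (κ⁻¹ : ℂ) x, mulOp_ae hQ hb x] with p h1 h2 h3 h4
    rw [h1, Pi.sub_apply, h2, Pi.sub_apply, h3, h4, Pi.smul_apply, smul_eq_mul]
    push_cast
    ring
  · rintro μ ⟨u, hu, w, huw, hae⟩
    have h9 := hlow u w huw
    rw [IsSphereEigenfunction.rayleigh hQ hb hae] at h9
    exact le_of_mul_le_mul_right h9 (by have := norm_pos_iff.2 hu; positivity)

theorem surface_real_univ : surface.real univ = 4 * Real.pi := by
  rw [Measure.toSphere_real_apply_univ, measureReal_def, EuclideanSpace.volume_ball_fin_three]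
  simp only [finrank_euclideanSpace, Fintype.card_fin, ENNReal.ofReal_one, one_pow, one_mul]
  rw [ENNReal.toReal_ofReal (by positivity)]
  push_cast
  ring

theorem surface_band_le : surface.real {p : S2 | |(p : R3) 2| ≤ 1 / 50} ≤ 12 / 25 := by
  have hm : MeasurableSet {p : S2 | |(p : R3) 2| ≤ 1 / 50} :=
    (isClosed_le (by fun_prop) continuous_const).measurableSet
  let d : Fin 3 → ℝ := ![1, 1, 1 / 50]
  have hd : ∀ i, 0 ≤ d i := fun i => by fin_cases i <;> simp [d]
  have hbox : volume (Ioo (0 : ℝ) 1 • (Subtype.val '' {p : S2 | |(p : R3) 2| ≤ 1 / 50})) ≤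
      ENNReal.ofReal (4 / 25) := by
    calc volume (Ioo (0 : ℝ) 1 • (Subtype.val '' {p : S2 | |(p : R3) 2| ≤ 1 / 50}))
        ≤ volume (WithLp.ofLp ⁻¹' (Set.pi univ fun i => Icc (-d i) (d i)) : Set R3) := by
          refine measure_mono ?_
          rintro _ ⟨r, hr, _, ⟨p, hp, rfl⟩, rfl⟩
          rw [mem_preimage, mem_univ_pi]
          intro i
          have h1 : |r * (p : R3) i| ≤ |(p : R3) i| := by
            rw [abs_mul, abs_of_pos hr.1]
            exact mul_le_of_le_one_left (abs_nonneg _) hr.2.le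
          have h2 : |(p : R3) i| ≤ 1 := by
            have := PiLp.norm_apply_le (p : R3) i
            rwa [norm_coe_S2, Real.norm_eq_abs] at this
          rw [mem_Icc, ← abs_le]
          change |r * (p : R3) i| ≤ d i
          fin_cases i
          · exact h1.trans h2
          · exact h1.trans h2
          · exact h1.trans hp
      _ = ENNReal.ofReal (4 / 25) := by
          rw [(PiLp.volume_preserving_ofLp (Fin 3)).measure_preimage
            (MeasurableSet.univ_pi fun i => measurableSet_Icc).nullMeasurableSet, volume_pi_pi]
          simp only [Real.volume_Icc]
          rw [
            ← ENNReal.ofReal_prod_of_nonneg (fun i _ => by linarith [hd i])]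
          congr 1
          simp only [Fin.prod_univ_three, d, Matrix.cons_val]
          norm_num
  rw [measureReal_def, Measure.toSphere_apply' _ hm]
  refine ENNReal.toReal_le_of_le_ofReal (by norm_num) ?_
  calc (Module.finrank ℝ R3 : ENNReal) *
      volume (Ioo (0 : ℝ) 1 • (Subtype.val '' {p : S2 | |(p : R3) 2| ≤ 1 / 50}))
      ≤ (Module.finrank ℝ R3 : ENNReal) * ENNReal.ofReal (4 / 25) := by gcongr
    _ = ENNReal.ofReal (12 / 25) := by
        rw [finrank_euclideanSpace, Fintype.card_fin, ← ENNReal.ofReal_natCast,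
          ← ENNReal.ofReal_mul (by norm_num)]
        congr 1
        norm_num

theorem IsProfile.evenExt_eq {P : ℝ → ℝ} (hP : IsProfile P) {p : S2}
    (hp : 1 / 50 < |(p : R3) 2|) : evenExt P p = -1 / 3 := by
  have key : ∀ {t : ℝ}, 1 / 50 < t → t ≤ 1 → Real.arccos t < Real.pi / 2 - 1 / 50 := by
    intro t h1 h2
    have h3 : t ≤ Real.arcsin t := by
      have h4 := Real.sin_le (Real.arcsin_nonneg.2 (by linarith : 0 ≤ t))
      rwa [Real.sin_arcsin (by linarith) h2] at h4
    rw [Real.arccos_eq_pi_div_two_sub_arcsin]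
    linarith
  have h2 : |(p : R3) 2| ≤ 1 := by
    have := PiLp.norm_apply_le (p : R3) 2
    rwa [norm_coe_S2, Real.norm_eq_abs] at this
  rcases le_or_gt 0 ((p : R3) 2) with h | h
  · rw [abs_of_nonneg h] at hp h2
    have h3 := key hp h2
    unfold evenExt colatitude
    rw [if_pos (by linarith)]
    exact hP.cap _ (Real.arccos_nonneg _) h3
  · rw [abs_of_neg h] at hp h2
    have h3 := key hp h2
    rw [Real.arccos_neg] at h3
    unfold evenExt colatitude
    rw [if_neg (by linarith)]
    exact hP.cap _ (by linarith [Real.arccos_le_pi ((p : R3) 2)]) h3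

theorem IsProfile.integral_evenExt_lt {P : ℝ → ℝ} (hP : IsProfile P) :
    ∫ p, evenExt P p ∂surface < -(1 / 4) * surface.real univ := by
  set s : Set S2 := {p : S2 | |(p : R3) 2| ≤ 1 / 50} with hs
  have hm : MeasurableSet s :=
    (isClosed_le (by fun_prop) continuous_const).measurableSet
  have hi : Integrable (evenExt P) surface :=
    Integrable.of_bound hP.measurable_evenExt.aestronglyMeasurable (1 / 3)
      (Eventually.of_forall hP.abs_evenExt_le)
  have h1 : ∫ p in s, evenExt P p ∂surface ≤ 0 :=
    integral_nonpos fun p => hP.evenExt_nonpos p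
  have h2 : ∫ p in sᶜ, evenExt P p ∂surface = ∫ p in sᶜ, (-1 / 3 : ℝ) ∂surface :=
    setIntegral_congr_fun hm.compl fun p hp => hP.evenExt_eq (not_le.1 hp)
  rw [← integral_add_compl hm hi, h2, setIntegral_const, measureReal_compl hm, smul_eq_mul]
  have h3 := surface_band_le
  rw [← hs] at h3
  rw [surface_real_univ]
  linarith [Real.pi_gt_three]

theorem norm_sq_one : ‖monomialClass 0‖ ^ 2 = surface.real univ := by
  rw [norm_sq_eq_integral]
  have : ∫ p, ‖monomialClass 0 p‖ ^ 2 ∂surface = ∫ p : S2, (1 : ℝ) ∂surface := by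
    refine integral_congr_ae ?_
    filter_upwards [sphereClass_ae (smoothOnSphere_monomialFun 0).continuous] with p h
    rw [monomialClass, h]
    simp [monomialFun]
  rw [this]
  simp

theorem IsProfile.exists_isLeast_evenExt {P : ℝ → ℝ} (hP : IsProfile P) :
    ∃ μ, IsLeast (sphereEigenvalues (evenExt P)) μ ∧ μ < -1 / 4 := by
  obtain ⟨μ, hμ, hlow⟩ :=
    exists_isLeast_sphereEigenvalues hP.measurable_evenExt hP.abs_evenExt_le
  refine ⟨μ, hμ, ?_⟩
  have h1 := hlow _ _ hasSphereLaplacian_one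
  have h2 : ∫ p, evenExt P p * ‖monomialClass 0 p‖ ^ 2 ∂surface = ∫ p, evenExt P p ∂surface := by
    refine integral_congr_ae ?_
    filter_upwards [sphereClass_ae (smoothOnSphere_monomialFun 0).continuous] with p h
    rw [monomialClass, h]
    simp [monomialFun]
  rw [h2, inner_zero_right, norm_sq_one, Complex.zero_re, zero_add] at h1
  have h3 := h1.trans_lt hP.integral_evenExt_lt
  have h4 : 0 < surface.real univ := by rw [surface_real_univ]; positivity
  have := lt_of_mul_lt_mul_right h3 h4.le
  linarith

theorem IsProfile.exists_isLeast_oddExt {P : ℝ → ℝ} (hP : IsProfile P) :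
    ∃ μ, IsLeast (sphereEigenvalues (oddExt P)) μ ∧ -1 / 18 ≤ μ ∧ -1 / 4 < μ := by
  obtain ⟨μ, hμ, -⟩ := exists_isLeast_sphereEigenvalues hP.measurable_oddExt hP.abs_oddExt_le
  obtain ⟨u, hu, w, huw, hae⟩ := hμ.1
  have h1 := huw.ge_of_odd hP.measurable_oddExt hP.abs_oddExt_le hP.oddExt_sphereReflect
  rw [IsSphereEigenfunction.rayleigh hP.measurable_oddExt hP.abs_oddExt_le hae] at h1
  have h2 := le_of_mul_le_mul_right h1 (by have := norm_pos_iff.2 hu; positivity)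
  exact ⟨μ, hμ, by linarith, by linarith⟩

end SphereEigenvalues

end HomPot

namespace HomPot

section EuclideanResolvent

open Filter Topology FourierTransform
open scoped InnerProductSpace

/-- The Hilbert space `L²(ℝ³)`. -/
abbrev L2R3 : Type := Lp ℂ 2 (volume : Measure R3)

/-- `-Δ u = w` in the sense of distributions. -/
def HasLaplacian (u w : L2R3) : Prop :=
  -(Laplacian.laplacian (u : 𝓢'(R3, ℂ))) = (w : 𝓢'(R3, ℂ))

/-- The distance of the spectrum of `-Δ + (2π)²` to the origin. -/
noncomputable def specGap : ℝ := (2 * Real.pi) ^ 2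

theorem one_lt_specGap : 1 < specGap := by
  unfold specGap
  nlinarith [Real.pi_gt_three]

theorem specGap_pos : 0 < specGap := one_pos.trans one_lt_specGap

/-- The Fourier symbol of `(-Δ + (2π)²)⁻¹`. -/
noncomputable def resSymbol (ξ : R3) : ℝ := specGap⁻¹ * (1 + ‖ξ‖ ^ 2) ^ (-1 : ℝ)

theorem resSymbol_eq (ξ : R3) : resSymbol ξ = specGap⁻¹ * (1 + ‖ξ‖ ^ 2)⁻¹ := by
  rw [resSymbol, Real.rpow_neg_one]

theorem resSymbol_nonneg (ξ : R3) : 0 ≤ resSymbol ξ := by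
  rw [resSymbol_eq]
  have := specGap_pos
  positivity

theorem resSymbol_le (ξ : R3) : resSymbol ξ ≤ specGap⁻¹ := by
  rw [resSymbol_eq]
  refine mul_le_of_le_one_right (inv_nonneg.2 specGap_pos.le) (inv_le_one_of_one_le₀ ?_)
  linarith [sq_nonneg ‖ξ‖]

theorem abs_resSymbol_le (ξ : R3) : |resSymbol ξ| ≤ specGap⁻¹ := by
  rw [abs_of_nonneg (resSymbol_nonneg ξ)]
  exact resSymbol_le ξ

theorem hasTemperateGrowth_resSymbol : Function.HasTemperateGrowth (fun ξ => (resSymbol ξ : ℂ)) := by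
  unfold resSymbol
  fun_prop

theorem continuous_resSymbol : Continuous resSymbol := by
  have h : resSymbol = fun ξ => specGap⁻¹ * (1 + ‖ξ‖ ^ 2)⁻¹ := funext resSymbol_eq
  rw [h]
  refine continuous_const.mul (Continuous.inv₀ (by fun_prop) fun ξ => ?_)
  positivity

theorem hasTemperateGrowth_one_add :
    Function.HasTemperateGrowth (fun ξ : R3 => ((1 + ‖ξ‖ ^ 2 : ℝ) : ℂ)) := by
  fun_prop

/-- The operator `(-Δ + (2π)²)⁻¹` on `L²(ℝ³)`. -/
noncomputable def freeRes : L2R3 →L[ℂ] L2R3 :=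
  ((Lp.fourierTransformₗᵢ R3 ℂ).symm.toContinuousLinearEquiv : L2R3 →L[ℂ] L2R3) ∘L
    (mulOp volume continuous_resSymbol.measurable abs_resSymbol_le) ∘L
      ((Lp.fourierTransformₗᵢ R3 ℂ).toContinuousLinearEquiv : L2R3 →L[ℂ] L2R3)

theorem freeRes_apply (z : L2R3) : freeRes z =
    𝓕⁻ (mulOp volume continuous_resSymbol.measurable abs_resSymbol_le (𝓕 z)) := rfl

theorem fourier_freeRes (z : L2R3) : 𝓕 (freeRes z) =
    mulOp volume continuous_resSymbol.measurable abs_resSymbol_le (𝓕 z) := by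
  rw [freeRes_apply, fourier_fourierInv_eq]

theorem freeRes_symmetric : (freeRes : L2R3 →ₗ[ℂ] L2R3).IsSymmetric := by
  intro x y
  change ⟪freeRes x, y⟫_ℂ = ⟪x, freeRes y⟫_ℂ
  rw [← Lp.inner_fourier_eq, fourier_freeRes, ← Lp.inner_fourier_eq x, fourier_freeRes]
  exact mulOp_symmetric continuous_resSymbol.measurable abs_resSymbol_le _ _

theorem freeRes_bound (z : L2R3) :
    specGap * ‖freeRes z‖ ^ 2 ≤ (⟪freeRes z, z⟫_ℂ).re := by
  rw [← Lp.inner_fourier_eq, ← Lp.norm_fourier_eq, fourier_freeRes, ← inner_conj_symm,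
    Complex.conj_re, re_inner_mulOp, norm_sq_eq_integral, ← integral_const_mul]
  have hi := integrable_mul_norm_sq continuous_resSymbol.measurable abs_resSymbol_le (𝓕 z)
  refine integral_mono_ae (Integrable.const_mul ?_ _) hi ?_
  · exact (Lp.memLp _).integrable_norm_pow (p := 2) (by norm_num)
  · filter_upwards [mulOp_ae continuous_resSymbol.measurable abs_resSymbol_le (𝓕 z)] with ξ h
    rw [h, norm_mul, Complex.norm_real, mul_pow, Real.norm_of_nonneg (resSymbol_nonneg ξ),
      ← mul_assoc]
    refine mul_le_mul_of_nonneg_right ?_ (sq_nonneg _)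
    have h1 : specGap * resSymbol ξ ≤ 1 := by
      calc specGap * resSymbol ξ ≤ specGap * specGap⁻¹ :=
            mul_le_mul_of_nonneg_left (resSymbol_le ξ) specGap_pos.le
        _ = 1 := mul_inv_cancel₀ specGap_pos.ne'
    nlinarith [resSymbol_nonneg ξ]

theorem freeRes_toTemperedDistribution (z : L2R3) :
    (freeRes z : 𝓢'(R3, ℂ)) = TemperedDistribution.fourierMultiplierCLM ℂ
      (fun ξ => (resSymbol ξ : ℂ)) (z : 𝓢'(R3, ℂ)) := by
  rw [freeRes_apply, TemperedDistribution.fourierMultiplierCLM_apply,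
    Lp.fourier_toTemperedDistribution_eq, ← Lp.fourierInv_toTemperedDistribution_eq]
  congr 1
  ext φ
  rw [TemperedDistribution.smulLeftCLM_apply_apply, Lp.toTemperedDistribution_apply,
    Lp.toTemperedDistribution_apply]
  refine integral_congr_ae ?_
  filter_upwards [mulOp_ae continuous_resSymbol.measurable abs_resSymbol_le (𝓕 z)] with ξ h
  rw [h, SchwartzMap.smulLeftCLM_apply_apply hasTemperateGrowth_resSymbol]
  simp only [smul_eq_mul]
  ring

theorem neg_laplacian_add (f : 𝓢'(R3, ℂ)) :
    -(Laplacian.laplacian f) + (specGap : ℂ) • f = (specGap : ℂ) •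
      TemperedDistribution.fourierMultiplierCLM ℂ (fun ξ => ((1 + ‖ξ‖ ^ 2 : ℝ) : ℂ)) f := by
  have h1 : (fun ξ : R3 => ((1 + ‖ξ‖ ^ 2 : ℝ) : ℂ)) =
      (fun _ => (1 : ℂ)) + fun ξ => ((‖ξ‖ ^ 2 : ℝ) : ℂ) := by
    funext ξ
    simp
  rw [h1, TemperedDistribution.fourierMultiplierCLM_apply,
    TemperedDistribution.smulLeftCLM_add (by fun_prop) (by fun_prop), add_apply,
    TemperedDistribution.smulLeftCLM_const, one_smul, FourierTransform.fourierInv_add,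
    fourierInv_fourier_eq, ← TemperedDistribution.fourierMultiplierCLM_apply,
    TemperedDistribution.laplacian_eq_fourierMultiplierCLM, smul_add, add_comm]
  congr 1
  rw [neg_smul, neg_neg]
  rfl

theorem fourierMultiplier_cancel (f : 𝓢'(R3, ℂ)) :
    (specGap : ℂ) • TemperedDistribution.fourierMultiplierCLM ℂ
        (fun ξ => ((1 + ‖ξ‖ ^ 2 : ℝ) : ℂ))
      (TemperedDistribution.fourierMultiplierCLM ℂ (fun ξ => (resSymbol ξ : ℂ)) f) = f := by
  rw [TemperedDistribution.fourierMultiplierCLM_fourierMultiplierCLM_apply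
    hasTemperateGrowth_resSymbol hasTemperateGrowth_one_add, mul_comm]
  have h : ((fun ξ : R3 => ((1 + ‖ξ‖ ^ 2 : ℝ) : ℂ)) * fun ξ => (resSymbol ξ : ℂ)) =
      fun _ => ((specGap⁻¹ : ℝ) : ℂ) := by
    funext ξ
    rw [Pi.mul_apply, ← Complex.ofReal_mul, resSymbol_eq]
    congr 1
    have : (1 + ‖ξ‖ ^ 2) ≠ 0 := by positivity
    field_simp
  have h2 : (specGap : ℂ) * ((specGap⁻¹ : ℝ) : ℂ) = 1 := by
    rw [← Complex.ofReal_mul, mul_inv_cancel₀ specGap_pos.ne', Complex.ofReal_one]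
  rw [h, TemperedDistribution.fourierMultiplierCLM_const, smul_apply, smul_smul, h2, one_smul]
  rfl

theorem fourierMultiplier_cancel' (f : 𝓢'(R3, ℂ)) :
    TemperedDistribution.fourierMultiplierCLM ℂ (fun ξ => (resSymbol ξ : ℂ))
      ((specGap : ℂ) • TemperedDistribution.fourierMultiplierCLM ℂ
        (fun ξ => ((1 + ‖ξ‖ ^ 2 : ℝ) : ℂ)) f) = f := by
  conv_rhs => rw [← fourierMultiplier_cancel f]
  rw [map_smul, TemperedDistribution.fourierMultiplierCLM_fourierMultiplierCLM_apply
    hasTemperateGrowth_one_add hasTemperateGrowth_resSymbol,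
    TemperedDistribution.fourierMultiplierCLM_fourierMultiplierCLM_apply
    hasTemperateGrowth_resSymbol hasTemperateGrowth_one_add, mul_comm]

theorem toTemperedDistribution_injective {u v : L2R3}
    (h : (u : 𝓢'(R3, ℂ)) = (v : 𝓢'(R3, ℂ))) : u = v := by
  have h1 := LinearMap.ker_eq_bot.1
    (Lp.ker_toTemperedDistributionCLM_eq_bot (F := ℂ) (μ := (volume : Measure R3)) (p := 2))
  exact h1 h

theorem toTemperedDistribution_add_smul (w u : L2R3) (c : ℂ) :
    ((w + c • u : L2R3) : 𝓢'(R3, ℂ)) = (w : 𝓢'(R3, ℂ)) + c • (u : 𝓢'(R3, ℂ)) := by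
  simp only [← Lp.toTemperedDistributionCLM_apply, map_add, map_smul]

theorem hasLaplacian_iff {u w : L2R3} :
    HasLaplacian u w ↔ u = freeRes (w + (specGap : ℂ) • u) := by
  constructor
  · intro h
    apply toTemperedDistribution_injective
    rw [freeRes_toTemperedDistribution, toTemperedDistribution_add_smul, ← h, neg_laplacian_add,
      fourierMultiplier_cancel']
  · intro h
    have h1 := congrArg (fun z : L2R3 => (z : 𝓢'(R3, ℂ))) h
    simp only [freeRes_toTemperedDistribution] at h1
    have h2 := neg_laplacian_add (u : 𝓢'(R3, ℂ))
    conv_rhs at h2 => rw [h1]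
    rw [fourierMultiplier_cancel, toTemperedDistribution_add_smul] at h2
    exact add_right_cancel h2

theorem HasLaplacian.memSobolev {u w : L2R3} (h : HasLaplacian u w) :
    TemperedDistribution.MemSobolev 2 2 (u : 𝓢'(R3, ℂ)) := by
  refine ⟨(specGap⁻¹ : ℂ) • (w + (specGap : ℂ) • u), ?_⟩
  have h1 : ((specGap⁻¹ : ℂ) • (w + (specGap : ℂ) • u) : L2R3) =
      (0 : L2R3) + (specGap⁻¹ : ℂ) • (w + (specGap : ℂ) • u) := by rw [zero_add]
  have h3 : (specGap : ℂ) ≠ 0 := by exact_mod_cast specGap_pos.ne'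
  have h2 : ((0 : L2R3) : 𝓢'(R3, ℂ)) = 0 := by
    rw [← Lp.toTemperedDistributionCLM_apply, map_zero]
  rw [h1, toTemperedDistribution_add_smul, h2, zero_add, toTemperedDistribution_add_smul, ← h,
    neg_laplacian_add, smul_smul, inv_mul_cancel₀ h3, one_smul, TemperedDistribution.besselPotential]
  congr 2
  funext ξ
  norm_num

end EuclideanResolvent

section SchwartzApproximation

open Filter Topology FourierTransform
open scoped InnerProductSpace

theorem fourier_neg_laplacian_add (φ : 𝓢(R3, ℂ)) (ξ : R3) :
    𝓕 (-(Laplacian.laplacian φ) + (specGap : ℂ) • φ) ξ =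
      ((specGap * (1 + ‖ξ‖ ^ 2) : ℝ) : ℂ) * 𝓕 φ ξ := by
  have h1 : 𝓕 (Laplacian.laplacian φ) ξ = -((specGap * ‖ξ‖ ^ 2 : ℝ) : ℂ) * 𝓕 φ ξ := by
    have hg : Function.HasTemperateGrowth (fun ξ : R3 => ‖ξ‖ ^ 2) := by fun_prop
    rw [SchwartzMap.laplacian_eq_fourierMultiplierCLM, FourierTransform.fourier_smul,
      SchwartzMap.fourierMultiplierCLM_apply, fourier_fourierInv_eq, smul_apply]
    have h2 := SchwartzMap.smulLeftCLM_apply_apply hg (𝓕 φ) ξ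
    rw [h2, specGap]
    simp only [Complex.real_smul]
    push_cast
    ring
  rw [FourierTransform.fourier_add, FourierTransform.fourier_neg, FourierTransform.fourier_smul,
    add_apply, neg_apply, smul_apply, h1]
  push_cast
  simp only [smul_eq_mul]
  ring

theorem hasLaplacian_toLp (φ : 𝓢(R3, ℂ)) :
    HasLaplacian (φ.toLp 2 volume) ((-(Laplacian.laplacian φ)).toLp 2 volume) := by
  unfold HasLaplacian
  rw [Lp.toTemperedDistribution_toLp_eq, Lp.toTemperedDistribution_toLp_eq,
    TemperedDistribution.laplacian_toTemperedDistributionCLM_eq, map_neg]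

theorem toLp_neg_laplacian_add (φ : 𝓢(R3, ℂ)) :
    ((-(Laplacian.laplacian φ) + (specGap : ℂ) • φ).toLp 2 volume : L2R3) =
      (-(Laplacian.laplacian φ)).toLp 2 volume + (specGap : ℂ) • φ.toLp 2 volume := by
  have h := map_add (SchwartzMap.toLpCLM ℂ ℂ 2 (volume : Measure R3))
    (-(Laplacian.laplacian φ)) ((specGap : ℂ) • φ)
  rw [map_smul] at h
  exact h

theorem exists_neg_laplacian_add_eq (z : 𝓢(R3, ℂ)) :
    ∃ φ : 𝓢(R3, ℂ), -(Laplacian.laplacian φ) + (specGap : ℂ) • φ = z := by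
  refine ⟨𝓕⁻ (SchwartzMap.smulLeftCLM ℂ (fun ξ => (resSymbol ξ : ℂ)) (𝓕 z)), ?_⟩
  refine (FourierTransform.fourierCLE ℂ 𝓢(R3, ℂ)).injective ?_
  ext ξ
  simp only [FourierTransform.fourierCLE_apply]
  rw [fourier_neg_laplacian_add, fourier_fourierInv_eq,
    SchwartzMap.smulLeftCLM_apply_apply hasTemperateGrowth_resSymbol, smul_eq_mul, ← mul_assoc,
    ← Complex.ofReal_mul, resSymbol_eq]
  have h1 : (1 + ‖ξ‖ ^ 2) ≠ 0 := by positivity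
  have h2 : specGap ≠ 0 := specGap_pos.ne'
  have h3 : specGap * (1 + ‖ξ‖ ^ 2) * (specGap⁻¹ * (1 + ‖ξ‖ ^ 2)⁻¹) = 1 := by field_simp
  rw [h3, Complex.ofReal_one, one_mul]

/-- Schwartz functions are dense in the domain of the Laplacian. -/
theorem HasLaplacian.exists_approx {u w : L2R3} (h : HasLaplacian u w) :
    ∃ φ : ℕ → 𝓢(R3, ℂ), Tendsto (fun n => (φ n).toLp 2 volume) atTop (𝓝 u) ∧
      Tendsto (fun n => (-(Laplacian.laplacian (φ n))).toLp 2 volume) atTop (𝓝 w) := by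
  have hd : DenseRange (SchwartzMap.toLpCLM ℝ ℂ 2 (volume : Measure R3)) :=
    SchwartzMap.denseRange_toLpCLM ENNReal.ofNat_ne_top
  obtain ⟨x, hx, hlim⟩ := mem_closure_iff_seq_limit.1 (hd (w + (specGap : ℂ) • u))
  choose z hz using hx
  choose φ hφ using fun n => exists_neg_laplacian_add_eq (z n)
  have h1 : ∀ n, (φ n).toLp 2 volume = freeRes (x n) := by
    intro n
    rw [← hz, ← hφ n, hasLaplacian_iff.1 (hasLaplacian_toLp (φ n)), ← toLp_neg_laplacian_add]
    rfl
  have h2 : ∀ n, (-(Laplacian.laplacian (φ n))).toLp 2 volume = x n - (specGap : ℂ) • (φ n).toLp 2 volume := by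
    intro n
    rw [eq_sub_iff_add_eq, ← toLp_neg_laplacian_add, hφ n, ← hz n]
    rfl
  have h3 : Tendsto (fun n => (φ n).toLp 2 volume) atTop (𝓝 u) := by
    simp only [h1]
    have := (freeRes.continuous.tendsto _).comp hlim
    rwa [← hasLaplacian_iff.1 h] at this
  refine ⟨φ, h3, ?_⟩
  simp only [h2]
  have := hlim.sub (h3.const_smul (specGap : ℂ))
  rwa [add_sub_cancel_right] at this

theorem memLp_resSymbol : MemLp (fun ξ : R3 => (resSymbol ξ : ℂ)) 2 := by
  refine MemLp.ofReal ?_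
  refine (memLp_two_iff_integrable_sq continuous_resSymbol.aestronglyMeasurable).2 ?_
  have h1 : Integrable (fun ξ : R3 => (1 + ‖ξ‖ ^ 2) ^ (-(4 : ℝ) / 2)) :=
    integrable_rpow_neg_one_add_norm_sq (by simp; norm_num)
  refine (h1.const_mul (specGap⁻¹ ^ 2)).congr (Eventually.of_forall fun ξ => ?_)
  have h2 : (0 : ℝ) ≤ 1 + ‖ξ‖ ^ 2 := by positivity
  simp only [resSymbol, mul_pow]
  rw [← Real.rpow_mul_natCast h2]
  norm_num

/-- Point evaluations are bounded on the domain of the Laplacian. -/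
theorem exists_evaluation : ∃ (G : R3 → L2R3) (C : ℝ), 0 ≤ C ∧ (∀ x, ‖G x‖ ≤ C) ∧
    ∀ (φ : 𝓢(R3, ℂ)) (x : R3),
      φ x = ⟪G x, (-(Laplacian.laplacian φ) + (specGap : ℂ) • φ).toLp 2 volume⟫_ℂ := by
  have hk : ∀ x : R3, MemLp (fun ξ : R3 =>
      (Real.fourierChar (-inner ℝ ξ x) : ℂ) * (resSymbol ξ : ℂ)) 2 := by
    intro x
    refine memLp_resSymbol.of_le ?_ (Eventually.of_forall fun ξ => ?_)
    · refine Continuous.aestronglyMeasurable ?_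
      have := continuous_resSymbol
      fun_prop
    · rw [norm_mul, Circle.norm_coe, one_mul]
  refine ⟨fun x => 𝓕⁻ ((hk x).toLp _), ‖memLp_resSymbol.toLp _‖, norm_nonneg _, fun x => ?_,
    fun φ x => ?_⟩
  · have h1 : ‖(𝓕⁻ ((hk x).toLp _) : L2R3)‖ = ‖(hk x).toLp _‖ :=
      (Lp.fourierTransformₗᵢ R3 ℂ).symm.norm_map _
    rw [h1]
    refine Lp.norm_le_norm_of_ae_le ?_
    filter_upwards [(hk x).coeFn_toLp, memLp_resSymbol.coeFn_toLp] with ξ h2 h3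
    rw [h2, h3, norm_mul, Circle.norm_coe, one_mul]
  · rw [← Lp.inner_fourier_eq, fourier_fourierInv_eq, SchwartzMap.toLp_fourier_eq, L2.inner_def]
    have h1 : φ x = (𝓕⁻ (𝓕 φ)) x := by rw [fourierInv_fourier_eq]
    rw [h1, SchwartzMap.fourierInv_coe, Real.fourierInv_eq]
    refine integral_congr_ae ?_
    filter_upwards [(hk x).coeFn_toLp, SchwartzMap.coeFn_toLp
      (𝓕 (-(Laplacian.laplacian φ) + (specGap : ℂ) • φ)) 2 (volume : Measure R3)] with ξ h2 h3
    rw [h2, h3, fourier_neg_laplacian_add, RCLike.inner_apply, map_mul, Complex.conj_ofReal]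
    have h4 : (starRingEnd ℂ) (Real.fourierChar (-inner ℝ ξ x) : ℂ) =
        (Real.fourierChar (inner ℝ ξ x) : ℂ) := by
      rw [AddChar.map_neg_eq_inv, Circle.coe_inv_eq_conj, Complex.conj_conj]
    have h5 : specGap * (1 + ‖ξ‖ ^ 2) * resSymbol ξ = 1 := by
      rw [resSymbol_eq]
      have h1 : (1 + ‖ξ‖ ^ 2) ≠ 0 := by positivity
      have h2 : specGap ≠ 0 := specGap_pos.ne'
      field_simp
    rw [h4, Circle.smul_def, smul_eq_mul]
    calc (Real.fourierChar (inner ℝ ξ x) : ℂ) * 𝓕 φ ξ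
        = ((specGap * (1 + ‖ξ‖ ^ 2) * resSymbol ξ : ℝ) : ℂ) *
          ((Real.fourierChar (inner ℝ ξ x) : ℂ) * 𝓕 φ ξ) := by rw [h5]; simp
      _ = _ := by push_cast; ring

end SchwartzApproximation

end HomPot

namespace HomPot

section HilbertSchmidt

open Filter Topology
open scoped InnerProductSpace

variable {H : Type*} [NormedAddCommGroup H] [InnerProductSpace ℂ H] [CompleteSpace H] {ι : Type*}

/-- Hilbert–Schmidt operators are compact. -/
theorem isCompactOperator_of_sum_norm_sq_le (b : HilbertBasis ι ℂ H) (S : H →L[ℂ] H) {M : ℝ}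
    (hM : ∀ s : Finset ι, ∑ i ∈ s, ‖S (b i)‖ ^ 2 ≤ M) : IsCompactOperator S := by
  have hs : Summable fun i => ‖S (b i)‖ ^ 2 :=
    summable_of_sum_le (fun i => sq_nonneg _) hM
  let f : ι → H →L[ℂ] H := fun i => InnerProductSpace.rankOne ℂ (S (b i)) (b i)
  have hfx : ∀ i x, f i x = ⟪b i, x⟫_ℂ • S (b i) := fun i x => rfl
  have hf : Summable f := by
    classical
    rw [summable_iff_vanishing_norm]
    intro ε hε
    obtain ⟨s, hs'⟩ := summable_iff_vanishing_norm.1 hs ((ε / 2) ^ 2) (by positivity)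
    refine ⟨s, fun t ht => lt_of_le_of_lt ?_ (half_lt_self hε)⟩
    refine ContinuousLinearMap.opNorm_le_bound _ (half_pos hε).le fun x => ?_
    have h1 : ∑ i ∈ t, ‖S (b i)‖ ^ 2 ≤ (ε / 2) ^ 2 :=
      ((Real.le_norm_self _).trans_lt (hs' t ht)).le
    have h2 := b.orthonormal.sum_inner_products_le x (s := t)
    have h3 : ‖(∑ i ∈ t, f i) x‖ ≤ ∑ i ∈ t, ‖⟪b i, x⟫_ℂ‖ * ‖S (b i)‖ := by
      rw [sum_apply]
      refine (norm_sum_le _ _).trans (Finset.sum_le_sum fun i _ => ?_)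
      rw [hfx, norm_smul]
    refine h3.trans (abs_le_of_sq_le_sq' ?_ (by positivity)).2
    calc (∑ i ∈ t, ‖⟪b i, x⟫_ℂ‖ * ‖S (b i)‖) ^ 2
        ≤ (∑ i ∈ t, ‖⟪b i, x⟫_ℂ‖ ^ 2) * ∑ i ∈ t, ‖S (b i)‖ ^ 2 :=
          Finset.sum_mul_sq_le_sq_mul_sq _ _ _
      _ ≤ ‖x‖ ^ 2 * (ε / 2) ^ 2 :=
          mul_le_mul h2 h1 (Finset.sum_nonneg fun _ _ => sq_nonneg _) (sq_nonneg _)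
      _ = (ε / 2 * ‖x‖) ^ 2 := by ring
  have hS : S = ∑' i, f i := by
    ext x
    have h1 : HasSum (fun i => f i x) ((∑' i, f i) x) :=
      hf.hasSum.mapL (ContinuousLinearMap.apply ℂ H x)
    have h2 : HasSum (fun i => S (b.repr x i • b i)) (S x) := (b.hasSum_repr x).mapL S
    refine h2.unique ?_
    convert h1 using 1
    funext i
    rw [map_smul, hfx, HilbertBasis.repr_apply_apply]
  rw [hS]
  exact isCompactOperator_of_tendsto (l := atTop) hf.hasSum
    (Eventually.of_forall fun s => isCompactOperator_sum s f fun i _ =>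
      isCompactOperator_rankOne _ _)

end HilbertSchmidt

section ContinuousRepresentative

open Filter Topology
open scoped InnerProductSpace

theorem ae_eq_of_tendsto_toLp {φ : ℕ → 𝓢(R3, ℂ)} {u : L2R3} {g : R3 → ℂ}
    (h : Tendsto (fun n => (φ n).toLp 2 volume) atTop (𝓝 u))
    (hg : ∀ x, Tendsto (fun n => φ n x) atTop (𝓝 (g x))) : u =ᵐ[volume] g := by
  obtain ⟨ns, hns, hae⟩ := (tendstoInMeasure_of_tendsto_Lp h).exists_seq_tendsto_ae
  have h1 : ∀ᵐ x, ∀ n, (φ n).toLp 2 volume x = φ n x :=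
    ae_all_iff.2 fun n => SchwartzMap.coeFn_toLp (φ n) 2 volume
  filter_upwards [hae, h1] with x h2 h3
  simp only [h3] at h2
  exact tendsto_nhds_unique h2 ((hg x).comp hns.tendsto_atTop)

theorem exists_kernel : ∃ (G : R3 → L2R3) (C : ℝ), 0 ≤ C ∧ (∀ x, ‖G x‖ ≤ C) ∧
    (∀ z : L2R3, freeRes z =ᵐ[volume] fun x => ⟪G x, z⟫_ℂ) ∧
    ∀ u w, HasLaplacian u w → ∃ (φ : ℕ → 𝓢(R3, ℂ)) (g : R3 → ℂ),
      Tendsto (fun n => (φ n).toLp 2 volume) atTop (𝓝 u) ∧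
      Tendsto (fun n => (-(Laplacian.laplacian (φ n))).toLp 2 volume) atTop (𝓝 w) ∧
      TendstoUniformly (fun n x => φ n x) g atTop ∧ Continuous g ∧ u =ᵐ[volume] g ∧
      ∀ x, g x = ⟪G x, w + (specGap : ℂ) • u⟫_ℂ := by
  obtain ⟨G, C, hC, hG, hev⟩ := exists_evaluation
  have key : ∀ u w, HasLaplacian u w → ∃ (φ : ℕ → 𝓢(R3, ℂ)) (g : R3 → ℂ),
      Tendsto (fun n => (φ n).toLp 2 volume) atTop (𝓝 u) ∧
      Tendsto (fun n => (-(Laplacian.laplacian (φ n))).toLp 2 volume) atTop (𝓝 w) ∧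
      TendstoUniformly (fun n x => φ n x) g atTop ∧ Continuous g ∧ u =ᵐ[volume] g ∧
      ∀ x, g x = ⟪G x, w + (specGap : ℂ) • u⟫_ℂ := by
    intro u w h
    obtain ⟨φ, hu, hw⟩ := h.exists_approx
    have hz : Tendsto (fun n => (-(Laplacian.laplacian (φ n)) +
        (specGap : ℂ) • φ n).toLp 2 volume) atTop (𝓝 (w + (specGap : ℂ) • u)) := by
      simp only [toLp_neg_laplacian_add]
      exact hw.add (hu.const_smul _)
    have hunif : TendstoUniformly (fun n x => φ n x)
        (fun x => ⟪G x, w + (specGap : ℂ) • u⟫_ℂ) atTop := by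
      rw [Metric.tendstoUniformly_iff]
      intro ε hε
      have h1 := (tendsto_iff_norm_sub_tendsto_zero.1 hz).const_mul C
      rw [mul_zero] at h1
      filter_upwards [h1.eventually (gt_mem_nhds hε)] with n hn x
      rw [dist_comm, dist_eq_norm, hev (φ n) x, ← inner_sub_right]
      refine lt_of_le_of_lt ((norm_inner_le_norm _ _).trans ?_) hn
      exact mul_le_mul_of_nonneg_right (hG x) (norm_nonneg _)
    exact ⟨φ, _, hu, hw, hunif, hunif.continuous (Eventually.of_forall fun n => (φ n).continuous).frequently,
      ae_eq_of_tendsto_toLp hu fun x => hunif.tendsto_at x, fun x => rfl⟩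
  refine ⟨G, C, hC, hG, fun z => ?_, key⟩
  have h1 : HasLaplacian (freeRes z) (z - (specGap : ℂ) • freeRes z) := by
    rw [hasLaplacian_iff, sub_add_cancel]
  obtain ⟨φ, g, -, -, -, -, hae, hg⟩ := key _ _ h1
  filter_upwards [hae] with x hx
  rw [hx, hg, sub_add_cancel]

theorem isCompactOperator_mulOp_freeRes {V : R3 → ℝ} {C : ℝ} (hV : Measurable V)
    (hC : ∀ x, |V x| ≤ C) (hV2 : Integrable fun x => V x ^ 2) :
    IsCompactOperator (mulOp volume hV hC ∘L freeRes) := by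
  obtain ⟨G, D, hD, hG, hk, -⟩ := exists_kernel
  obtain ⟨w, b, -⟩ := exists_hilbertBasis ℂ L2R3
  refine isCompactOperator_of_sum_norm_sq_le b _ (M := ∫ x, V x ^ 2 * D ^ 2) fun s => ?_
  have h1 : ∀ i, ‖(mulOp volume hV hC ∘L freeRes) (b i)‖ ^ 2 =
      ∫ x, ‖(mulOp volume hV hC ∘L freeRes) (b i) x‖ ^ 2 := fun i => norm_sq_eq_integral _
  simp only [h1]
  rw [← integral_finsetSum s fun i _ => (Lp.memLp _).integrable_norm_pow (p := 2) (by norm_num)]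
  refine integral_mono_ae (integrable_finsetSum s fun i _ =>
    (Lp.memLp _).integrable_norm_pow (p := 2) (by norm_num)) (hV2.mul_const _) ?_
  have h2 : ∀ᵐ x, ∀ i ∈ s, freeRes (b i) x = ⟪G x, b i⟫_ℂ :=
    (Finset.eventually_all s).2 fun i _ => hk (b i)
  have h3 : ∀ᵐ x, ∀ i ∈ s, mulOp volume hV hC (freeRes (b i)) x = (V x : ℂ) * freeRes (b i) x :=
    (Finset.eventually_all s).2 fun i _ => mulOp_ae hV hC _
  filter_upwards [h2, h3] with x h4 h5
  calc ∑ i ∈ s, ‖(mulOp volume hV hC ∘L freeRes) (b i) x‖ ^ 2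
      = V x ^ 2 * ∑ i ∈ s, ‖⟪b i, G x⟫_ℂ‖ ^ 2 := by
        rw [Finset.mul_sum]
        refine Finset.sum_congr rfl fun i hi => ?_
        rw [ContinuousLinearMap.comp_apply, h5 i hi, h4 i hi, norm_mul, mul_pow, Complex.norm_real,
          Real.norm_eq_abs, sq_abs, norm_inner_symm]
    _ ≤ V x ^ 2 * D ^ 2 := by
        refine mul_le_mul_of_nonneg_left ?_ (sq_nonneg _)
        refine (b.orthonormal.sum_inner_products_le (G x)).trans ?_
        exact pow_le_pow_left₀ (norm_nonneg _) (hG x) 2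

end ContinuousRepresentative

section Potential

open Filter Topology

variable {Q : S2 → ℝ}

theorem potential_of_lt {x : R3} (hx : ‖x‖ < 1) : potential Q x = 1 := by
  unfold potential
  split_ifs with h1 h2
  · rfl
  · exact absurd h2 (not_le.2 hx)
  · rfl

theorem potential_smul {r : ℝ} (hr : 1 ≤ r) (p : S2) :
    potential Q (r • (p : R3)) = (r ^ 2)⁻¹ * Q p := by
  have hr0 : 0 < r := one_pos.trans_le hr
  have hn : ‖r • (p : R3)‖ = r := by
    rw [norm_smul, norm_coe_S2, mul_one, Real.norm_of_nonneg hr0.le]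
  have h0 : r • (p : R3) ≠ 0 := smul_coe_S2_ne_zero hr0 p
  unfold potential
  rw [dif_neg h0, if_pos (by rwa [hn]), hn, radialProj_smul hr0]

theorem abs_potential_le_japanese (hb : ∀ p, |Q p| ≤ 1 / 3) (x : R3) :
    |potential Q x| ≤ 2 * (1 + ‖x‖ ^ 2)⁻¹ := by
  have h2 : 0 < 1 + ‖x‖ ^ 2 := by positivity
  rw [← div_eq_mul_inv, le_div_iff₀ h2]
  rcases lt_or_ge ‖x‖ 1 with h | h
  · rw [potential_of_lt h]
    have := norm_nonneg x
    rw [abs_one]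
    nlinarith
  · have hx : x ≠ 0 := by
      rintro rfl
      simp at h
      linarith
    unfold potential
    rw [dif_neg hx, if_pos h, abs_mul, abs_of_nonneg (by positivity)]
    have h3 : 0 < ‖x‖ ^ 2 := by positivity
    have h4 := hb (radialProj x hx)
    have h5 : (‖x‖ ^ 2)⁻¹ * (1 + ‖x‖ ^ 2) ≤ 2 := by
      rw [inv_mul_le_iff₀ h3]
      nlinarith
    calc (‖x‖ ^ 2)⁻¹ * |Q (radialProj x hx)| * (1 + ‖x‖ ^ 2)
        = ((‖x‖ ^ 2)⁻¹ * (1 + ‖x‖ ^ 2)) * |Q (radialProj x hx)| := by ring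
      _ ≤ 2 * (1 / 3) := mul_le_mul h5 h4 (abs_nonneg _) (by norm_num)
      _ ≤ 2 := by norm_num

theorem abs_potential_le (hb : ∀ p, |Q p| ≤ 1 / 3) (x : R3) : |potential Q x| ≤ 1 := by
  rcases lt_or_ge ‖x‖ 1 with h | h
  · rw [potential_of_lt h, abs_one]
  · refine (abs_potential_le_japanese hb x).trans ?_
    rw [← div_eq_mul_inv, div_le_one (by positivity)]
    nlinarith

theorem measurable_potential (hQ : Measurable Q) : Measurable (potential Q) := by
  classical
  let p₀ : S2 := ⟨EuclideanSpace.single 0 1, by simp⟩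
  let f : R3 → S2 := fun x => if hx : x = 0 then p₀ else radialProj x hx
  have hf : Measurable f := by
    have hs : MeasurableSet (Metric.sphere (0 : R3) 1) := Metric.isClosed_sphere.measurableSet
    rw [← (MeasurableEmbedding.subtype_coe hs).measurable_comp_iff]
    have h2 : (Subtype.val ∘ f) = fun x => if x = 0 then (p₀ : R3) else ‖x‖⁻¹ • x := by
      funext x
      by_cases hx : x = 0
      · simp only [Function.comp_apply, f, dif_pos hx, if_pos hx]
      · simp only [Function.comp_apply, f, dif_neg hx, if_neg hx, radialProj]
    rw [h2]
    exact Measurable.ite (measurableSet_singleton 0) measurable_const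
      (measurable_norm.inv.smul measurable_id)
  have h : potential Q = fun x => if ‖x‖ < 1 then 1 else (‖x‖ ^ 2)⁻¹ * Q (f x) := by
    funext x
    by_cases h2 : ‖x‖ < 1
    · rw [potential_of_lt h2, if_pos h2]
    · have hx : x ≠ 0 := by
        rintro rfl
        simp at h2
      rw [if_neg h2]
      unfold potential
      rw [dif_neg hx, if_pos (not_lt.1 h2)]
      simp only [f, dif_neg hx]
  rw [h]
  exact Measurable.ite (measurableSet_lt measurable_norm measurable_const) measurable_const
    ((measurable_norm.pow_const 2).inv.mul (hQ.comp hf))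

theorem integrable_potential_sq (hQ : Measurable Q) (hb : ∀ p, |Q p| ≤ 1 / 3) :
    Integrable fun x => potential Q x ^ 2 := by
  have h1 : Integrable (fun ξ : R3 => (1 + ‖ξ‖ ^ 2) ^ (-(4 : ℝ) / 2)) :=
    integrable_rpow_neg_one_add_norm_sq (by simp; norm_num)
  refine (h1.const_mul 4).mono' ((measurable_potential hQ).pow_const 2).aestronglyMeasurable
    (Eventually.of_forall fun x => ?_)
  have h2 : (1 + ‖x‖ ^ 2) ^ (-(4 : ℝ) / 2) = ((1 + ‖x‖ ^ 2)⁻¹) ^ 2 := by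
    rw [← Real.rpow_neg_one, ← Real.rpow_mul_natCast (by positivity)]
    norm_num
  rw [h2, Real.norm_of_nonneg (sq_nonneg _), ← sq_abs]
  calc |potential Q x| ^ 2 ≤ (2 * (1 + ‖x‖ ^ 2)⁻¹) ^ 2 :=
        pow_le_pow_left₀ (abs_nonneg _) (abs_potential_le_japanese hb x) 2
    _ = _ := by ring

end Potential

end HomPot

namespace HomPot

section LogRadial

open Filter Topology
open scoped InnerProductSpace

theorem integral_Ioi_comp_log (F : ℝ → ℂ) :
    ∫ r in Ioi (0 : ℝ), ((Real.exp (-Real.log r) : ℝ) : ℂ) * F (Real.log r) = ∫ t, F t := by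
  have h1 : Ioi (0 : ℝ) = Real.exp '' univ := by rw [image_univ, Real.range_exp]
  rw [h1, integral_image_eq_integral_abs_deriv_smul MeasurableSet.univ
    (fun x _ => (Real.hasDerivAt_exp x).hasDerivWithinAt) Real.exp_injective.injOn,
    Measure.restrict_univ]
  congr 1
  funext t
  rw [Real.log_exp, abs_of_pos (Real.exp_pos t), Complex.real_smul, ← mul_assoc,
    ← Complex.ofReal_mul, ← Real.exp_add]
  simp

/-- The radial function `r^{-1/2} q(log r)` on `ℝ³`. -/
theorem exists_logRadial {q q₁ q₂ : ℝ → ℝ} (hq : ContDiff ℝ ∞ q) (hqc : HasCompactSupport q)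
    (hq0 : ∀ t, t ≤ 1 → q t = 0) (h1 : ∀ t, HasDerivAt q (q₁ t) t)
    (h2 : ∀ t, HasDerivAt q₁ (q₂ t) t) :
    ∃ ψ : 𝓢(R3, ℂ), ∀ (p : S2) (r : ℝ), 0 < r →
      ψ (r • (p : R3)) = ((Real.exp (-Real.log r / 2) * q (Real.log r) : ℝ) : ℂ) ∧
      r ^ 2 * Laplacian.laplacian ψ (r • (p : R3)) =
        ((Real.exp (-Real.log r / 2) * (q₂ (Real.log r) - q (Real.log r) / 4) : ℝ) : ℂ) := by
  let f : ℝ → ℝ := fun r => if r ≤ 1 then 0 else Real.exp (-Real.log r / 2) * q (Real.log r)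
  have hf0 : ∀ r, r ≤ 1 → f r = 0 := fun r hr => if_pos hr
  have hfpos : ∀ r, 0 < r → f r = Real.exp (-Real.log r / 2) * q (Real.log r) := by
    intro r hr
    by_cases h : r ≤ 1
    · rw [hf0 r h, hq0 _ ((Real.log_nonpos hr.le h).trans zero_le_one), mul_zero]
    · exact if_neg h
  have hev : ∀ r, 0 < r → f =ᶠ[𝓝 r] fun r => Real.exp (-Real.log r / 2) * q (Real.log r) :=
    fun r hr => (eventually_gt_nhds hr).mono fun s hs => hfpos s hs
  have hev0 : ∀ r, r < 1 → f =ᶠ[𝓝 r] fun _ => 0 :=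
    fun r hr => (eventually_lt_nhds hr).mono fun s hs => hf0 s hs.le
  have hfs : ContDiff ℝ ∞ f := by
    rw [contDiff_iff_contDiffAt]
    intro r
    rcases lt_or_ge r 1 with h | h
    · exact contDiffAt_const.congr_of_eventuallyEq (hev0 r h)
    · have hr : 0 < r := one_pos.trans_le h
      refine ContDiffAt.congr_of_eventuallyEq ?_ (hev r hr)
      have hl : ContDiffAt ℝ ∞ Real.log r := Real.contDiffAt_log.2 hr.ne'
      exact (Real.contDiff_exp.contDiffAt.comp r (hl.neg.div_const 2)).mul
        (hq.contDiffAt.comp r hl)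
  have hfc : HasCompactSupport f := by
    obtain ⟨R, hR⟩ := hqc.isCompact.isBounded.subset_closedBall (0 : ℝ)
    refine HasCompactSupport.intro (isCompact_Icc (a := 1) (b := Real.exp R)) fun r hr => ?_
    by_cases h : r ≤ 1
    · exact hf0 r h
    · have hr0 : 0 < r := by linarith [not_le.1 h]
      have h3 : Real.exp R < r := by
        by_contra hcon
        exact hr ⟨(not_le.1 h).le, not_lt.1 hcon⟩
      have h4 : R < Real.log r := (Real.lt_log_iff_exp_lt hr0).2 h3
      have h5 : Real.log r ∉ tsupport q := by
        intro h6
        have := hR h6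
        rw [Metric.mem_closedBall, Real.dist_eq, sub_zero] at this
        linarith [le_abs_self (Real.log r)]
      rw [hfpos r hr0, image_eq_zero_of_notMem_tsupport h5, mul_zero]
  let χ : ℝ → ℂ := fun r => (f r : ℂ)
  have hχ : ContDiff ℝ ∞ χ := Complex.ofRealCLM.contDiff.comp hfs
  have hχc : HasCompactSupport χ := hfc.comp_left (g := fun t : ℝ => (t : ℂ)) Complex.ofReal_zero
  have hχ0 : (0 : ℝ) ∉ tsupport χ := by
    rw [notMem_tsupport_iff_eventuallyEq]
    exact (hev0 0 one_pos).mono fun s hs => by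
      simp only [χ, hs, Complex.ofReal_zero, Pi.zero_apply]
  have hone : SmoothOnSphere fun _ => 1 := by
    simpa [monomialFun] using smoothOnSphere_monomialFun 0
  have hLone : ∀ p, sphereLaplacian (fun _ => 1) p = 0 := by
    intro p
    have hm := sphereLaplacian_monomialFun 0 p
    rw [laplacian_monomialFun] at hm
    simpa [monomialFun] using hm
  have hF := contDiff_radialProd hχ hχ0 hone
  refine ⟨(hasCompactSupport_radialProd hχc _).toSchwartzMap hF, fun p r hr => ⟨?_, ?_⟩⟩
  · rw [HasCompactSupport.toSchwartzMap_toFun, radialProd_smul _ _ hr, mul_one, ← hfpos r hr]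
  · have e : ∀ x, Laplacian.laplacian ((hasCompactSupport_radialProd hχc _).toSchwartzMap hF) x =
        Laplacian.laplacian (radialProd χ fun _ => 1) x := fun x => by
      rw [SchwartzMap.laplacian_apply]
      rfl
    rw [e, laplacian_radialProd hχ hχ0 hone p hr, hLone]
    have d1 : ∀ s, 0 < s → HasDerivAt f (Real.exp (-Real.log s / 2) *
        (q₁ (Real.log s) - q (Real.log s) / 2) * s⁻¹) s := by
      intro s hs
      have hl := Real.hasDerivAt_log hs.ne'
      refine HasDerivAt.congr_of_eventuallyEq ?_ (hev s hs)
      refine ((((hl.neg).div_const 2).exp).mul ((h1 (Real.log s)).comp s hl)).congr_deriv ?_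
      simp only [Function.comp_apply, Pi.neg_apply]
      ring
    have d1' : ∀ s, 0 < s → deriv χ s = ((Real.exp (-Real.log s / 2) *
        (q₁ (Real.log s) - q (Real.log s) / 2) * s⁻¹ : ℝ) : ℂ) :=
      fun s hs => (d1 s hs).ofReal_comp.deriv
    have d2 : HasDerivAt (fun s => Real.exp (-Real.log s / 2) *
        (q₁ (Real.log s) - q (Real.log s) / 2) * s⁻¹) (Real.exp (-Real.log r / 2) *
        (q₂ (Real.log r) - 2 * q₁ (Real.log r) + 3 / 4 * q (Real.log r)) * (r⁻¹) ^ 2) r := by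
      have hl := Real.hasDerivAt_log hr.ne'
      refine (((((hl.neg).div_const 2).exp).mul (((h2 (Real.log r)).comp r hl).sub
        (((h1 (Real.log r)).comp r hl).div_const 2))).mul (hasDerivAt_inv hr.ne')).congr_deriv ?_
      simp only [Function.comp_apply, Pi.sub_apply, Pi.mul_apply, Pi.neg_apply]
      ring
    have d2' : deriv (deriv χ) r = ((Real.exp (-Real.log r / 2) *
        (q₂ (Real.log r) - 2 * q₁ (Real.log r) + 3 / 4 * q (Real.log r)) * (r⁻¹) ^ 2 : ℝ) : ℂ) := by
      have h3 : deriv χ =ᶠ[𝓝 r] fun s => ((Real.exp (-Real.log s / 2) *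
        (q₁ (Real.log s) - q (Real.log s) / 2) * s⁻¹ : ℝ) : ℂ) :=
        (eventually_gt_nhds hr).mono fun s hs => d1' s hs
      rw [h3.deriv_eq]
      exact d2.ofReal_comp.deriv
    rw [d2', d1' r hr, mul_zero, sub_zero, mul_one, ← Complex.ofReal_mul, ← Complex.ofReal_add,
      ← Complex.ofReal_pow, ← Complex.ofReal_mul]
    congr 1
    field_simp
    ring

end LogRadial

section BoundStates

open Filter Topology
open scoped InnerProductSpace

theorem inner_toLp (φ ψ : 𝓢(R3, ℂ)) :
    ⟪(φ.toLp 2 volume : L2R3), ψ.toLp 2 volume⟫_ℂ = ∫ x, ψ x * (starRingEnd ℂ) (φ x) := by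
  rw [L2.inner_def]
  refine integral_congr_ae ?_
  filter_upwards [SchwartzMap.coeFn_toLp φ 2 (volume : Measure R3),
    SchwartzMap.coeFn_toLp ψ 2 (volume : Measure R3)] with x h1 h2
  rw [h1, h2, RCLike.inner_apply]

theorem inner_mulOp_toLp {V : R3 → ℝ} {C : ℝ} (hV : Measurable V) (hC : ∀ x, |V x| ≤ C)
    (φ ψ : 𝓢(R3, ℂ)) :
    ⟪(φ.toLp 2 volume : L2R3), mulOp volume hV hC (ψ.toLp 2 volume)⟫_ℂ =
      ∫ x, (V x : ℂ) * (ψ x * (starRingEnd ℂ) (φ x)) := by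
  rw [L2.inner_def]
  refine integral_congr_ae ?_
  filter_upwards [SchwartzMap.coeFn_toLp φ 2 (volume : Measure R3),
    SchwartzMap.coeFn_toLp ψ 2 (volume : Measure R3), mulOp_ae hV hC (ψ.toLp 2 volume)]
    with x h1 h2 h3
  rw [h1, h3, h2, RCLike.inner_apply, mul_assoc]

/-- Wide bumps at disjoint places. -/
theorem exists_bumps {δ : ℝ} (hδ : 0 < δ) : ∃ (q q₁ q₂ : ℕ → ℝ → ℝ),
    (∀ k, ContDiff ℝ ∞ (q k)) ∧ (∀ k, HasCompactSupport (q k)) ∧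
    (∀ k t, t ≤ 1 → q k t = 0) ∧ (∀ k t, HasDerivAt (q k) (q₁ k t) t) ∧
    (∀ k t, HasDerivAt (q₁ k) (q₂ k t) t) ∧
    (∀ j k, j ≠ k → ∀ t, q j t * q k t = 0 ∧ q j t * q₂ k t = 0) ∧
    (∀ k, Integrable fun t => q k t * q₂ k t) ∧ (∀ k, Integrable fun t => q k t * q k t) ∧
    ∃ e < 0, ∀ k, -(∫ t, q k t * q₂ k t) - δ * ∫ t, q k t * q k t = e := by
  let b : ContDiffBump (0 : ℝ) := ⟨1, 2, one_pos, one_lt_two⟩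
  have hb : ContDiff ℝ ∞ b := b.contDiff
  have hb1 : ContDiff ℝ ∞ (deriv b) := (contDiff_infty_iff_deriv.1 hb).2
  have hb2 : ContDiff ℝ ∞ (deriv (deriv b)) := (contDiff_infty_iff_deriv.1 hb1).2
  have hbc : HasCompactSupport b := b.hasCompactSupport
  set A := ∫ t, b t * b t with hA
  set B := ∫ t, b t * deriv (deriv b) t with hB
  have hApos : 0 < A := by
    refine Continuous.integral_pos_of_hasCompactSupport_nonneg_nonzero (x := 0)
      (b.continuous.mul b.continuous) hbc.mul_left (fun t => mul_self_nonneg _) ?_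
    have : b 0 = 1 := b.one_of_mem_closedBall (by simp [b])
    simp [this]
  obtain ⟨L, hL1, hL⟩ : ∃ L : ℝ, 1 ≤ L ∧ -(L⁻¹ * B) - δ * (L * A) < 0 := by
    refine ⟨1 + |B| / (δ * A), by have : 0 ≤ |B| / (δ * A) := by positivity
                                  linarith, ?_⟩
    set L := 1 + |B| / (δ * A)
    have h0 : 0 ≤ |B| / (δ * A) := by positivity
    have h1 : 1 ≤ L := by simp only [L]; linarith
    have h2 : δ * (L * A) = δ * A + |B| := by simp only [L]; field_simp
    have h3 : -(L⁻¹ * B) ≤ |B| := by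
      calc -(L⁻¹ * B) ≤ |L⁻¹ * B| := neg_le_abs _
        _ = L⁻¹ * |B| := by rw [abs_mul, abs_of_nonneg (inv_nonneg.2 (by linarith))]
        _ ≤ 1 * |B| := mul_le_mul_of_nonneg_right (inv_le_one_of_one_le₀ h1) (abs_nonneg _)
        _ = |B| := one_mul _
    rw [h2]
    have : 0 < δ * A := by positivity
    linarith
  have hL0 : 0 < L := one_pos.trans_le hL1
  let s : ℕ → ℝ → ℝ := fun k t => t / L - (4 * k + 3)
  have hs : ∀ k t, HasDerivAt (s k) L⁻¹ t := fun k t => by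
    refine (((hasDerivAt_id t).div_const L).sub_const _).congr_deriv ?_
    simp
  have hsc : ∀ k, ContDiff ℝ ∞ (s k) := fun k => (contDiff_id.div_const L).sub contDiff_const
  have hint : ∀ (k : ℕ) (F : ℝ → ℝ), ∫ t, F (s k t) = L * ∫ t, F t := by
    intro k F
    have h1 := Measure.integral_comp_div (fun t => F (t - (4 * k + 3))) L
    rw [integral_sub_right_eq_self F, abs_of_pos hL0, smul_eq_mul] at h1
    exact h1
  have hzero : ∀ x : ℝ, 2 ≤ |x| → b x = 0 := by
    intro x hx
    refine b.zero_of_le_dist ?_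
    simpa [b, Real.dist_eq] using hx
  have hcs : ∀ k, HasCompactSupport fun t => b (s k t) := by
    intro k
    refine HasCompactSupport.intro (isCompact_Icc (a := L * (4 * k + 1)) (b := L * (4 * k + 5)))
      fun t ht => hzero _ ?_
    by_contra hcon
    rw [not_le, abs_lt] at hcon
    simp only [s] at hcon
    apply ht
    have h1 : t = L * (t / L) := by field_simp
    constructor
    · rw [h1]
      exact mul_le_mul_of_nonneg_left (by linarith [hcon.1]) hL0.le
    · rw [h1]
      exact mul_le_mul_of_nonneg_left (by linarith [hcon.2]) hL0.le
  refine ⟨fun k t => b (s k t), fun k t => L⁻¹ * deriv b (s k t),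
    fun k t => L⁻¹ * (L⁻¹ * deriv (deriv b) (s k t)), fun k => hb.comp (hsc k), hcs, ?_, ?_, ?_, ?_,
    ?_, ?_, -(L⁻¹ * B) - δ * (L * A), hL, ?_⟩
  · intro k t ht
    refine hzero _ ?_
    have h1 : t / L ≤ 1 := (div_le_one hL0).2 (ht.trans hL1)
    have h2 : s k t ≤ -2 := by
      simp only [s]
      have : (0 : ℝ) ≤ k := Nat.cast_nonneg k
      linarith
    rw [abs_of_nonpos (by linarith)]
    linarith
  · intro k t
    have h1 : HasDerivAt b (deriv b (s k t)) (s k t) :=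
      (hb.differentiable (by simp) _).hasDerivAt
    refine (h1.comp t (hs k t)).congr_deriv (mul_comm _ _)
  · intro k t
    have h1 : HasDerivAt (deriv b) (deriv (deriv b) (s k t)) (s k t) :=
      (hb1.differentiable (by simp) _).hasDerivAt
    exact ((h1.comp t (hs k t)).const_mul L⁻¹).congr_deriv (by ring)
  · intro j k hjk t
    by_cases h : 2 ≤ |s j t|
    · simp [hzero _ h]
    · rw [not_le, abs_lt] at h
      have h1 : 2 < |s k t| := by
        have h2 : s k t = s j t + 4 * ((j : ℝ) - k) := by simp only [s]; ring
        rcases lt_or_gt_of_ne hjk with h3 | h3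
        · have : (j : ℝ) + 1 ≤ k := by exact_mod_cast h3
          rw [lt_abs]
          right
          linarith [h.2]
        · have : (k : ℝ) + 1 ≤ j := by exact_mod_cast h3
          rw [lt_abs]
          left
          linarith [h.1]
      have h4 : b =ᶠ[𝓝 (s k t)] fun _ => 0 :=
        ((isOpen_lt continuous_const continuous_abs).mem_nhds h1 : {x : ℝ | 2 < |x|} ∈ _) |>
          Filter.mem_of_superset <| fun x hx => hzero x (le_of_lt hx)
      have h5 : deriv (deriv b) (s k t) = 0 := by
        rw [h4.deriv.deriv_eq]
        simp
      exact ⟨by simp [hzero _ h1.le], by simp [h5]⟩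
  · intro k
    refine Continuous.integrable_of_hasCompactSupport ?_ (hcs k).mul_right
    have := (hsc k).continuous
    have := hb2.continuous
    have := b.continuous
    fun_prop
  · intro k
    refine Continuous.integrable_of_hasCompactSupport ?_ (hcs k).mul_right
    have := (hsc k).continuous
    have := b.continuous
    fun_prop
  · intro k
    have h1 := hint k fun x => b x * (L⁻¹ * (L⁻¹ * deriv (deriv b) x))
    have h2 := hint k fun x => b x * b x
    have h3 : ∫ x, b x * (L⁻¹ * (L⁻¹ * deriv (deriv b) x)) = L⁻¹ * L⁻¹ * B := by
      rw [hB, ← integral_const_mul]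
      congr 1
      funext x
      ring
    rw [h1, h2, h3, ← hA]
    field_simp

theorem integral_log_form {Q : S2 → ℝ} (hQ : Measurable Q) (hb : ∀ p, |Q p| ≤ 1 / 3)
    {q q' q₂ : ℝ → ℝ} (hq0 : ∀ t, t ≤ 1 → q t = 0) {φ ψ : 𝓢(R3, ℂ)}
    (hφ : ∀ (p : S2) (r : ℝ), 0 < r →
      φ (r • (p : R3)) = ((Real.exp (-Real.log r / 2) * q (Real.log r) : ℝ) : ℂ))
    (hψ : ∀ (p : S2) (r : ℝ), 0 < r →
      ψ (r • (p : R3)) = ((Real.exp (-Real.log r / 2) * q' (Real.log r) : ℝ) : ℂ) ∧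
      r ^ 2 * Laplacian.laplacian ψ (r • (p : R3)) =
        ((Real.exp (-Real.log r / 2) * (q₂ (Real.log r) - q' (Real.log r) / 4) : ℝ) : ℂ)) :
    ⟪(φ.toLp 2 volume : L2R3), (-(Laplacian.laplacian ψ)).toLp 2 volume +
        mulOp volume (measurable_potential hQ) (abs_potential_le hb) (ψ.toLp 2 volume)⟫_ℂ =
      ((-(surface.real univ * ∫ t, q t * (q₂ t - q' t / 4)) +
        (∫ p, Q p ∂surface) * ∫ t, q t * q' t : ℝ) : ℂ) := by
  have hexp : ∀ r, Real.exp (-Real.log r) =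
      Real.exp (-Real.log r / 2) * Real.exp (-Real.log r / 2) := fun r => by
    rw [← Real.exp_add]
    congr 1
    ring
  rw [inner_add_right, inner_toLp, inner_mulOp_toLp]
  have e1 : ∫ x, (-(Laplacian.laplacian ψ)) x * (starRingEnd ℂ) (φ x) =
      (∫ _ : S2, (1 : ℂ) ∂surface) * ∫ r in Ioi (0 : ℝ),
        ((Real.exp (-Real.log r) : ℝ) : ℂ) *
          ((fun t => ((-(q t * (q₂ t - q' t / 4)) : ℝ) : ℂ)) (Real.log r)) := by
    refine integral_radial_mul_angular _ _ fun p r hr => ?_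
    rw [hφ p r hr, Complex.conj_ofReal, neg_apply, ← mul_assoc, mul_neg, (hψ p r hr).2, hexp]
    push_cast
    ring
  have e2 : ∫ x, (potential Q x : ℂ) * (ψ x * (starRingEnd ℂ) (φ x)) =
      (∫ p : S2, (Q p : ℂ) ∂surface) * ∫ r in Ioi (0 : ℝ),
        ((Real.exp (-Real.log r) : ℝ) : ℂ) *
          ((fun t => ((q t * q' t : ℝ) : ℂ)) (Real.log r)) := by
    refine integral_radial_mul_angular _ _ fun p r hr => ?_
    rw [hφ p r hr, Complex.conj_ofReal, (hψ p r hr).1]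
    rcases le_or_gt 1 r with h | h
    · rw [potential_smul h, hexp]
      have : (r : ℂ) ≠ 0 := by exact_mod_cast hr.ne'
      push_cast
      field_simp
    · have h1 := hq0 (Real.log r) ((Real.log_nonpos hr.le h.le).trans zero_le_one)
      simp [h1]
  rw [e1, e2, integral_Ioi_comp_log fun t => ((-(q t * (q₂ t - q' t / 4)) : ℝ) : ℂ),
    integral_Ioi_comp_log fun t => ((q t * q' t : ℝ) : ℂ), integral_complex_ofReal,
    integral_complex_ofReal, integral_complex_ofReal, integral_const, integral_neg]
  push_cast
  simp

theorem infinite_negative_eigenvalues {Q : S2 → ℝ} (hQ : Measurable Q)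
    (hb : ∀ p, |Q p| ≤ 1 / 3)
    (hneg : ∫ p, Q p ∂surface < -(1 / 4) * surface.real univ) :
    {lam ∈ eigenvalues (potential Q) | lam < 0}.Infinite := by
  set M := mulOp volume (measurable_potential hQ) (abs_potential_le hb) with hM
  set σ := surface.real univ with hσ
  have hσ0 : 0 < σ := by rw [hσ, surface_real_univ]; positivity
  have hc := specGap_pos
  obtain ⟨K, hKs, hK0, hK, -, hKT⟩ := exists_resolvent freeRes_symmetric
    (mulOp_symmetric (measurable_potential hQ) (abs_potential_le hb)) zero_le_one one_lt_specGap
    freeRes_bound (norm_mulOp_le (measurable_potential hQ) (abs_potential_le hb))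
  rw [← hM] at hKT
  have hK' : ∀ u w, HasLaplacian u w ↔ u = K (w + (specGap : ℂ) • u + M u) := by
    intro u w
    rw [hasLaplacian_iff, hK, add_sub_cancel_right]
  have hC : IsCompactOperator (K - freeRes) := hKT
    (isCompactOperator_mulOp_freeRes _ _ (integrable_potential_sq hQ hb))
  have hT : ∀ x, (⟪freeRes x, x⟫_ℂ).re ≤ specGap⁻¹ * ‖x‖ ^ 2 := by
    intro x
    have h1 : (⟪freeRes x, x⟫_ℂ).re ≤ ‖freeRes x‖ * ‖x‖ :=
      (Complex.re_le_norm _).trans (norm_inner_le_norm _ _)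
    have h2 := (freeRes_bound x).trans h1
    have h3 : specGap * ‖freeRes x‖ ≤ ‖x‖ := by
      rcases (norm_nonneg (freeRes x)).eq_or_lt with h | h
      · rw [← h, mul_zero]
        exact norm_nonneg _
      · refine le_of_mul_le_mul_right ?_ h
        nlinarith
    rw [← le_inv_mul_iff₀ hc] at h3
    calc (⟪freeRes x, x⟫_ℂ).re ≤ ‖freeRes x‖ * ‖x‖ := h1
      _ ≤ (specGap⁻¹ * ‖x‖) * ‖x‖ := mul_le_mul_of_nonneg_right h3 (norm_nonneg _)
      _ = _ := by ring
  let δ : ℝ := -(1 / 4 + (∫ p, Q p ∂surface) / σ)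
  have hδ : 0 < δ := by
    have : (∫ p, Q p ∂surface) / σ < -(1 / 4) := (div_lt_iff₀ hσ0).2 hneg
    simp only [δ]
    linarith
  obtain ⟨q, q₁, q₂, hq, hqc, hq0, hq1, hq2, hdis, hi1, hi2, e, he, hform⟩ := exists_bumps hδ
  choose ψ hψ using fun k => exists_logRadial (hq k) (hqc k) (hq0 k) (hq1 k) (hq2 k)
  let u : ℕ → L2R3 := fun k => (ψ k).toLp 2 volume
  let v : ℕ → L2R3 := fun k => (-(Laplacian.laplacian (ψ k))).toLp 2 volume + M (u k)
  have huv : ∀ k, K (v k + (specGap : ℂ) • u k) = u k := by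
    intro k
    have h1 := (hK' _ _).1 (hasLaplacian_toLp (ψ k))
    simp only [v, u]
    rw [add_right_comm]
    exact h1.symm
  have hin : ∀ j k, ⟪u j, v k⟫_ℂ = if j = k then ((σ * e : ℝ) : ℂ) else 0 := by
    intro j k
    have h1 := integral_log_form hQ hb (hq0 j) (fun p r hr => (hψ j p r hr).1) (hψ k)
    refine h1.trans ?_
    split_ifs with hjk
    · subst hjk
      congr 1
      have h2 : ∫ t, q j t * (q₂ j t - q j t / 4) =
          (∫ t, q j t * q₂ j t) - 1 / 4 * ∫ t, q j t * q j t := by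
        rw [← integral_const_mul, ← integral_sub (hi1 j) ((hi2 j).const_mul _)]
        congr 1
        funext t
        ring
      rw [h2, ← hform j, ← hσ]
      simp only [δ]
      field_simp
      ring
    · have h2 : ∀ t, q j t * (q₂ k t - q k t / 4) = 0 := fun t => by
        rw [mul_sub, (hdis j k hjk t).2, ← mul_div_assoc, (hdis j k hjk t).1]
        simp
      have h3 : ∀ t, q j t * q k t = 0 := fun t => (hdis j k hjk t).1
      simp only [h2, h3]
      simp
  have hN : ∀ W : Submodule ℂ L2R3, FiniteDimensional ℂ W → ∃ y ∈ Wᗮ,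
      specGap⁻¹ * (⟪K y, y⟫_ℂ).re < ‖K y‖ ^ 2 := by
    intro W hW
    let n := Module.finrank ℂ W + 1
    let f : (Fin n → ℂ) →ₗ[ℂ] W := (W.orthogonalProjectionOnto : L2R3 →ₗ[ℂ] W) ∘ₗ
      Fintype.linearCombination ℂ (fun i : Fin n => v i + (specGap : ℂ) • u i)
    obtain ⟨a, ha, ha0⟩ := (Submodule.ne_bot_iff _).1
      (LinearMap.ker_ne_bot_of_finrank_lt (f := f) (by simp [n]))
    let y : L2R3 := ∑ i : Fin n, a i • (v i + (specGap : ℂ) • u i)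
    let z : L2R3 := ∑ i : Fin n, a i • u i
    have hKy : K y = z := by
      simp only [y, z, map_sum, map_smul, huv]
    refine ⟨y, ?_, ?_⟩
    · rw [← Submodule.orthogonalProjectionOnto_eq_zero_iff]
      exact ha
    · have hy : y = (∑ i : Fin n, a i • v i) + (specGap : ℂ) • z := by
        simp only [y, z, smul_add, Finset.sum_add_distrib, Finset.smul_sum]
        congr 1
        exact Finset.sum_congr rfl fun i _ => smul_comm _ _ _
      have h1 : ⟪z, ∑ i : Fin n, a i • v i⟫_ℂ = ((σ * e * ∑ i, ‖a i‖ ^ 2 : ℝ) : ℂ) := by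
        simp only [z, sum_inner, inner_sum, inner_smul_left, inner_smul_right, hin]
        simp only [Fin.val_inj, mul_ite, mul_zero, Finset.sum_ite_eq', Finset.mem_univ,
          if_true]
        push_cast
        rw [Finset.mul_sum]
        refine Finset.sum_congr rfl fun i _ => ?_
        rw [← Complex.conj_mul']
        ring
      have h2 : 0 < ∑ i, ‖a i‖ ^ 2 := by
        obtain ⟨i, hi⟩ := Function.ne_iff.1 ha0
        exact Finset.sum_pos' (fun _ _ => sq_nonneg _)
          ⟨i, Finset.mem_univ _, by have := norm_pos_iff.2 hi; positivity⟩
      rw [hKy, inv_mul_lt_iff₀ hc, hy, inner_add_right, inner_smul_right, inner_self_ofReal, h1,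
        ← Complex.ofReal_mul, Complex.add_re, Complex.ofReal_re, Complex.ofReal_re]
      have : σ * e * ∑ i, ‖a i‖ ^ 2 < 0 := mul_neg_of_neg_of_pos (mul_neg_of_pos_of_neg hσ0 he) h2
      linarith
  have hinf := infinite_eigenvalues hKs hK0 (inv_pos.2 hc) hT hC (by abel) hN
  have hinj : InjOn (fun κ : ℝ => κ⁻¹ - specGap)
      {κ : ℝ | specGap⁻¹ < κ ∧ ∃ x, x ≠ 0 ∧ K x = (κ : ℂ) • x} := fun a _ b _ hab => by
    simpa using hab
  refine (hinf.image hinj).mono ?_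
  rintro _ ⟨κ, ⟨hκ, x, hx, hxκ⟩, rfl⟩
  have hκ0 : 0 < κ := (inv_pos.2 hc).trans hκ
  have hκc : (κ : ℂ) ≠ 0 := by exact_mod_cast hκ0.ne'
  have hL : HasLaplacian x ((κ⁻¹ : ℂ) • x - (specGap : ℂ) • x - M x) := by
    rw [hK']
    have h7 : (κ⁻¹ : ℂ) • x - (specGap : ℂ) • x - M x + (specGap : ℂ) • x + M x =
        (κ⁻¹ : ℂ) • x := by abel
    rw [h7, map_smul, hxκ, smul_smul, inv_mul_cancel₀ hκc, one_smul]
  refine ⟨⟨x, hx, hL.memSobolev, _, hL, ?_⟩, ?_⟩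
  · filter_upwards [Lp.coeFn_sub ((κ⁻¹ : ℂ) • x - (specGap : ℂ) • x) (M x),
      Lp.coeFn_sub ((κ⁻¹ : ℂ) • x) ((specGap : ℂ) • x), Lp.coeFn_smul (κ⁻¹ : ℂ) x,
      Lp.coeFn_smul (specGap : ℂ) x,
      mulOp_ae (measurable_potential hQ) (abs_potential_le hb) x] with p h1 h2 h3 h4 h5
    rw [h1, Pi.sub_apply, h2, Pi.sub_apply, h3, h4, h5, Pi.smul_apply, Pi.smul_apply, smul_eq_mul,
      smul_eq_mul]
    push_cast
    ring
  · have := inv_lt_of_inv_lt₀ hc hκ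
    simp only
    linarith

end BoundStates

end HomPot

namespace HomPot

section Hardy

open Filter Topology
open scoped InnerProductSpace

theorem exists_radial_bound (φ : 𝓢(R3, ℂ)) : ∃ C : ℝ, 0 ≤ C ∧ ∀ (p : S2) (r : ℝ), 0 ≤ r →
    ‖φ (r • (p : R3))‖ ≤ C * (1 + r ^ 2)⁻¹ ∧ ‖radialDeriv φ p r‖ ≤ C * (1 + r ^ 2)⁻¹ ∧
      ‖radialDeriv₂ φ p r‖ ≤ C * (1 + r ^ 2)⁻¹ := by
  let C : ℝ := 2 ^ 2 * (Finset.Iic ((2, 2) : ℕ × ℕ)).sup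
    (fun m => SchwartzMap.seminorm ℝ m.1 m.2) φ
  have hC : ∀ n, n ≤ 2 → ∀ (p : S2) (r : ℝ), 0 ≤ r →
      ‖iteratedFDeriv ℝ n φ (r • (p : R3))‖ ≤ C * (1 + r ^ 2)⁻¹ := by
    intro n hn p r hr
    have h1 := SchwartzMap.one_add_le_sup_seminorm_apply (𝕜 := ℝ) (m := (2, 2)) (k := 2) (n := n)
      le_rfl hn φ (r • (p : R3))
    have h2 : ‖r • (p : R3)‖ = r := by
      rw [norm_smul, norm_coe_S2, mul_one, Real.norm_of_nonneg hr]
    rw [h2] at h1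
    rw [← div_eq_mul_inv, le_div_iff₀ (by positivity), mul_comm]
    refine le_trans (mul_le_mul_of_nonneg_right ?_ (norm_nonneg _)) h1
    nlinarith
  have hCnn : 0 ≤ C := by positivity
  refine ⟨C, hCnn, fun p r hr => ⟨?_, ?_, ?_⟩⟩
  · simpa using hC 0 (by norm_num) p r hr
  · refine le_trans ?_ (hC 1 (by norm_num) p r hr)
    rw [norm_iteratedFDeriv_one]
    refine (ContinuousLinearMap.le_opNorm _ _).trans ?_
    rw [norm_coe_S2, mul_one]
  · refine le_trans ?_ (hC 2 le_rfl p r hr)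
    have h3 : radialDeriv₂ φ p r = iteratedFDeriv ℝ 2 φ (r • (p : R3)) ![(p : R3), (p : R3)] := by
      rw [iteratedFDeriv_two_apply]
      rfl
    rw [h3]
    refine (ContinuousMultilinearMap.le_opNorm _ _).trans ?_
    simp [Fin.prod_univ_two]

/-- The density of the radial part of the energy. -/
noncomputable def radialEnergy (φ : R3 → ℂ) (p : R3) (r : ℝ) : ℝ :=
  -(r ^ 2 * inner ℝ (φ (r • p)) (radialDeriv₂ φ p r)) -
    2 * r * inner ℝ (φ (r • p)) (radialDeriv φ p r)

variable (φ : 𝓢(R3, ℂ))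

theorem continuous_radial : Continuous fun z : S2 × ℝ => φ (z.2 • (z.1 : R3)) :=
  φ.continuous.comp (by fun_prop)

theorem continuous_radialDeriv : Continuous fun z : S2 × ℝ => radialDeriv φ z.1 z.2 := by
  have h := (contDiff_fderiv (φ.smooth ⊤)).continuous
  unfold radialDeriv
  exact (h.comp (by fun_prop : Continuous fun z : S2 × ℝ => z.2 • (z.1 : R3))).clm_apply
    (by fun_prop)

theorem continuous_radialDeriv₂ : Continuous fun z : S2 × ℝ => radialDeriv₂ φ z.1 z.2 := by
  have h : Continuous (fderiv ℝ (fderiv ℝ φ)) :=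
    (contDiff_fderiv (φ.smooth ⊤)).continuous_fderiv (by simp)
  unfold radialDeriv₂
  exact ((h.comp (by fun_prop : Continuous fun z : S2 × ℝ => z.2 • (z.1 : R3))).clm_apply
    (by fun_prop)).clm_apply (by fun_prop)

theorem continuous_radialEnergy : Continuous fun z : S2 × ℝ => radialEnergy φ z.1 z.2 := by
  have h0 := continuous_radial φ
  have h1 := continuous_radialDeriv φ
  have h2 := continuous_radialDeriv₂ φ
  unfold radialEnergy
  fun_prop

theorem integrable_japanese_polar : Integrable (fun z : S2 × ℝ => (1 + z.2 ^ 2)⁻¹) polarMeasure := by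
  have h1 : Integrable (fun r : ℝ => (1 + r ^ 2)⁻¹) (volume.restrict (Ioi 0)) :=
    integrable_inv_one_add_sq.restrict
  have h2 := (integrable_const (μ := surface) (1 : ℝ)).mul_prod h1
  simpa using h2

theorem ae_polar_pos : ∀ᵐ z : S2 × ℝ ∂polarMeasure, 0 < z.2 :=
  Measure.quasiMeasurePreserving_snd.ae (ae_restrict_mem measurableSet_Ioi)

theorem integrable_polar_of_bound {f : S2 × ℝ → ℝ} (hf : AEStronglyMeasurable f polarMeasure)
    {D : ℝ} (hD : ∀ (p : S2) (r : ℝ), 0 < r → |f (p, r)| ≤ D * (1 + r ^ 2)⁻¹) :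
    Integrable f polarMeasure :=
  (integrable_japanese_polar.const_mul D).mono' hf
    (ae_polar_pos.mono fun z hz => hD z.1 z.2 hz)

theorem mul_bound {a b C r : ℝ} (ha0 : 0 ≤ a) (hb0 : 0 ≤ b) (hC : 0 ≤ C)
    (ha : a ≤ C * (1 + r ^ 2)⁻¹) (hb : b ≤ C * (1 + r ^ 2)⁻¹) :
    a * b ≤ C ^ 2 * (1 + r ^ 2)⁻¹ ∧ r ^ 2 * (a * b) ≤ C ^ 2 * (1 + r ^ 2)⁻¹ ∧
      |r| * (a * b) ≤ C ^ 2 * (1 + r ^ 2)⁻¹ := by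
  have hj : 0 < 1 + r ^ 2 := by positivity
  set j := (1 + r ^ 2)⁻¹ with hjd
  have hj0 : 0 < j := inv_pos.2 hj
  have hjj : (1 + r ^ 2) * j = 1 := mul_inv_cancel₀ hj.ne'
  have h1 : a * b ≤ (C * j) * (C * j) := mul_le_mul ha hb hb0 (by positivity)
  have h2 : a * b ≤ C ^ 2 * j * j := by linarith [h1]
  have h3 : (1 + r ^ 2) * (a * b) ≤ C ^ 2 * j := by
    calc (1 + r ^ 2) * (a * b) ≤ (1 + r ^ 2) * (C ^ 2 * j * j) :=
          mul_le_mul_of_nonneg_left h2 hj.le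
      _ = C ^ 2 * j * ((1 + r ^ 2) * j) := by ring
      _ = C ^ 2 * j := by rw [hjj, mul_one]
  have h4 : 0 ≤ a * b := mul_nonneg ha0 hb0
  have h5 : |r| ≤ 1 + r ^ 2 := by
    rw [← sq_abs]
    nlinarith [sq_nonneg (|r| - 1), abs_nonneg r]
  refine ⟨le_trans ?_ h3, le_trans ?_ h3, le_trans ?_ h3⟩
  · nlinarith [sq_nonneg r]
  · nlinarith
  · exact mul_le_mul_of_nonneg_right h5 h4

theorem abs_radialEnergy_le : ∃ D : ℝ, 0 ≤ D ∧ ∀ (p : S2) (r : ℝ), 0 ≤ r →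
    |radialEnergy φ p r| ≤ D * (1 + r ^ 2)⁻¹ ∧ ‖φ (r • (p : R3))‖ ^ 2 ≤ D * (1 + r ^ 2)⁻¹ ∧
    |r * ‖φ (r • (p : R3))‖ ^ 2 / 2 + r ^ 2 * inner ℝ (φ (r • (p : R3))) (radialDeriv φ p r)| ≤
      D * (1 + r ^ 2)⁻¹ ∧ ‖r • radialDeriv φ p r‖ ^ 2 ≤ D * (1 + r ^ 2)⁻¹ := by
  obtain ⟨C, hC, hb⟩ := exists_radial_bound φ
  refine ⟨3 * C ^ 2, by positivity, fun p r hr => ?_⟩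
  obtain ⟨h0, h1, h2⟩ := hb p r hr
  set g := φ (r • (p : R3))
  set g1 := radialDeriv φ p r
  set g2 := radialDeriv₂ φ p r
  have m02 := mul_bound (norm_nonneg _) (norm_nonneg _) hC h0 h2
  have m01 := mul_bound (norm_nonneg _) (norm_nonneg _) hC h0 h1
  have m00 := mul_bound (norm_nonneg _) (norm_nonneg _) hC h0 h0
  have m11 := mul_bound (norm_nonneg _) (norm_nonneg _) hC h1 h1
  have hi1 : |inner ℝ g g1| ≤ ‖g‖ * ‖g1‖ := abs_real_inner_le_norm _ _
  have hi2 : |inner ℝ g g2| ≤ ‖g‖ * ‖g2‖ := abs_real_inner_le_norm _ _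
  have e1 : |r ^ 2 * inner ℝ g g2| ≤ r ^ 2 * (‖g‖ * ‖g2‖) := by
    rw [abs_mul, abs_of_nonneg (sq_nonneg r)]
    exact mul_le_mul_of_nonneg_left hi2 (sq_nonneg r)
  have e2 : |r * inner ℝ g g1| ≤ |r| * (‖g‖ * ‖g1‖) := by
    rw [abs_mul]
    exact mul_le_mul_of_nonneg_left hi1 (abs_nonneg r)
  have e3 : |r ^ 2 * inner ℝ g g1| ≤ r ^ 2 * (‖g‖ * ‖g1‖) := by
    rw [abs_mul, abs_of_nonneg (sq_nonneg r)]
    exact mul_le_mul_of_nonneg_left hi1 (sq_nonneg r)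
  rw [abs_le] at e1 e2 e3
  have hj : 0 ≤ C ^ 2 * (1 + r ^ 2)⁻¹ := by positivity
  have hr' : |r| = r := abs_of_nonneg hr
  refine ⟨?_, ?_, ?_, ?_⟩
  · unfold radialEnergy
    rw [abs_le]
    constructor <;> linarith [m02.2.1, m01.2.2]
  · linarith [m00.1, sq ‖g‖]
  · have e4 : r * ‖g‖ ^ 2 = |r| * (‖g‖ * ‖g‖) := by rw [hr', sq]
    rw [abs_le, e4]
    have : 0 ≤ |r| * (‖g‖ * ‖g‖) := by positivity
    constructor <;> linarith [m00.2.2, m01.2.1]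
  · rw [norm_smul, mul_pow, Real.norm_eq_abs, sq_abs]
    linarith [m11.2.1, sq ‖g1‖]

theorem integrable_radialEnergy :
    Integrable (fun z : S2 × ℝ => radialEnergy φ z.1 z.2) polarMeasure := by
  obtain ⟨D, -, hD⟩ := abs_radialEnergy_le φ
  exact integrable_polar_of_bound (continuous_radialEnergy φ).aestronglyMeasurable
    fun p r hr => (hD p r hr.le).1

theorem integrable_radial_sq :
    Integrable (fun z : S2 × ℝ => ‖φ (z.2 • (z.1 : R3))‖ ^ 2) polarMeasure := by
  obtain ⟨D, -, hD⟩ := abs_radialEnergy_le φ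
  refine integrable_polar_of_bound (D := D) ((continuous_radial φ).norm.pow 2).aestronglyMeasurable
    fun p r hr => ?_
  rw [abs_of_nonneg (sq_nonneg _)]
  exact (hD p r hr.le).2.1

/-- Hardy's inequality along rays. -/
theorem hardy_ray (p : S2) : (1 / 4) * ∫ r in Ioi (0 : ℝ), ‖φ (r • (p : R3))‖ ^ 2 ≤
    ∫ r in Ioi (0 : ℝ), radialEnergy φ p r := by
  obtain ⟨D, hD0, hD⟩ := abs_radialEnergy_le φ
  have hφ : ContDiff ℝ ∞ φ := φ.smooth ⊤
  let g : ℝ → ℂ := fun r => φ (r • (p : R3))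
  let g1 : ℝ → ℂ := radialDeriv φ p
  let g2 : ℝ → ℂ := radialDeriv₂ φ p
  have d0 : ∀ r, HasDerivAt g (g1 r) r := hasDerivAt_radial hφ p
  have d1 : ∀ r, HasDerivAt g1 (g2 r) r := hasDerivAt_radialDeriv hφ p
  let B : ℝ → ℝ := fun r => -(r * ‖g r‖ ^ 2 / 2) - r ^ 2 * inner ℝ (g r) (g1 r)
  let B' : ℝ → ℝ := fun r => radialEnergy φ p r - (1 / 4) * ‖g r‖ ^ 2 -
    ‖(1 / 2 : ℝ) • g r + r • g1 r‖ ^ 2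
  have hexp : ∀ r, ‖(1 / 2 : ℝ) • g r + r • g1 r‖ ^ 2 =
      ‖g r‖ ^ 2 / 4 + r * inner ℝ (g r) (g1 r) + r ^ 2 * ‖g1 r‖ ^ 2 := by
    intro r
    rw [norm_add_sq_real, norm_smul, norm_smul, inner_smul_left, inner_smul_right, mul_pow,
      mul_pow, Real.norm_eq_abs, Real.norm_eq_abs, sq_abs, sq_abs]
    simp
    ring
  have dB : ∀ r, HasDerivAt B (B' r) r := by
    intro r
    have e1 : HasDerivAt (fun r => ‖g r‖ ^ 2) (2 * inner ℝ (g r) (g1 r)) r := (d0 r).norm_sq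
    have e2 := (d0 r).inner ℝ (d1 r)
    refine ((((hasDerivAt_id r).mul e1).div_const 2).neg.sub
      ((hasDerivAt_pow 2 r).mul e2)).congr_deriv ?_
    simp only [B', hexp, radialEnergy, real_inner_self_eq_norm_sq]
    change _ = -(r ^ 2 * inner ℝ (g r) (g2 r)) - 2 * r * inner ℝ (g r) (g1 r) - _ - _
    simp only [id, Nat.cast_ofNat]
    ring
  have hcont : Continuous fun r : ℝ => ((p, r) : S2 × ℝ) := by fun_prop
  have cg : Continuous g := (continuous_radial φ).comp hcont
  have cg1 : Continuous g1 := (continuous_radialDeriv φ).comp hcont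
  have cE : Continuous (radialEnergy φ p) := (continuous_radialEnergy φ).comp hcont
  have hint : ∀ {f : ℝ → ℝ} (E : ℝ), Continuous f →
      (∀ r, 0 ≤ r → |f r| ≤ E * (1 + r ^ 2)⁻¹) → IntegrableOn f (Ioi 0) := by
    intro f E hf hE
    refine ((integrable_inv_one_add_sq.restrict (s := Ioi (0 : ℝ))).const_mul E).mono'
      hf.aestronglyMeasurable ?_
    filter_upwards [ae_restrict_mem measurableSet_Ioi] with r hr using hE r (le_of_lt hr)
  have i1 : IntegrableOn (radialEnergy φ p) (Ioi 0) := hint D cE fun r hr => (hD p r hr).1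
  have i2 : IntegrableOn (fun r => ‖g r‖ ^ 2) (Ioi 0) := hint D (cg.norm.pow 2) fun r hr => by
    rw [abs_of_nonneg (sq_nonneg _)]
    exact (hD p r hr).2.1
  have i3 : IntegrableOn (fun r => ‖(1 / 2 : ℝ) • g r + r • g1 r‖ ^ 2) (Ioi 0) := by
    refine hint (4 * D) (by fun_prop) fun r hr => ?_
    rw [abs_of_nonneg (sq_nonneg _)]
    have h1 := (hD p r hr).2.1
    have h2 := (hD p r hr).2.2.2
    change ‖g r‖ ^ 2 ≤ _ at h1
    change ‖r • g1 r‖ ^ 2 ≤ _ at h2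
    have h3 : ‖(1 / 2 : ℝ) • g r + r • g1 r‖ ≤ ‖g r‖ / 2 + ‖r • g1 r‖ := by
      refine (norm_add_le _ _).trans (le_of_eq ?_)
      rw [norm_smul]
      norm_num
      ring
    have h4 := pow_le_pow_left₀ (norm_nonneg _) h3 2
    nlinarith [sq_nonneg (‖g r‖ / 2 - ‖r • g1 r‖), norm_nonneg (g r)]
  have hB0 : Tendsto B atTop (𝓝 0) := by
    have h1 : Tendsto (fun r : ℝ => D * (1 + r ^ 2)⁻¹) atTop (𝓝 0) := by
      rw [← mul_zero D]
      refine Tendsto.const_mul D (tendsto_inv_atTop_zero.comp ?_)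
      exact tendsto_atTop_add_const_left _ 1 (tendsto_pow_atTop two_ne_zero)
    refine squeeze_zero_norm' ?_ h1
    filter_upwards [eventually_ge_atTop 0] with r hr
    have h2 := (hD p r hr).2.2.1
    rw [← abs_neg] at h2
    rw [Real.norm_eq_abs]
    convert h2 using 2
    simp only [B, g, g1]
    ring
  have hI := integral_Ioi_of_hasDerivAt_of_tendsto' (fun r _ => dB r)
    ((i1.sub (i2.const_mul (1 / 4))).sub i3) hB0
  have hI2 : ∫ r in Ioi 0, B' r = (∫ r in Ioi 0, radialEnergy φ p r) -
      (1 / 4) * (∫ r in Ioi 0, ‖g r‖ ^ 2) -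
        ∫ r in Ioi 0, ‖(1 / 2 : ℝ) • g r + r • g1 r‖ ^ 2 := by
    rw [← integral_const_mul, ← integral_sub i1 (i2.const_mul _), ← integral_sub _ i3]
    exact i1.sub (i2.const_mul _)
  have hB00 : B 0 = 0 := by simp [B]
  rw [hI2, hB00] at hI
  have h5 : 0 ≤ ∫ r in Ioi 0, ‖(1 / 2 : ℝ) • g r + r • g1 r‖ ^ 2 :=
    integral_nonneg fun r => sq_nonneg _
  linarith

end Hardy

section FormBound

open Filter Topology
open scoped InnerProductSpace

variable {Q : S2 → ℝ}

theorem real_inner_eq (z w : ℂ) : inner ℝ z w = (w * (starRingEnd ℂ) z).re := by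
  rw [Complex.inner, mul_comm]

theorem re_inner_toLp (φ ψ : 𝓢(R3, ℂ)) :
    (⟪(φ.toLp 2 volume : L2R3), ψ.toLp 2 volume⟫_ℂ).re = ∫ x, inner ℝ (φ x) (ψ x) := by
  rw [L2.inner_def, ← RCLike.re_eq_complex_re, ← integral_re (L2.integrable_inner _ _)]
  refine integral_congr_ae ?_
  filter_upwards [SchwartzMap.coeFn_toLp φ 2 (volume : Measure R3),
    SchwartzMap.coeFn_toLp ψ 2 (volume : Measure R3)] with x h1 h2
  rw [h1, h2, real_inner_eq, RCLike.inner_apply]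
  rfl

theorem integrable_inner_schwartz (φ ψ : 𝓢(R3, ℂ)) :
    Integrable fun x => inner ℝ (φ x) (ψ x) := by
  have h := (L2.integrable_inner (𝕜 := ℂ) (φ.toLp 2 volume : L2R3) (ψ.toLp 2 volume)).re
  refine h.congr ?_
  filter_upwards [SchwartzMap.coeFn_toLp φ 2 (volume : Measure R3),
    SchwartzMap.coeFn_toLp ψ 2 (volume : Measure R3)] with x h1 h2
  rw [h1, h2, real_inner_eq, RCLike.inner_apply]
  rfl

theorem integrable_norm_sq_schwartz (φ : 𝓢(R3, ℂ)) : Integrable fun x => ‖φ x‖ ^ 2 := by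
  simpa only [real_inner_self_eq_norm_sq] using integrable_inner_schwartz φ φ

theorem sq_mul_inner_neg_laplacian (φ : 𝓢(R3, ℂ)) (p : S2) {r : ℝ} (hr : 0 < r) :
    r ^ 2 * inner ℝ (φ (r • (p : R3))) ((-(Laplacian.laplacian φ)) (r • (p : R3))) =
      radialEnergy φ p r +
        inner ℝ (φ (r • (p : R3))) (sphereLaplacian (fun q => φ (r • (q : R3))) p) := by
  have h1 := laplacian_polar (φ.smooth ⊤) p hr
  have h2 : (-(Laplacian.laplacian φ)) (r • (p : R3)) =
      -(Laplacian.laplacian (φ : R3 → ℂ) (r • (p : R3))) := by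
    rw [neg_apply, SchwartzMap.laplacian_apply]
  simp only [h2, h1, radialEnergy]
  set s := sphereLaplacian (fun q => φ (r • (q : R3))) p
  have h3 : -(radialDeriv₂ φ p r + ((2 / r : ℝ) : ℂ) * radialDeriv φ p r -
      (((r ^ 2 : ℝ)⁻¹ : ℝ) : ℂ) * s) = -radialDeriv₂ φ p r - (2 / r) • radialDeriv φ p r +
        (r ^ 2)⁻¹ • s := by
    simp only [Complex.real_smul]
    push_cast
    ring
  rw [h3, inner_add_right, inner_sub_right, inner_neg_right, inner_smul_right, inner_smul_right]
  have := hr.ne'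
  field_simp

theorem integral_inner_sphereLaplacian {f : S2 → ℂ} (hs : SmoothOnSphere f) :
    ∫ p, inner ℝ (f p) (sphereLaplacian f p) ∂surface =
      (⟪sphereClass _ hs.continuous, sphereClass _ hs.continuous_sphereLaplacian⟫_ℂ).re := by
  rw [L2.inner_def, ← RCLike.re_eq_complex_re, ← integral_re (L2.integrable_inner _ _)]
  refine integral_congr_ae ?_
  filter_upwards [sphereClass_ae hs.continuous, sphereClass_ae hs.continuous_sphereLaplacian]
    with x h1 h2
  rw [h1, h2, real_inner_eq, RCLike.inner_apply]
  rfl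

theorem integral_inner_sphereLaplacian_nonneg {f : S2 → ℂ} (hs : SmoothOnSphere f) :
    0 ≤ ∫ p, inner ℝ (f p) (sphereLaplacian f p) ∂surface := by
  rw [integral_inner_sphereLaplacian hs]
  obtain ⟨c, hc⟩ := (hasSphereLaplacian_sphereClass hs).exists_gap
  exact le_trans (by positivity) hc

theorem sphere_form_ge (hQ : Measurable Q) (hb : ∀ p, |Q p| ≤ 1 / 3)
    (hodd : ∀ p, Q (sphereReflect p) = -Q p) {F : R3 → ℂ} (hF : ContDiff ℝ ∞ F) {r : ℝ}
    (hr : 0 < r) :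
    -(1 / 18) * ∫ p : S2, ‖F (r • (p : R3))‖ ^ 2 ∂surface ≤
      ∫ p : S2, (inner ℝ (F (r • (p : R3)))
        (sphereLaplacian (fun q => F (r • (q : R3))) p) +
          r ^ 2 * (potential Q (r • (p : R3)) * ‖F (r • (p : R3))‖ ^ 2)) ∂surface := by
  have hs := smoothOnSphere_restrict hF r
  have hL := hasSphereLaplacian_sphereClass hs
  set u := sphereClass _ hs.continuous
  set w := sphereClass _ hs.continuous_sphereLaplacian
  have hu : u =ᵐ[surface] fun p => F (r • (p : R3)) := sphereClass_ae _
  have e1 : ‖u‖ ^ 2 = ∫ p : S2, ‖F (r • (p : R3))‖ ^ 2 ∂surface := by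
    rw [norm_sq_eq_integral]
    refine integral_congr_ae ?_
    filter_upwards [hu] with p hp
    rw [hp]
  have e2 : (⟪u, w⟫_ℂ).re = ∫ p : S2, inner ℝ (F (r • (p : R3)))
        (sphereLaplacian (fun q => F (r • (q : R3))) p) ∂surface :=
    (integral_inner_sphereLaplacian hs).symm
  have i1 : Integrable (fun p : S2 => inner ℝ (F (r • (p : R3)))
        (sphereLaplacian (fun q => F (r • (q : R3))) p)) surface := by
    refine Continuous.integrable_of_hasCompactSupport ?_ (HasCompactSupport.of_compactSpace _)
    have h1 := hs.continuous
    have h2 := hs.continuous_sphereLaplacian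
    fun_prop
  have iF : Integrable (fun p : S2 => ‖F (r • (p : R3))‖ ^ 2) surface :=
    Continuous.integrable_of_hasCompactSupport (hs.continuous.norm.pow 2)
      (HasCompactSupport.of_compactSpace _)
  rcases le_or_gt 1 r with h | h
  · have h3 := hL.ge_of_odd hQ hb hodd
    have e3 : ∫ p, Q p * ‖u p‖ ^ 2 ∂surface =
        ∫ p : S2, r ^ 2 * (potential Q (r • (p : R3)) * ‖F (r • (p : R3))‖ ^ 2) ∂surface := by
      refine integral_congr_ae ?_
      filter_upwards [hu] with p hp
      rw [hp, potential_smul h]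
      have := hr.ne'
      field_simp
    have i2 : Integrable (fun p : S2 =>
        r ^ 2 * (potential Q (r • (p : R3)) * ‖F (r • (p : R3))‖ ^ 2)) surface := by
      refine Integrable.const_mul ?_ _
      refine Integrable.bdd_mul (c := 1) iF ?_ (Eventually.of_forall fun p => abs_potential_le hb _)
      refine ((measurable_potential hQ).comp ?_).aestronglyMeasurable
      exact (continuous_subtype_val.const_smul r).measurable
    rw [integral_add i1 i2, ← e1, ← e2, ← e3]
    exact h3
  · have e4 : ∀ p : S2, potential Q (r • (p : R3)) = 1 := fun p => potential_of_lt (by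
      rwa [norm_smul, norm_coe_S2, mul_one, Real.norm_of_nonneg hr.le])
    simp only [e4, one_mul]
    rw [integral_add i1 (iF.const_mul _), ← e2, integral_const_mul]
    have h5 : 0 ≤ ∫ p : S2, ‖F (r • (p : R3))‖ ^ 2 ∂surface := integral_nonneg fun p => sq_nonneg _
    have h6 : 0 ≤ (⟪u, w⟫_ℂ).re := e2 ▸ integral_inner_sphereLaplacian_nonneg hs
    have h7 : 0 ≤ r ^ 2 * ∫ p : S2, ‖F (r • (p : R3))‖ ^ 2 ∂surface := by positivity
    linarith

/-- Positivity of `-Δ + V` when the angular part of `V` is odd under the reflection. -/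
theorem form_ge (hQ : Measurable Q) (hb : ∀ p, |Q p| ≤ 1 / 3)
    (hodd : ∀ p, Q (sphereReflect p) = -Q p) (φ : 𝓢(R3, ℂ)) :
    (7 / 36) * ∫ x, (1 + ‖x‖ ^ 2)⁻¹ * ‖φ x‖ ^ 2 ≤
      (∫ x, inner ℝ (φ x) ((-(Laplacian.laplacian φ)) x)) +
        ∫ x, potential Q x * ‖φ x‖ ^ 2 := by
  have hφ : ContDiff ℝ ∞ φ := φ.smooth ⊤
  have i1 := integrable_inner_schwartz φ (-(Laplacian.laplacian φ))
  have i0 := integrable_norm_sq_schwartz φ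
  have i2 : Integrable fun x => potential Q x * ‖φ x‖ ^ 2 :=
    Integrable.bdd_mul (c := 1) i0 (measurable_potential hQ).aestronglyMeasurable
      (Eventually.of_forall fun x => abs_potential_le hb x)
  have i3 : Integrable fun x => (1 + ‖x‖ ^ 2)⁻¹ * ‖φ x‖ ^ 2 := by
    refine Integrable.bdd_mul (c := 1) i0 ?_ (Eventually.of_forall fun x => ?_)
    · exact (Measurable.inv (by fun_prop)).aestronglyMeasurable
    · rw [Real.norm_of_nonneg (by positivity)]
      exact inv_le_one_of_one_le₀ (by linarith [sq_nonneg ‖x‖])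
  rw [← integral_add i1 i2, integral_polar, integral_polar]
  have i4 := integrable_polar.1 (i1.add i2)
  have i5 := integrable_radialEnergy φ
  have i6 := integrable_radial_sq φ
  set E : S2 × ℝ → ℝ := fun z => radialEnergy φ z.1 z.2
  set N : S2 × ℝ → ℝ := fun z => ‖φ (z.2 • (z.1 : R3))‖ ^ 2
  set T : S2 × ℝ → ℝ := fun z => z.2 ^ 2 • (inner ℝ (φ (z.2 • (z.1 : R3)))
    ((-(Laplacian.laplacian φ)) (z.2 • (z.1 : R3))) +
      potential Q (z.2 • (z.1 : R3)) * ‖φ (z.2 • (z.1 : R3))‖ ^ 2)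
  have i4' : Integrable T polarMeasure := i4
  have hT : ∀ (p : S2) (r : ℝ), 0 < r → T (p, r) - E (p, r) =
      inner ℝ (φ (r • (p : R3))) (sphereLaplacian (fun q => φ (r • (q : R3))) p) +
          r ^ 2 * (potential Q (r • (p : R3)) * ‖φ (r • (p : R3))‖ ^ 2) := by
    intro p r hr
    simp only [T, E, smul_eq_mul, mul_add, sq_mul_inner_neg_laplacian φ p hr]
    ring
  have hE : (1 / 4) * ∫ z, N z ∂polarMeasure ≤ ∫ z, E z ∂polarMeasure := by
    rw [← integral_const_mul, integral_prod _ (i6.const_mul _), integral_prod _ i5]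
    refine integral_mono (i6.const_mul (1 / 4)).integral_prod_left i5.integral_prod_left
      fun p => ?_
    simp only
    rw [integral_const_mul]
    exact hardy_ray φ p
  have hS : -(1 / 18) * ∫ z, N z ∂polarMeasure ≤ ∫ z, (T z - E z) ∂polarMeasure := by
    have i7 : Integrable (fun z => T z - E z) polarMeasure := i4'.sub i5
    rw [← integral_const_mul, integral_prod_symm _ (i6.const_mul _), integral_prod_symm _ i7]
    refine integral_mono_ae (i6.const_mul (-(1 / 18))).integral_prod_right
      i7.integral_prod_right ?_
    filter_upwards [ae_restrict_mem measurableSet_Ioi] with r hr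
    have h3 := sphere_form_ge hQ hb hodd hφ hr
    rw [integral_const_mul]
    refine h3.trans (le_of_eq ?_)
    exact integral_congr_ae (Eventually.of_forall fun p => (hT p r hr).symm)
  rw [integral_sub i4' i5] at hS
  have hN : ∫ z, z.2 ^ 2 • ((1 + ‖z.2 • (z.1 : R3)‖ ^ 2)⁻¹ *
      ‖φ (z.2 • (z.1 : R3))‖ ^ 2) ∂polarMeasure ≤ ∫ z, N z ∂polarMeasure := by
    refine integral_mono (integrable_polar.1 i3) i6 fun z => ?_
    simp only [smul_eq_mul, N, norm_smul, norm_coe_S2, mul_one, Real.norm_eq_abs, sq_abs]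
    rw [← mul_assoc]
    refine mul_le_of_le_one_left (sq_nonneg _) ?_
    rw [← div_eq_mul_inv, div_le_one (by positivity)]
    linarith
  linarith

/-- There are no eigenvalues `≤ 0` when the angular part of the potential is odd. -/
theorem IsEigenfunction.pos_of_odd (hQ : Measurable Q) (hb : ∀ p, |Q p| ≤ 1 / 3)
    (hodd : ∀ p, Q (sphereReflect p) = -Q p) {lam : ℝ} {u : L2R3}
    (h : IsEigenfunction (potential Q) lam u) : 0 < lam := by
  obtain ⟨hu, -, w, hL, hae⟩ := h
  by_contra hlam
  have hL' : HasLaplacian u w := hL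
  obtain ⟨φ, h1, h2⟩ := hL'.exists_approx
  have hm : Measurable fun x : R3 => (1 + ‖x‖ ^ 2)⁻¹ := Measurable.inv (by fun_prop)
  have hm1 : ∀ x : R3, |(1 + ‖x‖ ^ 2)⁻¹| ≤ 1 := fun x => by
    rw [abs_of_nonneg (by positivity)]
    exact inv_le_one_of_one_le₀ (by linarith [sq_nonneg ‖x‖])
  set M := mulOp volume (measurable_potential hQ) (abs_potential_le hb)
  set J := mulOp volume hm hm1
  have hint : ∀ {V : R3 → ℝ} (hV : Measurable V) (hC : ∀ x, |V x| ≤ 1) (ψ : 𝓢(R3, ℂ)),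
      (⟪(ψ.toLp 2 volume : L2R3), mulOp volume hV hC (ψ.toLp 2 volume)⟫_ℂ).re =
        ∫ x, V x * ‖ψ x‖ ^ 2 := by
    intro V hV hC ψ
    rw [re_inner_mulOp]
    refine integral_congr_ae ?_
    filter_upwards [SchwartzMap.coeFn_toLp ψ 2 (volume : Measure R3)] with x hx
    rw [hx]
  have hn : ∀ n, (7 / 36) * (⟪(φ n).toLp 2 volume, J ((φ n).toLp 2 volume)⟫_ℂ).re ≤
      (⟪(φ n).toLp 2 volume, (-(Laplacian.laplacian (φ n))).toLp 2 volume⟫_ℂ).re +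
        (⟪(φ n).toLp 2 volume, M ((φ n).toLp 2 volume)⟫_ℂ).re := by
    intro n
    rw [hint, hint, re_inner_toLp]
    exact form_ge hQ hb hodd (φ n)
  have l1 := (Complex.continuous_re.tendsto _).comp
    (h1.inner (𝕜 := ℂ) ((J.continuous.tendsto _).comp h1))
  have l2 := (Complex.continuous_re.tendsto _).comp (h1.inner (𝕜 := ℂ) h2)
  have l3 := (Complex.continuous_re.tendsto _).comp
    (h1.inner (𝕜 := ℂ) ((M.continuous.tendsto _).comp h1))
  have hlim := le_of_tendsto_of_tendsto' (l1.const_mul (7 / 36)) (l2.add l3) hn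
  have hw : w + M u = (lam : ℂ) • u := by
    refine Lp.ext ?_
    filter_upwards [hae, Lp.coeFn_add w (M u), mulOp_ae (measurable_potential hQ)
      (abs_potential_le hb) u, Lp.coeFn_smul (lam : ℂ) u] with x e1 e2 e3 e4
    rw [e2, Pi.add_apply, e3, e1, e4, Pi.smul_apply, smul_eq_mul]
  have hright : (⟪u, w⟫_ℂ).re + (⟪u, M u⟫_ℂ).re = lam * ‖u‖ ^ 2 := by
    rw [← Complex.add_re, ← inner_add_right, hw, inner_smul_right, inner_self_ofReal,
      ← Complex.ofReal_mul, Complex.ofReal_re]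
  rw [hright] at hlim
  have hJ : (⟪u, J u⟫_ℂ).re ≤ 0 := by
    have : lam * ‖u‖ ^ 2 ≤ 0 := mul_nonpos_of_nonpos_of_nonneg (not_lt.1 hlam) (sq_nonneg _)
    linarith
  rw [re_inner_mulOp] at hJ
  have hzero : ∫ x, (1 + ‖x‖ ^ 2)⁻¹ * ‖u x‖ ^ 2 = 0 :=
    le_antisymm hJ (integral_nonneg fun x => by positivity)
  rw [integral_eq_zero_iff_of_nonneg (fun x => by positivity)
    (integrable_mul_norm_sq hm hm1 u)] at hzero
  apply hu
  refine Lp.ext ?_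
  filter_upwards [hzero, Lp.coeFn_zero ℂ 2 (volume : Measure R3)] with x e1 e2
  rw [e2]
  have e3 : (1 + ‖x‖ ^ 2)⁻¹ * ‖u x‖ ^ 2 = 0 := e1
  have e4 : (1 + ‖x‖ ^ 2)⁻¹ ≠ 0 := by positivity
  have e5 : ‖u x‖ ^ 2 = 0 := (mul_eq_zero.1 e3).resolve_left e4
  simpa using e5

end FormBound

end HomPot

namespace HomPot

section BallInequality

open Filter Topology
open scoped InnerProductSpace

/-- The indicator function of the unit ball. -/
noncomputable def ballInd (x : R3) : ℝ := if ‖x‖ < 1 then 1 else 0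

/-- The function `(1 - |x|²) / 6` on the unit ball, continued by zero. -/
noncomputable def ballWeight (x : R3) : ℝ := if ‖x‖ < 1 then (1 - ‖x‖ ^ 2) / 6 else 0

theorem measurable_ballInd : Measurable ballInd :=
  Measurable.ite (measurableSet_lt measurable_norm measurable_const) measurable_const
    measurable_const

theorem measurable_ballWeight : Measurable ballWeight :=
  Measurable.ite (measurableSet_lt measurable_norm measurable_const) (by fun_prop)
    measurable_const

theorem abs_ballInd_le (x : R3) : |ballInd x| ≤ 1 := by
  unfold ballInd
  split_ifs <;> simp

theorem ballWeight_nonneg (x : R3) : 0 ≤ ballWeight x := by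
  unfold ballWeight
  split_ifs with h
  · nlinarith [norm_nonneg x]
  · exact le_rfl

theorem abs_ballWeight_le (x : R3) : |ballWeight x| ≤ 1 := by
  rw [abs_of_nonneg (ballWeight_nonneg x)]
  unfold ballWeight
  split_ifs with h
  · nlinarith [norm_nonneg x]
  · norm_num

theorem norm_smul_coe_S2 (p : S2) {r : ℝ} (hr : 0 ≤ r) : ‖r • (p : R3)‖ = r := by
  rw [norm_smul, norm_coe_S2, mul_one, Real.norm_of_nonneg hr]

theorem setIntegral_Ioi_ite (f : ℝ → ℝ) :
    ∫ r in Ioi (0 : ℝ), (if r < 1 then f r else 0) = ∫ r in (0 : ℝ)..1, f r := by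
  have h : (fun r : ℝ => if r < 1 then f r else 0) = (Iio 1).indicator f := by
    ext r
    simp [indicator]
  rw [h, setIntegral_indicator measurableSet_Iio, Ioi_inter_Iio,
    intervalIntegral.integral_of_le zero_le_one, integral_Ioc_eq_integral_Ioo]

theorem ball_ray (φ : 𝓢(R3, ℂ)) (p : S2) :
    ∫ r in (0 : ℝ)..1, r ^ 2 * ‖φ (r • (p : R3))‖ ^ 2 ≤
      (1 / 3) * ‖φ p‖ ^ 2 + 2 * ∫ r in (0 : ℝ)..1, (1 - r ^ 2) / 6 * radialEnergy φ p r := by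
  have hφ : ContDiff ℝ ∞ φ := φ.smooth ⊤
  let g : ℝ → ℂ := fun r => φ (r • (p : R3))
  let g1 : ℝ → ℂ := radialDeriv φ p
  let g2 : ℝ → ℂ := radialDeriv₂ φ p
  have d0 : ∀ r, HasDerivAt g (g1 r) r := hasDerivAt_radial hφ p
  have d1 : ∀ r, HasDerivAt g1 (g2 r) r := hasDerivAt_radialDeriv hφ p
  have hcont : Continuous fun r : ℝ => ((p, r) : S2 × ℝ) := by fun_prop
  have cg : Continuous g := (continuous_radial φ).comp hcont
  have cg1 : Continuous g1 := (continuous_radialDeriv φ).comp hcont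
  have cE : Continuous (radialEnergy φ p) := (continuous_radialEnergy φ).comp hcont
  let a : ℝ → ℝ := fun r => r ^ 2 * ‖g r‖ ^ 2
  let b : ℝ → ℝ := fun r => (1 - r ^ 2) / 6 * radialEnergy φ p r
  let c : ℝ → ℝ := fun r => (1 - r ^ 2) / 3 * (r ^ 2 * ‖g1 r‖ ^ 2)
  have dB : ∀ r, HasDerivAt (fun r => (r ^ 3 / 3) * ‖g r‖ ^ 2 +
      (1 - r ^ 2) / 6 * (r ^ 2 * (2 * inner ℝ (g r) (g1 r)))) (a r - 2 * b r + c r) r := by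
    intro r
    have e1 : HasDerivAt (fun r => ‖g r‖ ^ 2) (2 * inner ℝ (g r) (g1 r)) r := (d0 r).norm_sq
    have e2 := (d0 r).inner ℝ (d1 r)
    refine ((((hasDerivAt_pow 3 r).div_const 3).mul e1).add
      ((((hasDerivAt_const r (1 : ℝ)).sub (hasDerivAt_pow 2 r)).div_const 6).mul
        ((hasDerivAt_pow 2 r).mul (e2.const_mul 2)))).congr_deriv ?_
    simp only [a, b, c, radialEnergy, real_inner_self_eq_norm_sq]
    change _ = r ^ 2 * ‖g r‖ ^ 2 - 2 * ((1 - r ^ 2) / 6 * (-(r ^ 2 * inner ℝ (g r) (g2 r)) -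
      2 * r * inner ℝ (g r) (g1 r))) + _
    simp only [Pi.sub_apply, Pi.mul_apply, Nat.cast_ofNat]
    ring
  have ca : Continuous a := by fun_prop
  have cb : Continuous b := by fun_prop
  have cc : Continuous c := by fun_prop
  have hI := intervalIntegral.integral_eq_sub_of_hasDerivAt (a := 0) (b := 1)
    (fun r _ => dB r) ((by fun_prop : Continuous fun r => a r - 2 * b r + c r).intervalIntegrable _ _)
  rw [intervalIntegral.integral_add ((by fun_prop :
      Continuous fun r => a r - 2 * b r).intervalIntegrable _ _) (cc.intervalIntegrable _ _),
    intervalIntegral.integral_sub (ca.intervalIntegrable _ _)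
      ((cb.const_mul 2).intervalIntegrable _ _), intervalIntegral.integral_const_mul] at hI
  have hc : 0 ≤ ∫ r in (0 : ℝ)..1, c r := by
    refine intervalIntegral.integral_nonneg zero_le_one fun r hr => ?_
    have : r ^ 2 ≤ 1 := pow_le_one₀ hr.1 hr.2
    have h1 : 0 ≤ (1 - r ^ 2) / 3 := by linarith
    positivity
  have g1' : g 1 = φ p := by simp [g]
  simp only [g1'] at hI
  norm_num at hI
  change ∫ r in (0 : ℝ)..1, a r ≤ _ + 2 * ∫ r in (0 : ℝ)..1, b r
  linarith

theorem ball_le (φ : 𝓢(R3, ℂ)) :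
    ∫ x, ballInd x * ‖φ x‖ ^ 2 ≤ (1 / 3) * ∫ p : S2, ‖φ p‖ ^ 2 ∂surface +
      2 * ∫ x, ballWeight x * inner ℝ (φ x) ((-(Laplacian.laplacian φ)) x) := by
  have i0 : Integrable fun x => ballInd x * ‖φ x‖ ^ 2 :=
    Integrable.bdd_mul (c := 1) (integrable_norm_sq_schwartz φ)
      measurable_ballInd.aestronglyMeasurable (Eventually.of_forall abs_ballInd_le)
  have i1 : Integrable fun x => ballWeight x * inner ℝ (φ x) ((-(Laplacian.laplacian φ)) x) :=
    Integrable.bdd_mul (c := 1) (integrable_inner_schwartz φ _)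
      measurable_ballWeight.aestronglyMeasurable (Eventually.of_forall abs_ballWeight_le)
  rw [integral_polar, integral_polar]
  have j0 := integrable_polar.1 i0
  have j1 := integrable_polar.1 i1
  let wt : ℝ → ℝ := fun r => if r < 1 then (1 - r ^ 2) / 6 else 0
  have hwt : ∀ (p : S2) (r : ℝ), 0 < r → ballWeight (r • (p : R3)) = wt r := by
    intro p r hr
    simp only [ballWeight, norm_smul_coe_S2 p hr.le, wt]
  have mwt : Measurable wt := Measurable.ite measurableSet_Iio (by fun_prop) measurable_const
  set N : S2 × ℝ → ℝ := fun z => z.2 ^ 2 • (ballInd (z.2 • (z.1 : R3)) *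
    ‖φ (z.2 • (z.1 : R3))‖ ^ 2)
  set T : S2 × ℝ → ℝ := fun z => z.2 ^ 2 • (ballWeight (z.2 • (z.1 : R3)) *
    inner ℝ (φ (z.2 • (z.1 : R3))) ((-(Laplacian.laplacian φ)) (z.2 • (z.1 : R3))))
  set E : S2 × ℝ → ℝ := fun z => ballWeight (z.2 • (z.1 : R3)) * radialEnergy φ z.1 z.2
  have j2 : Integrable E polarMeasure := by
    refine Integrable.bdd_mul (c := 1) (integrable_radialEnergy φ) ?_
      (Eventually.of_forall fun z => abs_ballWeight_le _)
    exact (measurable_ballWeight.comp (by fun_prop)).aestronglyMeasurable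
  have hT : ∀ (p : S2) (r : ℝ), 0 < r → T (p, r) - E (p, r) = wt r *
      inner ℝ (φ (r • (p : R3))) (sphereLaplacian (fun q => φ (r • (q : R3))) p) := by
    intro p r hr
    have h := sq_mul_inner_neg_laplacian φ p hr
    simp only [T, E, smul_eq_mul, hwt p r hr]
    linear_combination wt r * h
  have j3 : Integrable (fun z => T z - E z) polarMeasure := j1.sub j2
  have hS : 0 ≤ ∫ z, (T z - E z) ∂polarMeasure := by
    rw [integral_prod_symm _ j3]
    refine integral_nonneg_of_ae ?_
    filter_upwards [ae_restrict_mem measurableSet_Ioi] with r hr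
    have h1 : ∫ p, (T (p, r) - E (p, r)) ∂surface = wt r * ∫ p : S2,
        inner ℝ (φ (r • (p : R3))) (sphereLaplacian (fun q => φ (r • (q : R3))) p) ∂surface := by
      rw [← integral_const_mul]
      exact integral_congr_ae (Eventually.of_forall fun p => hT p r hr)
    rw [Pi.zero_apply, h1]
    refine mul_nonneg ?_ (integral_inner_sphereLaplacian_nonneg
      (smoothOnSphere_restrict (φ.smooth ⊤) r))
    have hr' : (0 : ℝ) < r := hr
    simp only [wt]
    split_ifs with h
    · nlinarith
    · exact le_rfl
  rw [integral_sub j1 j2] at hS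
  have i5 : Integrable (fun p : S2 => ‖φ p‖ ^ 2) surface :=
    Continuous.integrable_of_hasCompactSupport
      ((φ.continuous.comp continuous_subtype_val).norm.pow 2) (HasCompactSupport.of_compactSpace _)
  have hN : ∫ z, N z ∂polarMeasure ≤ (1 / 3) * ∫ p : S2, ‖φ p‖ ^ 2 ∂surface +
      2 * ∫ z, E z ∂polarMeasure := by
    rw [← integral_const_mul, ← integral_const_mul, integral_prod _ j0,
      integral_prod _ (j2.const_mul 2),
      ← integral_add (i5.const_mul _) (j2.const_mul 2).integral_prod_left]
    refine integral_mono j0.integral_prod_left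
      ((i5.const_mul _).add (j2.const_mul 2).integral_prod_left) fun p => ?_
    have h1 : ∫ r in Ioi (0 : ℝ), N (p, r) =
        ∫ r in (0 : ℝ)..1, r ^ 2 * ‖φ (r • (p : R3))‖ ^ 2 := by
      rw [← setIntegral_Ioi_ite]
      refine setIntegral_congr_fun measurableSet_Ioi fun r hr => ?_
      have hr' : (0 : ℝ) < r := hr
      simp only [N, ballInd, norm_smul_coe_S2 p hr'.le, smul_eq_mul]
      split_ifs <;> simp
    have h2 : ∫ r in Ioi (0 : ℝ), 2 * E (p, r) =
        2 * ∫ r in (0 : ℝ)..1, (1 - r ^ 2) / 6 * radialEnergy φ p r := by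
      rw [integral_const_mul, ← setIntegral_Ioi_ite]
      congr 1
      refine setIntegral_congr_fun measurableSet_Ioi fun r hr => ?_
      have hr' : (0 : ℝ) < r := hr
      simp only [E, hwt p r hr', wt]
      split_ifs <;> simp
    have h3 := ball_ray φ p
    rw [← h1, ← h2] at h3
    exact h3
  linarith

end BallInequality

end HomPot

namespace HomPot

section Dilation

open Filter Topology
open scoped InnerProductSpace

theorem re_inner_eq_integral (a b : L2R3) : (⟪a, b⟫_ℂ).re = ∫ x, inner ℝ (a x) (b x) := by
  rw [L2.inner_def, ← RCLike.re_eq_complex_re, ← integral_re (L2.integrable_inner _ _)]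
  refine integral_congr_ae (Eventually.of_forall fun x => ?_)
  simp only [real_inner_eq, RCLike.inner_apply, RCLike.re_eq_complex_re]

theorem integrable_real_inner (a b : L2R3) : Integrable fun x => inner ℝ (a x) (b x) := by
  refine (L2.integrable_inner (𝕜 := ℂ) a b).re.congr (Eventually.of_forall fun x => ?_)
  simp only [real_inner_eq, RCLike.inner_apply, RCLike.re_eq_complex_re]

theorem quasiMeasurePreserving_smul {s : ℝ} (hs : s ≠ 0) :
    Measure.QuasiMeasurePreserving (fun x : R3 => s • x) volume volume := by
  refine ⟨measurable_const_smul s, ?_⟩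
  rw [Measure.map_addHaar_smul _ hs]
  exact Measure.smul_absolutelyContinuous

theorem memLp_comp_smul {s : ℝ} (hs : s ≠ 0) (u : L2R3) :
    MemLp (fun x : R3 => u (s • x)) 2 volume := by
  refine MemLp.comp_of_map (g := u) (f := fun x : R3 => s • x) ?_
    (measurable_const_smul s).aemeasurable
  rw [Measure.map_addHaar_smul _ hs]
  exact (Lp.memLp u).smul_measure ENNReal.ofReal_ne_top

theorem abs_inv_pow_finrank_le {s : ℝ} (hs : 1 ≤ s) :
    |(s ^ Module.finrank ℝ R3)⁻¹| ≤ 1 := by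
  have h : 1 ≤ s ^ Module.finrank ℝ R3 := one_le_pow₀ hs
  rw [abs_of_nonneg (by positivity)]
  exact inv_le_one_of_one_le₀ h

theorem integral_comp_smul_le {s : ℝ} (hs : 1 ≤ s) {f : R3 → ℝ} (hf : ∀ x, 0 ≤ f x) :
    ∫ x, f (s • x) ≤ ∫ x, f x := by
  rw [Measure.integral_comp_smul, smul_eq_mul]
  exact mul_le_of_le_one_left (integral_nonneg hf) (abs_inv_pow_finrank_le hs)

/-- Dilations on `L²(ℝ³)`. -/
theorem exists_dilation {s : ℝ} (hs : 1 ≤ s) : ∃ D : L2R3 →L[ℂ] L2R3,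
    (∀ u, D u =ᵐ[volume] fun x => u (s • x)) ∧ ∀ u, ‖D u‖ ≤ ‖u‖ := by
  have hs0 : s ≠ 0 := (zero_lt_one.trans_le hs).ne'
  have hq := quasiMeasurePreserving_smul hs0
  let D₀ : L2R3 →ₗ[ℂ] L2R3 :=
    { toFun := fun u => (memLp_comp_smul hs0 u).toLp _
      map_add' := fun u v => by
        refine Lp.ext ?_
        filter_upwards [(memLp_comp_smul hs0 u).coeFn_toLp, (memLp_comp_smul hs0 v).coeFn_toLp,
          (memLp_comp_smul hs0 (u + v)).coeFn_toLp, hq.ae (Lp.coeFn_add u v),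
          Lp.coeFn_add ((memLp_comp_smul hs0 u).toLp _) ((memLp_comp_smul hs0 v).toLp _)]
          with x h1 h2 h3 h4 h5
        rw [h3, h4, h5, Pi.add_apply, Pi.add_apply, h1, h2]
      map_smul' := fun c u => by
        refine Lp.ext ?_
        filter_upwards [(memLp_comp_smul hs0 u).coeFn_toLp,
          (memLp_comp_smul hs0 (c • u)).coeFn_toLp, hq.ae (Lp.coeFn_smul c u),
          Lp.coeFn_smul c ((memLp_comp_smul hs0 u).toLp _)] with x h1 h2 h3 h4
        rw [RingHom.id_apply, h2, h3, h4, Pi.smul_apply, Pi.smul_apply, h1] }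
  have hae : ∀ u, D₀ u =ᵐ[volume] fun x => u (s • x) := fun u =>
    (memLp_comp_smul hs0 u).coeFn_toLp
  have hle : ∀ u, ‖D₀ u‖ ≤ ‖u‖ := by
    intro u
    rw [← sq_le_sq₀ (norm_nonneg _) (norm_nonneg _), norm_sq_eq_integral, norm_sq_eq_integral]
    refine le_trans (le_of_eq ?_)
      (integral_comp_smul_le hs (f := fun x => ‖u x‖ ^ 2) fun x => sq_nonneg _)
    refine integral_congr_ae ?_
    filter_upwards [hae u] with x hx
    rw [hx]
  exact ⟨D₀.mkContinuous 1 fun u => by simpa using hle u, hae, hle⟩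

theorem laplacian_comp_smul {f : R3 → ℂ} (hf : ContDiff ℝ 2 f) (s : ℝ) (x : R3) :
    Laplacian.laplacian (fun y => f (s • y)) x = (s : ℂ) ^ 2 * Laplacian.laplacian f (s • x) := by
  rw [InnerProductSpace.laplacian_eq_iteratedFDeriv_stdOrthonormalBasis,
    InnerProductSpace.laplacian_eq_iteratedFDeriv_stdOrthonormalBasis]
  have h : iteratedFDeriv ℝ 2 (fun y => f (s • y)) =
      fun x => s ^ 2 • iteratedFDeriv ℝ 2 f (s • x) :=
    iteratedFDeriv_comp_const_smul s hf
  simp only [h, Finset.mul_sum]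
  refine Finset.sum_congr rfl fun i _ => ?_
  simp

variable {s : ℝ} {D : L2R3 →L[ℂ] L2R3}

theorem HasLaplacian.dilate (hs : 1 ≤ s) (hD : ∀ u, D u =ᵐ[volume] fun x => u (s • x))
    {u w : L2R3} (h : HasLaplacian u w) : HasLaplacian (D u) ((s ^ 2 : ℂ) • D w) := by
  have hs0 : s ≠ 0 := (zero_lt_one.trans_le hs).ne'
  have hq := quasiMeasurePreserving_smul hs0
  obtain ⟨φ, h1, h2⟩ := h.exists_approx
  let e : R3 ≃L[ℝ] R3 := ContinuousLinearEquiv.smulLeft (Units.mk0 s hs0)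
  have he : ∀ x, e x = s • x := fun x => rfl
  let ψ : ℕ → 𝓢(R3, ℂ) := fun n => SchwartzMap.compCLMOfContinuousLinearEquiv ℂ e (φ n)
  have hψ : ∀ n x, ψ n x = φ n (s • x) := fun n x => rfl
  have e1 : ∀ n, (ψ n).toLp 2 volume = D ((φ n).toLp 2 volume) := by
    intro n
    refine Lp.ext ?_
    filter_upwards [SchwartzMap.coeFn_toLp (ψ n) 2 (volume : Measure R3),
      hD ((φ n).toLp 2 volume), hq.ae (SchwartzMap.coeFn_toLp (φ n) 2 (volume : Measure R3))]
      with x k1 k2 k3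
    rw [k1, k2, k3, hψ]
  have e2 : ∀ n, (-(Laplacian.laplacian (ψ n))).toLp 2 volume =
      (s ^ 2 : ℂ) • D ((-(Laplacian.laplacian (φ n))).toLp 2 volume) := by
    intro n
    refine Lp.ext ?_
    filter_upwards [SchwartzMap.coeFn_toLp (-(Laplacian.laplacian (ψ n))) 2 (volume : Measure R3),
      hD ((-(Laplacian.laplacian (φ n))).toLp 2 volume),
      hq.ae (SchwartzMap.coeFn_toLp (-(Laplacian.laplacian (φ n))) 2 (volume : Measure R3)),
      Lp.coeFn_smul (s ^ 2 : ℂ) (D ((-(Laplacian.laplacian (φ n))).toLp 2 volume))]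
      with x k1 k2 k3 k4
    rw [k1, k4, Pi.smul_apply, k2, k3, neg_apply, neg_apply, SchwartzMap.laplacian_apply,
      SchwartzMap.laplacian_apply, smul_eq_mul, mul_neg]
    exact congrArg Neg.neg (laplacian_comp_smul ((φ n).smooth 2) s x)
  have h3 : ∀ n, D ((φ n).toLp 2 volume) = freeRes
      ((s ^ 2 : ℂ) • D ((-(Laplacian.laplacian (φ n))).toLp 2 volume) +
        (specGap : ℂ) • D ((φ n).toLp 2 volume)) := by
    intro n
    have := hasLaplacian_iff.1 (hasLaplacian_toLp (ψ n))
    rwa [e1, e2] at this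
  rw [hasLaplacian_iff]
  have l1 := (D.continuous.tendsto _).comp h1
  have l2 := (D.continuous.tendsto _).comp h2
  refine tendsto_nhds_unique l1 ?_
  refine ((freeRes.continuous.tendsto _).comp
    ((l2.const_smul (s ^ 2 : ℂ)).add (l1.const_smul (specGap : ℂ)))).congr fun n => ?_
  exact (h3 n).symm

theorem HasLaplacian.inner_comm {u w u' w' : L2R3} (h : HasLaplacian u w)
    (h' : HasLaplacian u' w') : ⟪w, u'⟫_ℂ = ⟪u, w'⟫_ℂ := by
  have h1 := hasLaplacian_iff.1 h
  have h2 := hasLaplacian_iff.1 h'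
  have h3 : ⟪u, w' + (specGap : ℂ) • u'⟫_ℂ = ⟪w + (specGap : ℂ) • u, u'⟫_ℂ := by
    conv_lhs => rw [h1]
    conv_rhs => rw [h2]
    exact freeRes_symmetric _ _
  rw [inner_add_right, inner_add_left, inner_smul_right, inner_smul_left, Complex.conj_ofReal]
    at h3
  linear_combination -h3

/-- The virial identity in finite form. -/
theorem IsEigenfunction.dilation_identity {V : R3 → ℝ} (hV : Measurable V) {C : ℝ}
    (hC : ∀ x, |V x| ≤ C) {lam : ℝ} {u : L2R3} (h : IsEigenfunction V lam u) (hs : 1 ≤ s) :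
    (s ^ 2 - 1) * lam * ∫ x, inner ℝ (u x) (u (s • x)) =
      ∫ x, (s ^ 2 * V (s • x) - V x) * inner ℝ (u x) (u (s • x)) := by
  have hs0 : s ≠ 0 := (zero_lt_one.trans_le hs).ne'
  have hq := quasiMeasurePreserving_smul hs0
  obtain ⟨-, -, w, hL, hae⟩ := h
  have hL' : HasLaplacian u w := hL
  obtain ⟨D, hD, -⟩ := exists_dilation hs
  have h1 := hL'.inner_comm (hL'.dilate hs hD)
  have h2 : (⟪w, D u⟫_ℂ).re = s ^ 2 * (⟪u, D w⟫_ℂ).re := by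
    rw [h1, inner_smul_right, ← Complex.ofReal_pow, Complex.re_ofReal_mul]
  have hi : Integrable fun x => inner ℝ (u x) (u (s • x)) := by
    refine (integrable_real_inner u (D u)).congr ?_
    filter_upwards [hD u] with x hx
    rw [hx]
  have hVs : Measurable fun x : R3 => V (s • x) := hV.comp (measurable_const_smul s)
  have i1 : Integrable fun x => V x * inner ℝ (u x) (u (s • x)) :=
    hi.bdd_mul (c := C) hV.aestronglyMeasurable (Eventually.of_forall hC)
  have i2 : Integrable fun x => V (s • x) * inner ℝ (u x) (u (s • x)) :=
    hi.bdd_mul (c := C) hVs.aestronglyMeasurable (Eventually.of_forall fun x => hC _)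
  have hmul : ∀ (r : ℝ) (z : ℂ), (lam : ℂ) * z - (r : ℂ) * z = (lam - r) • z := by
    intro r z
    rw [Complex.real_smul]
    push_cast
    ring
  have e1 : (⟪w, D u⟫_ℂ).re = lam * (∫ x, inner ℝ (u x) (u (s • x))) -
      ∫ x, V x * inner ℝ (u x) (u (s • x)) := by
    rw [re_inner_eq_integral, ← integral_const_mul, ← integral_sub (hi.const_mul _) i1]
    refine integral_congr_ae ?_
    filter_upwards [hD u, hae] with x k1 k2
    rw [k1, eq_sub_of_add_eq k2, hmul, inner_smul_left]
    simp only [conj_trivial]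
    ring
  have e2 : (⟪u, D w⟫_ℂ).re = lam * (∫ x, inner ℝ (u x) (u (s • x))) -
      ∫ x, V (s • x) * inner ℝ (u x) (u (s • x)) := by
    rw [re_inner_eq_integral, ← integral_const_mul, ← integral_sub (hi.const_mul _) i2]
    refine integral_congr_ae ?_
    filter_upwards [hD w, hq.ae hae] with x k1 k2
    rw [k1, eq_sub_of_add_eq k2, hmul, inner_smul_right]
    ring
  have e3 : ∫ x, (s ^ 2 * V (s • x) - V x) * inner ℝ (u x) (u (s • x)) =
      s ^ 2 * (∫ x, V (s • x) * inner ℝ (u x) (u (s • x))) -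
        ∫ x, V x * inner ℝ (u x) (u (s • x)) := by
    rw [← integral_const_mul, ← integral_sub (i2.const_mul _) i1]
    exact integral_congr_ae (Eventually.of_forall fun x => by ring)
  rw [e3]
  rw [e1, e2] at h2
  linear_combination -h2

theorem tendsto_integral_inner_dilate (u : L2R3) :
    Tendsto (fun s : ℝ => ∫ x, inner ℝ (u x) (u (s • x))) (𝓝[>] 1) (𝓝 (‖u‖ ^ 2)) := by
  have hdense : ∀ δ > 0, ∃ φ : 𝓢(R3, ℂ), ‖u - φ.toLp 2 volume‖ < δ := by
    intro δ hδ
    have h := SchwartzMap.denseRange_toLpCLM (E := R3) (F := ℂ) (μ := volume) (p := 2)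
      ENNReal.ofNat_ne_top
    obtain ⟨φ, hφ⟩ := h.exists_dist_lt u hδ
    exact ⟨φ, by rwa [dist_eq_norm] at hφ⟩
  have hφlim : ∀ φ : 𝓢(R3, ℂ), Tendsto (fun s : ℝ => ∫ x, inner ℝ (φ x) (φ (s • x)))
      (𝓝[>] 1) (𝓝 (∫ x, inner ℝ (φ x) (φ x))) := by
    intro φ
    obtain ⟨M, hM⟩ : ∃ M, ∀ x, ‖φ x‖ ≤ M := by
      obtain ⟨M, -, hM⟩ := φ.decay 0 0
      exact ⟨M, fun x => by simpa using hM x⟩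
    refine tendsto_integral_filter_of_dominated_convergence (fun x => ‖φ x‖ * M) ?_ ?_ ?_ ?_
    · refine Eventually.of_forall fun s => Continuous.aestronglyMeasurable ?_
      exact φ.continuous.inner (φ.continuous.comp (continuous_const_smul s))
    · refine Eventually.of_forall fun s => Eventually.of_forall fun x => ?_
      refine (abs_real_inner_le_norm _ _).trans ?_
      exact mul_le_mul_of_nonneg_left (hM _) (norm_nonneg _)
    · exact φ.integrable.norm.mul_const M
    · refine Eventually.of_forall fun x => tendsto_nhdsWithin_of_tendsto_nhds ?_
      have hc : Continuous fun s : ℝ => inner ℝ (φ x) (φ (s • x)) :=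
        continuous_const.inner (φ.continuous.comp (by fun_prop))
      simpa using hc.tendsto 1
  have hsq : ∀ v : L2R3, ‖v‖ ^ 2 = (⟪v, v⟫_ℂ).re := fun v => by
    rw [inner_self_ofReal, Complex.ofReal_re]
  rw [Metric.tendsto_nhds]
  intro ε hε
  obtain ⟨δ, hδ, hδε⟩ : ∃ δ : ℝ, 0 < δ ∧ 2 * (δ * ‖u‖ + (‖u‖ + δ) * δ) < ε / 2 := by
    have hc : Continuous fun δ : ℝ => 2 * (δ * ‖u‖ + (‖u‖ + δ) * δ) := by fun_prop
    have h0 := hc.tendsto 0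
    have h1 : ∀ᶠ δ : ℝ in 𝓝[>] 0, 2 * (δ * ‖u‖ + (‖u‖ + δ) * δ) < ε / 2 :=
      nhdsWithin_le_nhds (h0.eventually_lt_const (by simpa using hε))
    obtain ⟨δ, h2, h3⟩ := (h1.and self_mem_nhdsWithin).exists
    exact ⟨δ, h3, h2⟩
  obtain ⟨φ, hφ⟩ := hdense δ hδ
  set f : L2R3 := φ.toLp 2 volume
  have hf : ‖f‖ ≤ ‖u‖ + δ := by
    have := norm_sub_le u (u - f)
    rw [sub_sub_cancel] at this
    linarith
  have key : ∀ A : L2R3 →L[ℂ] L2R3, (∀ v, ‖A v‖ ≤ ‖v‖) →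
      |(⟪u, A u⟫_ℂ).re - (⟪f, A f⟫_ℂ).re| ≤ δ * ‖u‖ + (‖u‖ + δ) * δ := by
    intro A hA
    have h1 : ⟪u, A u⟫_ℂ - ⟪f, A f⟫_ℂ = ⟪u - f, A u⟫_ℂ + ⟪f, A (u - f)⟫_ℂ := by
      rw [inner_sub_left, map_sub, inner_sub_right]
      ring
    rw [← Complex.sub_re, h1]
    refine (Complex.abs_re_le_norm _).trans ((norm_add_le _ _).trans (add_le_add ?_ ?_))
    · exact (norm_inner_le_norm _ _).trans
        (mul_le_mul hφ.le (hA u) (norm_nonneg _) hδ.le)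
    · exact (norm_inner_le_norm _ _).trans (mul_le_mul hf ((hA _).trans hφ.le) (norm_nonneg _)
        (by positivity))
  have hlim := (Metric.tendsto_nhds.1 (hφlim φ)) (ε / 2) (by positivity)
  filter_upwards [hlim, self_mem_nhdsWithin] with s h1 hs
  have hs1 : (1 : ℝ) ≤ s := le_of_lt hs
  have hq := quasiMeasurePreserving_smul (zero_lt_one.trans_le hs1).ne'
  obtain ⟨D, hD, hDle⟩ := exists_dilation hs1
  have k1 := key D hDle
  have k2 := key (ContinuousLinearMap.id ℂ L2R3) fun v => le_rfl
  have e1 : (⟪u, D u⟫_ℂ).re = ∫ x, inner ℝ (u x) (u (s • x)) := by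
    rw [re_inner_eq_integral]
    refine integral_congr_ae ?_
    filter_upwards [hD u] with x hx
    rw [hx]
  have e2 : (⟪f, D f⟫_ℂ).re = ∫ x, inner ℝ (φ x) (φ (s • x)) := by
    rw [re_inner_eq_integral]
    refine integral_congr_ae ?_
    filter_upwards [hD f, SchwartzMap.coeFn_toLp φ 2 (volume : Measure R3),
      hq.ae (SchwartzMap.coeFn_toLp φ 2 (volume : Measure R3))] with x k1 k2 k3
    rw [k1, k2, k3]
  rw [ContinuousLinearMap.id_apply, ContinuousLinearMap.id_apply, ← hsq, re_inner_toLp] at k2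
  rw [e1, e2] at k1
  rw [Real.dist_eq] at h1 ⊢
  rw [_root_.abs_le] at k1 k2
  rw [abs_lt] at h1 ⊢
  constructor <;> linarith [k1.1, k1.2, k2.1, k2.2, h1.1, h1.2]

end Dilation

end HomPot

namespace HomPot

section Virial

open Filter Topology
open scoped InnerProductSpace

variable {Q : S2 → ℝ}

theorem eventually_shell_le {g : R3 → ℂ} (hg : Continuous g) {η : ℝ} (hη : 0 < η) :
    ∀ᶠ s : ℝ in 𝓝[>] 1, ∀ (r q : ℝ) (p : S2), s⁻¹ ≤ r → r ≤ 1 → |q| ≤ 1 / 3 →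
      (q - r ^ 2) * inner ℝ (g (r • (p : R3))) (g (s • r • (p : R3))) ≤
        -(2 / 3) * ‖g p‖ ^ 2 + η := by
  let K : Set (S2 × ℝ) := univ ×ˢ Icc (-(1 / 3)) (1 / 3)
  have hK : IsCompact K := isCompact_univ.prod isCompact_Icc
  let f : (ℝ × ℝ) × (S2 × ℝ) → ℝ := fun z => (z.2.2 - z.1.1 ^ 2) *
    inner ℝ (g (z.1.1 • (z.2.1 : R3))) (g (z.1.2 • z.1.1 • (z.2.1 : R3))) +
      (2 / 3) * ‖g z.2.1‖ ^ 2
  have hf : Continuous f := by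
    have h1 : Continuous fun z : (ℝ × ℝ) × (S2 × ℝ) => g (z.1.1 • (z.2.1 : R3)) :=
      hg.comp (by fun_prop)
    have h2 : Continuous fun z : (ℝ × ℝ) × (S2 × ℝ) => g (z.1.2 • z.1.1 • (z.2.1 : R3)) :=
      hg.comp (by fun_prop)
    have h3 : Continuous fun z : (ℝ × ℝ) × (S2 × ℝ) => g (z.2.1 : R3) :=
      hg.comp (by fun_prop)
    fun_prop
  have h1 : ∀ᶠ x : ℝ × ℝ in 𝓝 (1, 1), ∀ y ∈ K, f (x, y) < η := by
    refine hK.eventually_forall_of_forall_eventually fun y hy => ?_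
    refine (hf.tendsto ((1, 1), y)).eventually_lt_const ?_
    simp only [f, one_smul, one_pow, real_inner_self_eq_norm_sq]
    have h2 : y.2 ≤ 1 / 3 := hy.2.2
    nlinarith [sq_nonneg ‖g y.1‖]
  obtain ⟨δ, hδ, hb⟩ := Metric.eventually_nhds_iff.1 h1
  have h2 : ∀ᶠ s : ℝ in 𝓝[>] 1, s < 1 + δ :=
    nhdsWithin_le_nhds (eventually_lt_nhds (by linarith))
  filter_upwards [h2, self_mem_nhdsWithin] with s hs1 hs2 r q p hr1 hr2 hq
  have hs2 : 1 < s := hs2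
  have hs3 : 1 - s⁻¹ ≤ s - 1 := by
    have h3 : s * s⁻¹ = 1 := mul_inv_cancel₀ (by linarith)
    have h4 : 0 < s⁻¹ := inv_pos.2 (by linarith)
    nlinarith
  have h5 := hb (y := (r, s)) (by
    rw [Prod.dist_eq, max_lt_iff, Real.dist_eq, Real.dist_eq, abs_lt, abs_lt]
    exact ⟨⟨by linarith, by linarith⟩, by linarith, by linarith⟩) (p, q)
      ⟨mem_univ _, _root_.abs_le.1 hq⟩
  simp only [f] at h5
  linarith

/-- The change of the potential under a dilation, outside the region where it is constant. -/
noncomputable def shellPart (Q : S2 → ℝ) (s : ℝ) (x : R3) : ℝ :=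
  s ^ 2 * potential Q (s • x) - potential Q x - (s ^ 2 - 1) * ballInd (s • x)

theorem shellPart_smul {s : ℝ} (hs : 1 < s) (p : S2) {r : ℝ} (hr : 0 < r) :
    r ^ 2 * shellPart Q s (r • (p : R3)) =
      if r ∈ Ico s⁻¹ 1 then Q p - r ^ 2 else 0 := by
  have hs0 : 0 < s := by linarith
  have hn : ‖(s * r) • (p : R3)‖ = s * r := norm_smul_coe_S2 p (by positivity)
  have hn' : ‖r • (p : R3)‖ = r := norm_smul_coe_S2 p hr.le
  rw [shellPart, smul_smul]
  rcases lt_or_ge r s⁻¹ with h1 | h1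
  · have h2 : s * r < 1 := by
      rwa [← lt_inv_mul_iff₀ hs0, mul_one]
    have h3 : r < 1 := h1.trans_le (inv_le_one_of_one_le₀ hs.le)
    rw [if_neg (fun h => absurd h.1 (not_le.2 h1)), potential_of_lt (by rwa [hn]),
      potential_of_lt (by rwa [hn']), ballInd, if_pos (by rwa [hn])]
    ring
  · have h2 : 1 ≤ s * r := by
      rwa [← inv_mul_le_iff₀ hs0, mul_one]
    rw [potential_smul h2, ballInd, if_neg (by rw [hn]; exact not_lt.2 h2)]
    rcases lt_or_ge r 1 with h3 | h3
    · rw [if_pos ⟨h1, h3⟩, potential_of_lt (by rwa [hn'])]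
      field_simp
      ring
    · rw [if_neg (fun h => absurd h.2 (not_lt.2 h3)), potential_smul h3]
      field_simp
      ring

theorem integral_shell_le (hQ : Measurable Q) (hb : ∀ p, |Q p| ≤ 1 / 3) {g : R3 → ℂ}
    (hg : Continuous g) {s η : ℝ} (hs : 1 < s)
    (hi : Integrable fun x => inner ℝ (g x) (g (s • x)))
    (h : ∀ (r q : ℝ) (p : S2), s⁻¹ ≤ r → r ≤ 1 → |q| ≤ 1 / 3 →
      (q - r ^ 2) * inner ℝ (g (r • (p : R3))) (g (s • r • (p : R3))) ≤
        -(2 / 3) * ‖g p‖ ^ 2 + η) :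
    ∫ x, shellPart Q s x * inner ℝ (g x) (g (s • x)) ≤
      (1 - s⁻¹) * (-(2 / 3) * (∫ p : S2, ‖g p‖ ^ 2 ∂surface) + η * surface.real univ) := by
  have hs0 : 0 < s := by linarith
  have hm : Measurable (shellPart Q s) := by
    have h1 := (measurable_potential hQ).comp (measurable_const_smul (α := R3) s)
    have h2 := measurable_ballInd.comp (measurable_const_smul (α := R3) s)
    exact ((h1.const_mul _).sub (measurable_potential hQ)).sub (h2.const_mul _)
  have hbound : ∀ x, ‖shellPart Q s x‖ ≤ s ^ 2 + 1 + |s ^ 2 - 1| := by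
    intro x
    rw [Real.norm_eq_abs, shellPart]
    refine (abs_sub _ _).trans (add_le_add ((abs_sub _ _).trans (add_le_add ?_ ?_)) ?_)
    · rw [abs_mul, abs_of_nonneg (sq_nonneg s)]
      exact mul_le_of_le_one_right (sq_nonneg s) (abs_potential_le hb _)
    · exact abs_potential_le hb _
    · rw [abs_mul]
      exact mul_le_of_le_one_right (abs_nonneg _) (abs_ballInd_le _)
  have i1 : Integrable fun x => shellPart Q s x * inner ℝ (g x) (g (s • x)) :=
    hi.bdd_mul hm.aestronglyMeasurable (Eventually.of_forall hbound)
  have hU : Integrable (fun p : S2 => -(2 / 3) * ‖g p‖ ^ 2 + η) surface :=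
    Continuous.integrable_of_hasCompactSupport (by fun_prop) (HasCompactSupport.of_compactSpace _)
  have hN : Integrable (fun p : S2 => ‖g p‖ ^ 2) surface :=
    Continuous.integrable_of_hasCompactSupport (by fun_prop) (HasCompactSupport.of_compactSpace _)
  have hsub : Ico s⁻¹ 1 ⊆ Ioi 0 := fun r hr => (inv_pos.2 hs0).trans_le hr.1
  have hK : Integrable ((Ico s⁻¹ 1).indicator (1 : ℝ → ℝ)) (volume.restrict (Ioi 0)) :=
    ((integrable_indicator_iff measurableSet_Ico).2
      (integrableOn_const (by simp))).restrict
  have hKi : ∫ r in Ioi (0 : ℝ), (Ico s⁻¹ 1).indicator (1 : ℝ → ℝ) r = 1 - s⁻¹ := by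
    rw [setIntegral_indicator measurableSet_Ico, inter_eq_self_of_subset_right hsub]
    simp [inv_le_one_of_one_le₀ hs.le]
  rw [integral_polar]
  calc _ ≤ ∫ z : S2 × ℝ, (-(2 / 3) * ‖g z.1‖ ^ 2 + η) *
        (Ico s⁻¹ 1).indicator (1 : ℝ → ℝ) z.2 ∂polarMeasure := by
        refine integral_mono_ae (integrable_polar.1 i1) (hU.mul_prod hK) ?_
        filter_upwards [ae_polar_pos] with z hz
        simp only [smul_eq_mul]
        rw [← mul_assoc, shellPart_smul hs z.1 hz]
        by_cases hr : z.2 ∈ Ico s⁻¹ 1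
        · rw [if_pos hr, indicator_of_mem hr, Pi.one_apply, mul_one]
          exact h z.2 _ z.1 hr.1 hr.2.le (hb _)
        · rw [if_neg hr, indicator_of_notMem hr, mul_zero, zero_mul]
    _ = _ := by
        rw [polarMeasure, integral_prod_mul (fun p : S2 => -(2 / 3) * ‖g p‖ ^ 2 + η), hKi,
          integral_add (hN.const_mul _) (integrable_const _), integral_const_mul, integral_const,
          smul_eq_mul]
        ring

theorem integral_ballInd_dilate_le {s : ℝ} (hs : 1 ≤ s) (u : L2R3) :
    ∫ x, ballInd (s • x) * inner ℝ (u x) (u (s • x)) ≤ ∫ x, ballInd x * ‖u x‖ ^ 2 := by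
  have hs0 : s ≠ 0 := (zero_lt_one.trans_le hs).ne'
  have hb0 : ∀ x, 0 ≤ ballInd x := fun x => by
    unfold ballInd
    split_ifs <;> norm_num
  have hms : Measurable fun x : R3 => ballInd (s • x) :=
    measurable_ballInd.comp (measurable_const_smul s)
  have i1 := integrable_mul_norm_sq hms (fun x => abs_ballInd_le (s • x)) u
  have i0 := integrable_mul_norm_sq measurable_ballInd abs_ballInd_le u
  have i2 : Integrable fun x => ballInd (s • x) * ‖u (s • x)‖ ^ 2 :=
    (integrable_comp_smul_iff volume (fun x => ballInd x * ‖u x‖ ^ 2) hs0).2 i0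
  have hi : Integrable fun x => ballInd (s • x) * inner ℝ (u x) (u (s • x)) := by
    obtain ⟨D, hD, -⟩ := exists_dilation hs
    refine Integrable.bdd_mul (c := 1) ?_ hms.aestronglyMeasurable
      (Eventually.of_forall fun x => abs_ballInd_le (s • x))
    refine (integrable_real_inner u (D u)).congr ?_
    filter_upwards [hD u] with x hx
    rw [hx]
  have h1 : ∫ x, ballInd (s • x) * ‖u (s • x)‖ ^ 2 ≤ ∫ x, ballInd x * ‖u x‖ ^ 2 :=
    integral_comp_smul_le hs (f := fun x => ballInd x * ‖u x‖ ^ 2)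
      fun x => mul_nonneg (hb0 x) (sq_nonneg _)
  have h2 : ∫ x, ballInd (s • x) * ‖u x‖ ^ 2 ≤ ∫ x, ballInd x * ‖u x‖ ^ 2 := by
    refine integral_mono i1 i0 fun x => mul_le_mul_of_nonneg_right ?_ (sq_nonneg _)
    unfold ballInd
    split_ifs with h3 h4
    · exact le_rfl
    · rw [norm_smul, Real.norm_of_nonneg (by linarith)] at h3
      nlinarith [norm_nonneg x]
    · norm_num
    · exact le_rfl
  have h3 : ∫ x, ballInd (s • x) * inner ℝ (u x) (u (s • x)) ≤
      ∫ x, (1 / 2) * (ballInd (s • x) * ‖u x‖ ^ 2 + ballInd (s • x) * ‖u (s • x)‖ ^ 2) := by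
    refine integral_mono hi ((i1.add i2).const_mul _) fun x => ?_
    have h4 := real_inner_le_norm (u x) (u (s • x))
    have h5 : inner ℝ (u x) (u (s • x)) ≤ (‖u x‖ ^ 2 + ‖u (s • x)‖ ^ 2) / 2 := by
      nlinarith [sq_nonneg (‖u x‖ - ‖u (s • x)‖)]
    have h6 := mul_le_mul_of_nonneg_left h5 (hb0 (s • x))
    simp only
    linarith
  rw [integral_const_mul, integral_add i1 i2] at h3
  linarith

theorem IsEigenfunction.virial_le (hQ : Measurable Q) (hb : ∀ p, |Q p| ≤ 1 / 3) {lam : ℝ}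
    {u : L2R3} (h : IsEigenfunction (potential Q) lam u) {g : R3 → ℂ} (hg : Continuous g)
    (hug : u =ᵐ[volume] g) :
    2 * (lam * ‖u‖ ^ 2) ≤ 2 * (∫ x, ballInd x * ‖u x‖ ^ 2) -
      (2 / 3) * ∫ p : S2, ‖g p‖ ^ 2 ∂surface := by
  set A := ∫ p : S2, ‖g p‖ ^ 2 ∂surface
  set B := ∫ x, ballInd x * ‖u x‖ ^ 2
  set σ := surface.real univ
  have key : ∀ η > 0, 2 * (lam * ‖u‖ ^ 2) ≤ 2 * B - (2 / 3) * A + η * σ := by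
    intro η hη
    have h1 : Tendsto (fun s : ℝ => (s + 1) * (lam * ∫ x, inner ℝ (u x) (u (s • x)))) (𝓝[>] 1)
        (𝓝 ((1 + 1) * (lam * ‖u‖ ^ 2))) :=
      (((continuous_add_const (1 : ℝ)).tendsto 1).mono_left nhdsWithin_le_nhds).mul
        ((tendsto_integral_inner_dilate u).const_mul lam)
    have h2 : Tendsto (fun s : ℝ => (s + 1) * B + s⁻¹ * (-(2 / 3) * A + η * σ)) (𝓝[>] 1)
        (𝓝 ((1 + 1) * B + 1⁻¹ * (-(2 / 3) * A + η * σ))) := by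
      refine Tendsto.mono_left ?_ nhdsWithin_le_nhds
      exact (((continuous_add_const (1 : ℝ)).tendsto 1).mul_const B).add
        ((tendsto_inv₀ one_ne_zero).mul_const _)
    have h3 := le_of_tendsto_of_tendsto h1 h2 ?_
    · rw [inv_one] at h3
      linarith
    filter_upwards [eventually_shell_le hg hη, self_mem_nhdsWithin] with s hs1 hs2
    have hs : 1 < s := hs2
    have hs0 : s ≠ 0 := by linarith
    have hq := quasiMeasurePreserving_smul hs0
    have hid := h.dilation_identity (measurable_potential hQ) (abs_potential_le hb) hs.le
    have hI : Integrable fun x => inner ℝ (u x) (u (s • x)) := by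
      obtain ⟨D, hD, -⟩ := exists_dilation hs.le
      refine (integrable_real_inner u (D u)).congr ?_
      filter_upwards [hD u] with x hx
      rw [hx]
    have hug2 : (fun x => inner ℝ (u x) (u (s • x))) =ᵐ[volume]
        fun x => inner ℝ (g x) (g (s • x)) := by
      filter_upwards [hug, hq.ae hug] with x k1 k2
      rw [k1, k2]
    have hbd : ∀ x, ‖s ^ 2 * potential Q (s • x) - potential Q x‖ ≤ s ^ 2 + 1 := by
      intro x
      refine (abs_sub _ _).trans (add_le_add ?_ (abs_potential_le hb _))
      rw [abs_mul, abs_of_nonneg (sq_nonneg s)]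
      exact mul_le_of_le_one_right (sq_nonneg s) (abs_potential_le hb _)
    have i1 : Integrable fun x => (s ^ 2 * potential Q (s • x) - potential Q x) *
        inner ℝ (u x) (u (s • x)) := by
      refine hI.bdd_mul ?_ (Eventually.of_forall hbd)
      have h1 := (measurable_potential hQ).comp (measurable_const_smul (α := R3) s)
      exact ((h1.const_mul _).sub (measurable_potential hQ)).aestronglyMeasurable
    have i2 : Integrable fun x => ballInd (s • x) * inner ℝ (u x) (u (s • x)) := by
      refine hI.bdd_mul (c := 1) ?_ (Eventually.of_forall fun x => abs_ballInd_le (s • x))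
      exact (measurable_ballInd.comp (measurable_const_smul (α := R3) s)).aestronglyMeasurable
    have hsplit : ∫ x, (s ^ 2 * potential Q (s • x) - potential Q x) *
        inner ℝ (u x) (u (s • x)) = (s ^ 2 - 1) * (∫ x, ballInd (s • x) *
          inner ℝ (u x) (u (s • x))) + ∫ x, shellPart Q s x * inner ℝ (g x) (g (s • x)) := by
      have h4 : ∫ x, shellPart Q s x * inner ℝ (g x) (g (s • x)) =
          (∫ x, (s ^ 2 * potential Q (s • x) - potential Q x) * inner ℝ (u x) (u (s • x))) -
            (s ^ 2 - 1) * ∫ x, ballInd (s • x) * inner ℝ (u x) (u (s • x)) := by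
        rw [← integral_const_mul, ← integral_sub i1 (i2.const_mul _)]
        refine integral_congr_ae ?_
        filter_upwards [hug2] with x hx
        rw [hx, shellPart]
        ring
      rw [h4]
      ring
    rw [hsplit] at hid
    have h5 := integral_shell_le hQ hb hg hs (hI.congr hug2) hs1
    have h6 := mul_le_mul_of_nonneg_left (integral_ballInd_dilate_le hs.le u)
      (by nlinarith : 0 ≤ s ^ 2 - 1)
    have h7 : (s - 1) * ((s + 1) * (lam * ∫ x, inner ℝ (u x) (u (s • x)))) ≤
        (s - 1) * ((s + 1) * B + s⁻¹ * (-(2 / 3) * A + η * σ)) := by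
      have h8 : 1 - s⁻¹ = (s - 1) * s⁻¹ := by field_simp
      rw [h8] at h5
      linarith
    exact le_of_mul_le_mul_left h7 (by linarith)
  have hσ : 0 < σ := by
    simp only [σ, surface_real_univ]
    positivity
  refine le_of_forall_pos_le_add fun ε hε => ?_
  have h1 := key (ε / σ) (by positivity)
  rw [div_mul_cancel₀ _ hσ.ne'] at h1
  linarith

theorem integral_ball_le_of_eigenfunction {lam : ℝ} (hlam : lam ≤ 1) {u w : L2R3} {φ : ℕ → 𝓢(R3, ℂ)} {g : R3 → ℂ}
    (hae : ∀ᵐ x, w x + (potential Q x : ℂ) * u x = (lam : ℂ) * u x)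
    (h1 : Tendsto (fun n => (φ n).toLp 2 volume) atTop (𝓝 u))
    (h2 : Tendsto (fun n => (-(Laplacian.laplacian (φ n))).toLp 2 volume) atTop (𝓝 w))
    (h3 : TendstoUniformly (fun n x => φ n x) g atTop) (hg : Continuous g) :
    ∫ x, ballInd x * ‖u x‖ ^ 2 ≤ (1 / 3) * ∫ p : S2, ‖g p‖ ^ 2 ∂surface := by
  set J := mulOp volume measurable_ballInd abs_ballInd_le
  set W := mulOp volume measurable_ballWeight abs_ballWeight_le
  have l1 := (Complex.continuous_re.tendsto _).comp
    (h1.inner (𝕜 := ℂ) ((J.continuous.tendsto _).comp h1))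
  have l2 := (Complex.continuous_re.tendsto _).comp
    (h1.inner (𝕜 := ℂ) ((W.continuous.tendsto _).comp h2))
  have l3 : Tendsto (fun n => ∫ p : S2, ‖φ n p‖ ^ 2 ∂surface) atTop
      (𝓝 (∫ p : S2, ‖g p‖ ^ 2 ∂surface)) := by
    obtain ⟨M, hM⟩ := (isCompact_sphere (0 : R3) 1).exists_bound_of_continuousOn hg.continuousOn
    refine tendsto_integral_filter_of_dominated_convergence (fun _ => (M + 1) ^ 2) ?_ ?_
      (integrable_const _) ?_
    · exact Eventually.of_forall fun n => (((φ n).continuous.comp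
        continuous_subtype_val).norm.pow 2).aestronglyMeasurable
    · filter_upwards [Metric.tendstoUniformly_iff.1 h3 1 one_pos] with n hn
      refine Eventually.of_forall fun p => ?_
      rw [Real.norm_of_nonneg (sq_nonneg _)]
      refine pow_le_pow_left₀ (norm_nonneg _) ?_ 2
      have k1 := hn p
      rw [dist_eq_norm] at k1
      have k2 := norm_sub_norm_le (φ n p) (g p)
      rw [norm_sub_rev] at k2
      linarith [hM p p.2]
    · exact Eventually.of_forall fun p => ((h3.tendsto_at p).norm.pow 2)
  have hn : ∀ n, (⟪(φ n).toLp 2 volume, J ((φ n).toLp 2 volume)⟫_ℂ).re ≤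
      (1 / 3) * (∫ p : S2, ‖φ n p‖ ^ 2 ∂surface) + 2 * (⟪(φ n).toLp 2 volume,
        W ((-(Laplacian.laplacian (φ n))).toLp 2 volume)⟫_ℂ).re := by
    intro n
    refine le_trans (le_of_eq ?_) ((ball_le (φ n)).trans (le_of_eq ?_))
    · rw [re_inner_mulOp]
      refine integral_congr_ae ?_
      filter_upwards [SchwartzMap.coeFn_toLp (φ n) 2 (volume : Measure R3)] with x hx
      rw [hx]
    · rw [re_inner_eq_integral]
      congr 2
      refine integral_congr_ae ?_
      filter_upwards [SchwartzMap.coeFn_toLp (φ n) 2 (volume : Measure R3),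
        SchwartzMap.coeFn_toLp (-(Laplacian.laplacian (φ n))) 2 (volume : Measure R3),
        mulOp_ae measurable_ballWeight abs_ballWeight_le
          ((-(Laplacian.laplacian (φ n))).toLp 2 volume)] with x k1 k2 k3
      rw [k1, k3, k2, ← Complex.real_smul, inner_smul_right]
  have hlim := le_of_tendsto_of_tendsto' l1 ((l3.const_mul (1 / 3)).add (l2.const_mul 2)) hn
  rw [re_inner_mulOp] at hlim
  have hneg : (⟪u, W w⟫_ℂ).re ≤ 0 := by
    rw [re_inner_eq_integral]
    refine integral_nonpos_of_ae ?_
    filter_upwards [mulOp_ae measurable_ballWeight abs_ballWeight_le w, hae] with x k1 k2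
    rw [k1, ← Complex.real_smul, inner_smul_right, Pi.zero_apply]
    rcases lt_or_ge ‖x‖ 1 with hx | hx
    · refine mul_nonpos_of_nonneg_of_nonpos (ballWeight_nonneg x) ?_
      rw [potential_of_lt hx] at k2
      have k3 : w x = (lam - 1) • u x := by
        rw [eq_sub_of_add_eq k2, Complex.real_smul]
        push_cast
        ring
      rw [k3, inner_smul_right, real_inner_self_eq_norm_sq]
      exact mul_nonpos_of_nonpos_of_nonneg (by linarith) (sq_nonneg _)
    · rw [ballWeight, if_neg (not_lt.2 hx), zero_mul]
  linarith

/-- No eigenvalues at all when the angular part of the potential is odd. -/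
theorem not_isEigenfunction_of_odd (hQ : Measurable Q) (hb : ∀ p, |Q p| ≤ 1 / 3)
    (hodd : ∀ p, Q (sphereReflect p) = -Q p) {lam : ℝ} {u : L2R3} :
    ¬ IsEigenfunction (potential Q) lam u := by
  intro h
  have hpos := h.pos_of_odd hQ hb hodd
  obtain ⟨hu, -, w, hL, hae⟩ := id h
  obtain ⟨G, C, -, -, -, hex⟩ := exists_kernel
  obtain ⟨φ, g, h1, h2, h3, hg, hug, -⟩ := hex u w hL
  have hv := h.virial_le hQ hb hg hug
  have hA : 0 ≤ ∫ p : S2, ‖g p‖ ^ 2 ∂surface := integral_nonneg fun p => sq_nonneg _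
  have hu2 : 0 < ‖u‖ ^ 2 := by
    have := norm_pos_iff.2 hu
    positivity
  rcases le_or_gt lam 1 with hlam | hlam
  · have h4 := integral_ball_le_of_eigenfunction hlam hae h1 h2 h3 hg
    nlinarith [mul_pos hpos hu2]
  · have h5 : ∫ x, ballInd x * ‖u x‖ ^ 2 ≤ ‖u‖ ^ 2 := by
      rw [norm_sq_eq_integral]
      refine integral_mono (integrable_mul_norm_sq measurable_ballInd abs_ballInd_le u)
        ?_ fun x => mul_le_of_le_one_left (sq_nonneg _) (_root_.abs_le.1 (abs_ballInd_le x)).2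
      simpa using integrable_mul_norm_sq (measurable_const (a := (1 : ℝ)))
        (fun x => (abs_one (α := ℝ)).le) u
    nlinarith [mul_lt_mul_of_pos_right hlam hu2]

end Virial

end HomPot

namespace HomPot

section Regions

variable {P : ℝ → ℝ}

theorem phaseReflect_phaseReflect (z : Phase) : phaseReflect (phaseReflect z) = z :=
  Prod.ext (reflect_reflect _) (reflect_reflect _)

theorem colatitude_le_iff (p : S2) : colatitude p ≤ Real.pi / 2 ↔ 0 ≤ (p : R3) 2 :=
  Real.arccos_le_pi_div_two

theorem coe_radialProj_two (x : R3) (hx : x ≠ 0) :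
    ((radialProj x hx : S2) : R3) 2 = ‖x‖⁻¹ * x 2 := rfl

theorem evenExt_sphereReflect (P : ℝ → ℝ) (p : S2) : evenExt P (sphereReflect p) = evenExt P p := by
  unfold evenExt
  rw [colatitude_sphereReflect]
  rcases lt_trichotomy (colatitude p) (Real.pi / 2) with h | h | h
  · rw [if_neg (by linarith), if_pos h.le, sub_sub_cancel]
  · rw [h, if_pos (by linarith), if_pos le_rfl, show Real.pi - Real.pi / 2 = Real.pi / 2 by ring]
  · rw [if_pos (by linarith), if_neg (by linarith)]

theorem potential_of_ge (Q : S2 → ℝ) {x : R3} (hx : x ≠ 0) (h1 : 1 ≤ ‖x‖) :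
    potential Q x = (‖x‖ ^ 2)⁻¹ * Q (radialProj x hx) := by
  rw [potential, dif_neg hx, if_pos h1]

theorem ne_zero_of_one_le_norm {x : R3} (h1 : 1 ≤ ‖x‖) : x ≠ 0 := by
  rintro rfl
  rw [norm_zero] at h1
  linarith

theorem potential_evenExt_reflect (P : ℝ → ℝ) (x : R3) :
    potential (evenExt P) (reflect x) = potential (evenExt P) x := by
  rcases lt_or_ge ‖x‖ 1 with h | h
  · rw [potential_of_lt h, potential_of_lt (by rwa [norm_reflect])]
  · have hx := ne_zero_of_one_le_norm h
    have h' : 1 ≤ ‖reflect x‖ := by rwa [norm_reflect]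
    have hp : radialProj (reflect x) (ne_zero_of_one_le_norm h') =
        sphereReflect (radialProj x hx) := by
      refine Subtype.ext ?_
      change ‖reflect x‖⁻¹ • reflect x = reflect (‖x‖⁻¹ • x)
      rw [norm_reflect]
      exact (reflectIso.map_smul ‖x‖⁻¹ x).symm
    rw [potential_of_ge _ hx h, potential_of_ge _ (ne_zero_of_one_le_norm h') h', hp,
      evenExt_sphereReflect, norm_reflect]

theorem potential_oddExt_of_nonneg {x : R3} (hx : 0 ≤ x 2) :
    potential (oddExt P) x = potential (evenExt P) x := by
  rcases lt_or_ge ‖x‖ 1 with h | h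
  · rw [potential_of_lt h, potential_of_lt h]
  · have hx0 := ne_zero_of_one_le_norm h
    have h1 : colatitude (radialProj x hx0) ≤ Real.pi / 2 := by
      rw [colatitude_le_iff, coe_radialProj_two]
      positivity
    rw [potential_of_ge _ hx0 h, potential_of_ge _ hx0 h, oddExt, evenExt, if_pos h1, if_pos h1]

theorem IsProfile.potential_oddExt_nonneg (hP : IsProfile P) {x : R3} (hx : x 2 ≤ 0) :
    0 ≤ potential (oddExt P) x := by
  rcases lt_or_ge ‖x‖ 1 with h | h
  · rw [potential_of_lt h]
    exact zero_le_one
  · have hx0 := ne_zero_of_one_le_norm h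
    rw [potential_of_ge _ hx0 h]
    refine mul_nonneg (by positivity) ?_
    have h1 : Real.pi / 2 ≤ colatitude (radialProj x hx0) := by
      rw [colatitude, Real.arccos, coe_radialProj_two, le_sub_self_iff, Real.arcsin_nonpos]
      exact mul_nonpos_of_nonneg_of_nonpos (by positivity) hx
    have h2 := colatitude_le_pi (radialProj x hx0)
    unfold oddExt
    split_ifs with h3
    · rw [le_antisymm h3 h1, hP.end_eq]
    · exact neg_nonneg.2 (hP.nonpos (by linarith) (by linarith))

theorem IsProfile.mem_region_oddExt (hP : IsProfile P) {E : ℝ} (hE : 0 ≤ E) {z : Phase} :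
    z ∈ region (potential (oddExt P)) E ↔
      0 < z.1 2 ∧ z ∈ region (potential (evenExt P)) E := by
  constructor
  · intro hz
    have h0 : 0 < z.1 2 := by
      by_contra h
      have h1 : ‖z.2‖ ^ 2 + potential (oddExt P) z.1 < -E := hz
      have h2 := hP.potential_oddExt_nonneg (not_lt.1 h)
      nlinarith [sq_nonneg ‖z.2‖]
    refine ⟨h0, ?_⟩
    have h1 : ‖z.2‖ ^ 2 + potential (oddExt P) z.1 < -E := hz
    rwa [potential_oddExt_of_nonneg h0.le] at h1
  · rintro ⟨h0, h1⟩
    have h1 : ‖z.2‖ ^ 2 + potential (evenExt P) z.1 < -E := h1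
    rwa [← potential_oddExt_of_nonneg h0.le] at h1

theorem phaseReflect_mem_region_evenExt {E : ℝ} {z : Phase} :
    phaseReflect z ∈ region (potential (evenExt P)) E ↔
      z ∈ region (potential (evenExt P)) E := by
  simp only [region, mem_ofPred_eq, phaseReflect, norm_reflect, potential_evenExt_reflect]

theorem IsProfile.mem_image_region_oddExt (hP : IsProfile P) {E : ℝ} (hE : 0 ≤ E) {z : Phase} :
    z ∈ phaseReflect '' region (potential (oddExt P)) E ↔
      z.1 2 < 0 ∧ z ∈ region (potential (evenExt P)) E := by
  constructor
  · rintro ⟨y, hy, rfl⟩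
    obtain ⟨h0, h1⟩ := (hP.mem_region_oddExt hE).1 hy
    refine ⟨?_, phaseReflect_mem_region_evenExt.2 h1⟩
    change -(y.1 2) < 0
    linarith
  · rintro ⟨h0, h1⟩
    refine ⟨phaseReflect z, (hP.mem_region_oddExt hE).2 ⟨?_, ?_⟩, phaseReflect_phaseReflect z⟩
    · change 0 < -(z.1 2)
      linarith
    · exact phaseReflect_mem_region_evenExt.2 h1

theorem IsProfile.region_evenExt (hP : IsProfile P) {E : ℝ} (hE : 0 ≤ E) :
    region (potential (evenExt P)) E = region (potential (oddExt P)) E ∪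
      phaseReflect '' region (potential (oddExt P)) E := by
  ext z
  rw [mem_union, hP.mem_region_oddExt hE, hP.mem_image_region_oddExt hE]
  constructor
  · intro hz
    rcases lt_trichotomy (z.1 2) 0 with h | h | h
    · exact Or.inr ⟨h, hz⟩
    · have h1 : ‖z.2‖ ^ 2 + potential (evenExt P) z.1 < -E := hz
      rw [← potential_oddExt_of_nonneg h.ge] at h1
      have h2 := hP.potential_oddExt_nonneg h.le
      nlinarith [sq_nonneg ‖z.2‖]
    · exact Or.inl ⟨h, hz⟩
  · rintro (h | h)
    exacts [h.2, h.2]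

theorem IsProfile.disjoint_region (hP : IsProfile P) {E : ℝ} (hE : 0 ≤ E) :
    Disjoint (region (potential (oddExt P)) E)
      (phaseReflect '' region (potential (oddExt P)) E) := by
  rw [disjoint_left]
  intro z h1 h2
  have h3 := ((hP.mem_region_oddExt hE).1 h1).1
  have h4 := ((hP.mem_image_region_oddExt hE).1 h2).1
  linarith

end Regions

section Packing

variable {𝒬 : Set (Set Phase)} {R R' : Set Phase} {𝒮 𝒮' : Set (Set Phase)}

theorem phaseReflect_injective : Function.Injective phaseReflect :=
  Function.LeftInverse.injective phaseReflect_phaseReflect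

theorem image_phaseReflect_injective :
    Function.Injective fun Q : Set Phase => phaseReflect '' Q :=
  phaseReflect_injective.image_injective

theorem image_image_phaseReflect (R : Set Phase) : phaseReflect '' (phaseReflect '' R) = R := by
  rw [image_image]
  simp only [phaseReflect_phaseReflect, image_id']

theorem IsPacking.reflect (h𝒬 : IsTestFamily 𝒬) (h : IsPacking 𝒬 R 𝒮) :
    IsPacking 𝒬 (phaseReflect '' R) ((fun Q => phaseReflect '' Q) '' 𝒮) := by
  obtain ⟨h1, h2, h3⟩ := h
  refine ⟨?_, ?_, ?_⟩
  · rintro _ ⟨Q, hQ, rfl⟩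
    exact h𝒬.2 Q (h1 hQ)
  · rintro _ ⟨Q, hQ, rfl⟩
    exact image_mono (h2 Q hQ)
  · rintro _ ⟨Q, hQ, rfl⟩ _ ⟨Q', hQ', rfl⟩ hne
    refine (disjoint_image_iff phaseReflect_injective).2 (h3 hQ hQ' ?_)
    rintro rfl
    exact hne rfl

theorem IsPacking.mono (h : IsPacking 𝒬 R 𝒮) (hR : R ⊆ R') : IsPacking 𝒬 R' 𝒮 :=
  ⟨h.1, fun Q hQ => (h.2.1 Q hQ).trans hR, h.2.2⟩

theorem IsPacking.union (h𝒬 : IsTestFamily 𝒬) (h : IsPacking 𝒬 R 𝒮) (h' : IsPacking 𝒬 R' 𝒮')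
    (hd : Disjoint R R') : IsPacking 𝒬 (R ∪ R') (𝒮 ∪ 𝒮') ∧ Disjoint 𝒮 𝒮' := by
  refine ⟨⟨union_subset h.1 h'.1, ?_, ?_⟩, ?_⟩
  · rintro Q (hQ | hQ)
    · exact (h.2.1 Q hQ).trans subset_union_left
    · exact (h'.2.1 Q hQ).trans subset_union_right
  · rintro Q (hQ | hQ) Q' (hQ' | hQ') hne
    · exact h.2.2 hQ hQ' hne
    · exact hd.mono (h.2.1 Q hQ) (h'.2.1 Q' hQ')
    · exact (hd.mono (h.2.1 Q' hQ') (h'.2.1 Q hQ)).symm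
    · exact h'.2.2 hQ hQ' hne
  · rw [disjoint_left]
    intro Q hQ hQ'
    obtain ⟨z, hz⟩ := (h𝒬.1 Q (h.1 hQ)).nonempty
    exact disjoint_left.1 hd (h.2.1 Q hQ hz) (h'.2.1 Q hQ' hz)

theorem IsPacking.encard_le (h : IsPacking 𝒬 R 𝒮) : 𝒮.encard ≤ packingNumber 𝒬 R :=
  le_iSup₂_of_le (f := fun 𝒮 (_ : 𝒮 ∈ {𝒮 | IsPacking 𝒬 R 𝒮}) => 𝒮.encard) 𝒮 h le_rfl

/-- A packing of a region and its mirror image splits when the two are separated by the plane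
of the equator. -/
theorem IsPacking.split (h𝒬 : IsTestFamily 𝒬) (hR : ∀ z ∈ R, 0 < z.1 2)
    (hR' : ∀ z ∈ R', z.1 2 < 0) (h : IsPacking 𝒬 (R ∪ R') 𝒮) :
    ∃ 𝒮₁ 𝒮₂, IsPacking 𝒬 R 𝒮₁ ∧ IsPacking 𝒬 R' 𝒮₂ ∧ 𝒮 = 𝒮₁ ∪ 𝒮₂ := by
  refine ⟨{Q ∈ 𝒮 | Q ⊆ R}, {Q ∈ 𝒮 | Q ⊆ R'}, ⟨fun Q hQ => h.1 hQ.1, fun Q hQ => hQ.2,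
    h.2.2.subset fun Q hQ => hQ.1⟩, ⟨fun Q hQ => h.1 hQ.1, fun Q hQ => hQ.2,
    h.2.2.subset fun Q hQ => hQ.1⟩, ?_⟩
  refine Subset.antisymm (fun Q hQ => ?_) (union_subset (fun Q hQ => hQ.1) fun Q hQ => hQ.1)
  have hc : Continuous fun z : Phase => z.1 2 := by fun_prop
  have hsub := h.2.1 Q hQ
  rcases (h𝒬.1 Q (h.1 hQ)).isPreconnected.subset_or_subset
    (isOpen_lt continuous_const hc) (isOpen_lt hc continuous_const)
    (by
      rw [disjoint_left]
      intro z hz hz'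
      exact lt_asymm (mem_ofPred.1 hz) (mem_ofPred.1 hz'))
    (show Q ⊆ {z : Phase | 0 < z.1 2} ∪ {z | z.1 2 < 0} from fun z hz =>
      (hsub hz).imp (hR z) (hR' z)) with h1 | h1
  · refine Or.inl ⟨hQ, fun z hz => (hsub hz).resolve_right fun h2 => ?_⟩
    exact lt_asymm (mem_ofPred.1 (h1 hz)) (hR' z h2)
  · refine Or.inr ⟨hQ, fun z hz => (hsub hz).resolve_left fun h2 => ?_⟩
    exact lt_asymm (mem_ofPred.1 (h1 hz)) (hR z h2)

theorem packingNumber_union_reflect (h𝒬 : IsTestFamily 𝒬) (hR : ∀ z ∈ R, 0 < z.1 2)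
    (hR' : ∀ z ∈ phaseReflect '' R, z.1 2 < 0) :
    packingNumber 𝒬 (R ∪ phaseReflect '' R) = 2 * packingNumber 𝒬 R := by
  have hd : Disjoint R (phaseReflect '' R) := disjoint_left.2 fun z h1 h2 =>
    lt_asymm (hR z h1) (hR' z h2)
  refine le_antisymm ?_ ?_
  · refine iSup₂_le fun 𝒮 h𝒮 => ?_
    obtain ⟨𝒮₁, 𝒮₂, h1, h2, rfl⟩ := IsPacking.split h𝒬 hR hR' h𝒮
    refine (encard_union_le _ _).trans ?_
    have h3 := h2.reflect h𝒬
    rw [image_image_phaseReflect] at h3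
    have h4 := h3.encard_le
    rw [image_phaseReflect_injective.encard_image] at h4
    rw [two_mul]
    exact add_le_add h1.encard_le h4
  · rw [packingNumber, ENat.mul_iSup]
    refine iSup_le fun 𝒮 => ?_
    rw [ENat.mul_iSup]
    refine iSup_le fun h𝒮 => ?_
    have h𝒮 : IsPacking 𝒬 R 𝒮 := h𝒮
    obtain ⟨h1, h2⟩ := h𝒮.union h𝒬 (h𝒮.reflect h𝒬) hd
    have h3 := h1.encard_le
    rwa [encard_union_eq h2, image_phaseReflect_injective.encard_image, ← two_mul] at h3

theorem exists_infinite_packing_iff (h𝒬 : IsTestFamily 𝒬) (hR : ∀ z ∈ R, 0 < z.1 2)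
    (hR' : ∀ z ∈ phaseReflect '' R, z.1 2 < 0) :
    (∃ 𝒮, IsPacking 𝒬 (R ∪ phaseReflect '' R) 𝒮 ∧ 𝒮.Infinite) ↔
      ∃ 𝒮, IsPacking 𝒬 R 𝒮 ∧ 𝒮.Infinite := by
  constructor
  · rintro ⟨𝒮, h𝒮, hinf⟩
    obtain ⟨𝒮₁, 𝒮₂, h1, h2, rfl⟩ := IsPacking.split h𝒬 hR hR' h𝒮
    rcases infinite_union.1 hinf with h | h
    · exact ⟨𝒮₁, h1, h⟩
    · have h3 := h2.reflect h𝒬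
      rw [image_image_phaseReflect] at h3
      exact ⟨_, h3, h.image image_phaseReflect_injective.injOn⟩
  · rintro ⟨𝒮, h𝒮, hinf⟩
    exact ⟨𝒮, h𝒮.mono subset_union_left, hinf⟩

end Packing

section Counting

open scoped InnerProductSpace

variable {V : R3 → ℝ} {C : ℝ}

theorem IsEigenfunction.inner_eq_zero (hV : Measurable V) (hC : ∀ x, |V x| ≤ C) {lam lam' : ℝ}
    {u u' : L2R3} (h : IsEigenfunction V lam u) (h' : IsEigenfunction V lam' u')
    (hne : lam ≠ lam') : ⟪u, u'⟫_ℂ = 0 := by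
  obtain ⟨-, -, w, hL, hae⟩ := h
  obtain ⟨-, -, w', hL', hae'⟩ := h'
  set M := mulOp volume hV hC
  have key : ∀ {a b : L2R3} {t : ℝ}, (∀ᵐ x, b x + (V x : ℂ) * a x = (t : ℂ) * a x) →
      b = (t : ℂ) • a - M a := by
    intro a b t hab
    refine Lp.ext ?_
    filter_upwards [hab, Lp.coeFn_sub ((t : ℂ) • a) (M a), mulOp_ae hV hC a,
      Lp.coeFn_smul (t : ℂ) a] with x e1 e2 e3 e4
    rw [e2, Pi.sub_apply, e3, e4, Pi.smul_apply, smul_eq_mul, eq_sub_of_add_eq e1]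
  have h1 := HasLaplacian.inner_comm hL hL'
  rw [key hae, key hae', inner_sub_left, inner_sub_right, inner_smul_left, inner_smul_right,
    Complex.conj_ofReal] at h1
  have h2 : ⟪M u, u'⟫_ℂ = ⟪u, M u'⟫_ℂ := mulOp_symmetric hV hC u u'
  rw [h2] at h1
  have h3 : ((lam : ℂ) - lam') * ⟪u, u'⟫_ℂ = 0 := by linear_combination h1
  refine (mul_eq_zero.1 h3).resolve_left ?_
  refine sub_ne_zero.2 ?_
  exact_mod_cast hne

/-- The counting function is unbounded if there are infinitely many negative eigenvalues. -/
theorem exists_le_countBelow (hV : Measurable V) (hC : ∀ x, |V x| ≤ C)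
    (hinf : {lam ∈ eigenvalues V | lam < 0}.Infinite) (N : ℕ) :
    ∃ E : ℝ, 0 < E ∧ (N : ℕ∞) ≤ countBelow V E := by
  obtain ⟨t, ht, hcard⟩ := hinf.exists_subset_card_eq N
  have hE : ∃ E : ℝ, 0 < E ∧ ∀ lam ∈ t, lam < -E := by
    rcases t.eq_empty_or_nonempty with rfl | hne
    · exact ⟨1, one_pos, by simp⟩
    · have h1 : t.max' hne < 0 := (ht (t.max'_mem hne)).2
      refine ⟨-(t.max' hne) / 2, by linarith, fun lam hlam => ?_⟩
      have := t.le_max' lam hlam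
      linarith
  obtain ⟨E, hE, hlt⟩ := hE
  refine ⟨E, hE, ?_⟩
  choose u hu using fun lam : t => (ht lam.2).1
  have hli : LinearIndependent ℂ u := by
    refine linearIndependent_of_ne_zero_of_inner_eq_zero (𝕜 := ℂ) (fun i => (hu i).1)
      fun i j hij => ?_
    exact (hu i).inner_eq_zero hV hC (hu j) fun h => hij (Subtype.ext h)
  let W := Submodule.span ℂ {u : L2R3 | ∃ lam < -E, IsEigenfunction V lam u}
  let v : t → W := fun i => ⟨u i, Submodule.subset_span ⟨i, hlt i i.2, hu i⟩⟩
  have hv : LinearIndependent ℂ v := LinearIndependent.of_comp W.subtype hli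
  have h1 := hv.cardinal_le_rank
  rw [Cardinal.mk_coe_finset, hcard] at h1
  exact Cardinal.natCast_le_toENat.2 h1

theorem countBelow_eq_zero (h : ∀ lam u, ¬ IsEigenfunction V lam u) (E : ℝ) :
    countBelow V E = 0 := by
  have h1 : {u : L2R3 | ∃ lam < -E, IsEigenfunction V lam u} = ∅ := by
    ext u
    simp only [mem_ofPred_eq, mem_empty_iff_false, iff_false]
    rintro ⟨lam, -, hu⟩
    exact h lam u hu
  rw [countBelow, h1, Submodule.span_empty, rank_bot, map_zero]

end Counting

section Canonical

/-- The reflection of phase space as a linear map. -/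
noncomputable def phaseReflectEquiv : Phase ≃L[ℝ] Phase :=
  reflectIso.toContinuousLinearEquiv.prodCongr reflectIso.toContinuousLinearEquiv

theorem coe_phaseReflectEquiv : ⇑phaseReflectEquiv = phaseReflect := rfl

theorem symplecticForm_phaseReflect (v w : Phase) :
    symplecticForm (phaseReflect v) (phaseReflect w) = symplecticForm v w := by
  have h1 : inner ℝ (reflect v.1) (reflect w.2) = inner ℝ v.1 w.2 := reflectIso.inner_map_map _ _
  have h2 : inner ℝ (reflect v.2) (reflect w.1) = inner ℝ v.2 w.1 := reflectIso.inner_map_map _ _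
  simp only [symplecticForm, phaseReflect, h1, h2]

theorem IsCanonical.phaseReflect_comp {Φ : Phase → Phase} (h : IsCanonical Φ) :
    IsCanonical (phaseReflect ∘ Φ) := by
  obtain ⟨h1, h2, h3⟩ := h
  refine ⟨phaseReflectEquiv.contDiff.comp_contDiffOn h1, phaseReflect_injective.comp_injOn h2,
    fun z hz v w => ?_⟩
  rw [← coe_phaseReflectEquiv, phaseReflectEquiv.comp_fderiv]
  exact (symplecticForm_phaseReflect _ _).trans (h3 z hz v w)

theorem isConnected_unitCube : IsConnected unitCube := by
  have hconv : Convex ℝ unitCube := by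
    have h : unitCube = ⋂ i : Fin 3, ({z : Phase | z.1 i ∈ Ioo (0 : ℝ) 1} ∩
        {z : Phase | z.2 i ∈ Ioo (0 : ℝ) 1}) := by
      ext z
      simp [unitCube]
    rw [h]
    refine convex_iInter fun i => Convex.inter ?_ ?_
    · exact (convex_Ioo (0 : ℝ) 1).linear_preimage
        ((EuclideanSpace.projₗ (𝕜 := ℝ) i).comp (LinearMap.fst ℝ R3 R3))
    · exact (convex_Ioo (0 : ℝ) 1).linear_preimage
        ((EuclideanSpace.projₗ (𝕜 := ℝ) i).comp (LinearMap.snd ℝ R3 R3))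
  refine ⟨⟨(WithLp.toLp 2 fun _ => 1 / 2, WithLp.toLp 2 fun _ => 1 / 2), fun i => ?_⟩,
    hconv.isPreconnected⟩
  norm_num

theorem isTestFamily_images {𝒯 : Set (Phase → Phase)} (h : ∀ Φ ∈ 𝒯, IsCanonical Φ)
    (hρ : ∀ Φ ∈ 𝒯, phaseReflect ∘ Φ ∈ 𝒯) :
    IsTestFamily {Q | ∃ Φ ∈ 𝒯, Q = Φ '' unitCube} := by
  constructor
  · rintro _ ⟨Φ, hΦ, rfl⟩
    exact isConnected_unitCube.image Φ (h Φ hΦ).1.continuousOn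
  · rintro _ ⟨Φ, hΦ, rfl⟩
    exact ⟨phaseReflect ∘ Φ, hρ Φ hΦ, (image_comp _ _ _).symm⟩

end Canonical

section PackingEstimate

variable {P : ℝ → ℝ}

theorem IsProfile.packingNumber_evenExt (hP : IsProfile P) {𝒬 : Set (Set Phase)}
    (h𝒬 : IsTestFamily 𝒬) {E : ℝ} (hE : 0 ≤ E) :
    packingNumber 𝒬 (region (potential (evenExt P)) E) =
      2 * packingNumber 𝒬 (region (potential (oddExt P)) E) := by
  rw [hP.region_evenExt hE]
  exact packingNumber_union_reflect h𝒬 (fun z hz => ((hP.mem_region_oddExt hE).1 hz).1)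
    fun z hz => ((hP.mem_image_region_oddExt hE).1 hz).1

theorem IsProfile.exists_infinite_packing_evenExt (hP : IsProfile P) {𝒬 : Set (Set Phase)}
    (h𝒬 : IsTestFamily 𝒬) {E : ℝ} (hE : 0 ≤ E) :
    (∃ 𝒮, IsPacking 𝒬 (region (potential (evenExt P)) E) 𝒮 ∧ 𝒮.Infinite) ↔
      ∃ 𝒮, IsPacking 𝒬 (region (potential (oddExt P)) E) 𝒮 ∧ 𝒮.Infinite := by
  rw [hP.region_evenExt hE]
  exact exists_infinite_packing_iff h𝒬 (fun z hz => ((hP.mem_region_oddExt hE).1 hz).1)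
    fun z hz => ((hP.mem_image_region_oddExt hE).1 hz).1

theorem IsProfile.not_isEigenfunction_oddExt (hP : IsProfile P) (lam : ℝ) (u : L2R3) :
    ¬ IsEigenfunction (potential (oddExt P)) lam u :=
  not_isEigenfunction_of_odd hP.measurable_oddExt hP.abs_oddExt_le hP.oddExt_sphereReflect

theorem IsProfile.infinite_eigenvalues_evenExt (hP : IsProfile P) :
    {lam ∈ eigenvalues (potential (evenExt P)) | lam < 0}.Infinite :=
  infinite_negative_eigenvalues hP.measurable_evenExt hP.abs_evenExt_le hP.integral_evenExt_lt

theorem IsProfile.not_exists_packingEstimate (hP : IsProfile P) {𝒬 : Set (Set Phase)}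
    (h𝒬 : IsTestFamily 𝒬) : ¬ ∃ C : ℕ, PackingEstimate 𝒬 (potential (evenExt P)) C ∧
      PackingEstimate 𝒬 (potential (oddExt P)) C := by
  rintro ⟨C, hev, hodd⟩
  obtain ⟨E, hE, hN⟩ := exists_le_countBelow (measurable_potential hP.measurable_evenExt)
    (abs_potential_le hP.abs_evenExt_le) hP.infinite_eigenvalues_evenExt (C * (2 * C + 1) + 1)
  have h1 := (hodd E hE).2
  rw [countBelow_eq_zero hP.not_isEigenfunction_oddExt, zero_add, mul_one] at h1
  have h2 := (hev E hE).1
  rw [hP.packingNumber_evenExt h𝒬 hE.le] at h2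
  have h3 : countBelow (potential (evenExt P)) E ≤ ((C * (2 * C + 1) : ℕ) : ℕ∞) := by
    refine h2.trans ?_
    push_cast
    gcongr
  have h4 := hN.trans h3
  rw [Nat.cast_le] at h4
  omega

end PackingEstimate

end HomPot

theorem mainTheorem5 (ε : ℝ) (hε : 0 < ε) (hε' : ε < 1 / 100) (P : ℝ → ℝ)
    (hP_cap : ∀ θ, 0 ≤ θ → θ < Real.pi / 2 - 2 * ε → P θ = -1 / 3)
    (hP_eq : ∀ θ, Real.pi / 2 - ε < θ → θ ≤ Real.pi / 2 → P θ = 0)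
    (hP_mono : MonotoneOn P (Set.Icc 0 (Real.pi / 2))) :
    -- lowest eigenvalues on the sphere
    (∃ μ, IsLeast (HomPot.sphereEigenvalues (HomPot.evenExt P)) μ ∧ μ < -1 / 4) ∧
    (∃ μ, IsLeast (HomPot.sphereEigenvalues (HomPot.oddExt P)) μ ∧
      -1 / 18 ≤ μ ∧ -1 / 4 < μ) ∧
    -- the operator with the odd angular part has finitely many eigenvalues, with multiplicity
    (HomPot.eigenvalues (HomPot.potential (HomPot.oddExt P))).Finite ∧
    FiniteDimensional ℂ (Submodule.span ℂ
      {u | ∃ lam, HomPot.IsEigenfunction (HomPot.potential (HomPot.oddExt P)) lam u}) ∧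
    -- the operator with the even angular part has infinitely many negative eigenvalues
    {lam ∈ HomPot.eigenvalues (HomPot.potential (HomPot.evenExt P)) | lam < 0}.Infinite ∧
    -- the even region of phase space consists of two disjoint copies of the odd one
    (∀ E : ℝ, 0 ≤ E →
      HomPot.region (HomPot.potential (HomPot.evenExt P)) E =
        HomPot.region (HomPot.potential (HomPot.oddExt P)) E ∪
          HomPot.phaseReflect '' HomPot.region (HomPot.potential (HomPot.oddExt P)) E ∧
      Disjoint (HomPot.region (HomPot.potential (HomPot.oddExt P)) E)
        (HomPot.phaseReflect '' HomPot.region (HomPot.potential (HomPot.oddExt P)) E)) ∧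
    (∀ 𝒬 : Set (Set HomPot.Phase), HomPot.IsTestFamily 𝒬 →
      (∀ E : ℝ, 0 ≤ E →
        HomPot.packingNumber 𝒬 (HomPot.region (HomPot.potential (HomPot.evenExt P)) E) =
          2 * HomPot.packingNumber 𝒬 (HomPot.region (HomPot.potential (HomPot.oddExt P)) E) ∧
        ((∃ 𝒮, HomPot.IsPacking 𝒬
            (HomPot.region (HomPot.potential (HomPot.evenExt P)) E) 𝒮 ∧ 𝒮.Infinite) ↔
          ∃ 𝒮, HomPot.IsPacking 𝒬
            (HomPot.region (HomPot.potential (HomPot.oddExt P)) E) 𝒮 ∧ 𝒮.Infinite)) ∧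
      ¬ ∃ C : ℕ, HomPot.PackingEstimate 𝒬 (HomPot.potential (HomPot.evenExt P)) C ∧
        HomPot.PackingEstimate 𝒬 (HomPot.potential (HomPot.oddExt P)) C) ∧
    -- canonical images of the unit cube are such test regions, whatever further
    -- reflection-invariant condition is placed on the canonical transformations
    (∀ Φ, HomPot.IsCanonical Φ → HomPot.IsCanonical (HomPot.phaseReflect ∘ Φ)) ∧
    (∀ 𝒯 : Set (HomPot.Phase → HomPot.Phase), (∀ Φ ∈ 𝒯, HomPot.IsCanonical Φ) →
      (∀ Φ ∈ 𝒯, HomPot.phaseReflect ∘ Φ ∈ 𝒯) →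
      HomPot.IsTestFamily {Q | ∃ Φ ∈ 𝒯, Q = Φ '' HomPot.unitCube}) := by
  have hP : HomPot.IsProfile P :=
    ⟨hP_mono, hP_eq _ (by linarith) le_rfl, fun θ h0 h1 => hP_cap θ h0 (by linarith)⟩
  have hempty : {u | ∃ lam, HomPot.IsEigenfunction (HomPot.potential (HomPot.oddExt P)) lam u} =
      ∅ := by
    ext u
    simp only [Set.mem_ofPred_eq, Set.mem_empty_iff_false, iff_false, not_exists]
    exact fun lam => hP.not_isEigenfunction_oddExt lam u
  refine ⟨hP.exists_isLeast_evenExt, hP.exists_isLeast_oddExt, ?_, ?_,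
    hP.infinite_eigenvalues_evenExt, fun E hE => ⟨hP.region_evenExt hE, hP.disjoint_region hE⟩,
    fun 𝒬 h𝒬 => ⟨fun E hE => ⟨hP.packingNumber_evenExt h𝒬 hE,
      hP.exists_infinite_packing_evenExt h𝒬 hE⟩, hP.not_exists_packingEstimate h𝒬⟩,
    fun Φ hΦ => hΦ.phaseReflect_comp, fun 𝒯 h hρ => HomPot.isTestFamily_images h hρ⟩
  · refine Set.finite_empty.subset ?_
    rintro lam ⟨u, hu⟩
    exact hP.not_isEigenfunction_oddExt lam u hu
  · rw [hempty, Submodule.span_empty]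
    infer_instance
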